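/- **Setting.** States of Majorana modes $c_j$ are described by their real antisymmetric correlation matrix $\Gamma_{jl}=\frac i2\operatorname{Tr}(\rho[c_j,c_l])$, $\Gamma^T\Gamma\le 1$. A Gaussian fermion tensor on the square lattice has $p$ physical Majorana modes and $n$ Majorana modes on each of its four virtual legs (left, right, top, bottom); it is a pure Gaussian state of these modes, i.e. a real antisymmetric matrix $\Lambda$ with $\Lambda^T\Lambda=1$. It is *isometric* with a given set of incoming legs if the block of $\Lambda$ on the modes of the incoming legs vanishes. Tensors are contracted by projecting the virtual modes of each bond onto a maximally entangled reference state; the virtual modes on the incoming legs at the boundary of a finite network are contracted with an arbitrary Gaussian boundary (initial) state. * A translation-invariant 2D Gaussian fermion *isoTNS* on $\mathbb Z^2$ has an isometric tensor with incoming legs left and bottom at each site $(u,v)$: one tensor $T_0$ where $u+v$ is even and one tensor $T_1$ where $u+v$ is odd. Here $(u,v)$ are light-cone coordinates: the sites with $u+v=t$ are the layer $t$ of a brick-wall circuit, $(1,-1)$ is the spatial direction (one unit cell of two sites), and $(1,1)$ is the translation by two time steps. A nonzero direction $d=(d_1,d_2)\in\mathbb Z^2$ is *space-like* if $d_1d_2<0$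 and *light-like* if $d_1d_2=0$. * An *alt-isoTNS* has in its even rows an isometric tensor $T_0$ with incoming legs left and bottom, and in its odd rows an isometric tensor $T_1$ with incoming legs right and bottom (the horizontal arrows alternate from row to row). Its spatial direction is $(1,0)$. **Corollary.** (1) For every translation-invariant 2D Gaussian fermion isoTNS the physical two-point function has a bulk thermodynamic limit: there are $p\times p$ matrices $G(r,r')$, $r,r'\in\mathbb Z^2$, such that for all $r,r'$ and $\varepsilon>0$ there is an $R$ for which the physical two-point correlation matrix between $r$ and $r'$ of the network on any finite region containing the box $[-R,R]^2$ is entrywise within $\varepsilon$ of $G(r,r')$, whatever the boundary state. The region may be a region of the plane or of a cylinder $\mathbb Z^2/\mathbb Z w$ with $w=(w_1,w_2)$, $w_1\ge R$, $-w_2\ge R$, $w_1+w_2$ even (in particular of the ring of $L\ge R$ unit cells, $w=(L,-L)$). This $G$ decays exponentially along the spatial direction $(1,-1)$ and along every space-like and every light-like direction $d$: there is a $\xi>0$ such that for each offset $s\in\mathbb Z^2$ there is a $C$ with $$|G_{\alpha\beta}(r,\,r+s+md)|\le C e^{-|m|/\xi}\qquad\text{for all } r\in\mathbb Z^2,\ m\in\mathbb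 Z,\ 1\le\alpha,\beta\le p.$$ (2) For every such alt-isoTNS, the bulk thermodynamic limit $G$ of the physical two-point function exists in the same sense (for finite regions of the plane), and it decays exponentially, in the same sense, along its spatial direction $(1,0)$. -/

import Mathlib

/-! Gaussian fermion tensor networks on the square lattice, described by real antisymmetric
correlation matrices `Γ j l = (i/2) Tr (ρ [c j, c l])` of Majorana modes. -/

namespace GaussianTNS

/-- The four virtual legs of a tensor of the square lattice. -/
inductive Leg where
  | left
  | right
  | top
  | bottom
  deriving DecidableEq

instance : Fintype Leg where
  elems := {.left, .right, .top, .bottom}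
  complete := by intro x; cases x <;> simp

/-- The leg at the other end of a bond. -/
def Leg.opp : Leg → Leg
  | .left => .right
  | .right => .left
  | .top => .bottom
  | .bottom => .top

/-- The Majorana modes of one tensor: `p` physical modes and `n` modes on each virtual leg. -/
abbrev Mode (p n : ℕ) : Type := Fin p ⊕ (Leg × Fin n)

/-- Correlation matrix of a (possibly mixed) Gaussian state: real antisymmetric, `Γᵀ Γ ≤ 1`. -/
structure IsCorrelationMatrix {X : Type} [Fintype X] [DecidableEq X] (Γ : Matrix X X ℝ) :
    Prop where
  antisymm : Γ.transpose = -Γ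
  contraction : (1 - Γ.transpose * Γ).PosSemidef

/-- `Λ` is the correlation matrix of a Gaussian isometric tensor with incoming legs `inc`:
it is a pure Gaussian state of its physical and virtual modes, and the modes on the incoming
virtual legs are maximally mixed. Equivalently, the tensor is an isometry from the incoming legs
to the physical leg and the remaining (outgoing) virtual legs. -/
structure IsIsometricTensor {p n : ℕ} (inc : Leg → Prop)
    (Λ : Matrix (Mode p n) (Mode p n) ℝ) : Prop where
  antisymm : Λ.transpose = -Λ
  pure : Λ.transpose * Λ = 1
  isometric : ∀ a b : Leg, inc a → inc b → ∀ i j : Fin n, Λ (.inr (a, i)) (.inr (b, j)) = 0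

/-- A Gaussian tensor network on the lattice `A` (`ℤ²` or a quotient of it): the two unit lattice
vectors, the incoming legs of each site (all other legs are outgoing), and the correlation matrix
of the tensor at each site. -/
structure Network (A : Type) (p n : ℕ) where
  e₁ : A
  e₂ : A
  inc : A → Leg → Prop
  tensor : A → Matrix (Mode p n) (Mode p n) ℝ

namespace Network

variable {A : Type} [AddCommGroup A] {p n : ℕ}

/-- Displacement to the neighbour reached through a leg. -/
def step (N : Network A p n) : Leg → A
  | .left => -N.e₁
  | .right => N.e₁
  | .top => N.e₂
  | .bottom => -N.e₂

/-- In the network on the finite region `D`, leg `a` of site `s` is an incoming leg whose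
neighbour is not in `D`. These legs carry the boundary (initial) state. -/
def IsBoundaryLeg (N : Network A p n) (D : Finset A) (s : A) (a : Leg) : Prop :=
  N.inc s a ∧ s + N.step a ∉ D

open Classical in
/-- Joint correlation matrix of all the tensors in `D` before contraction. -/
noncomputable def tensorMatrix (N : Network A p n) (D : Finset A) :
    Matrix (D × Mode p n) (D × Mode p n) ℝ :=
  fun x y => if x.1 = y.1 then N.tensor x.1 x.2 y.2 else 0

open Classical in
/-- Correlation matrix of the state with which the virtual modes are contracted: a maximally
entangled reference state on each bond of `D` (entry `1` from the outgoing to the incoming end,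
`-1` from the incoming to the outgoing end), the state `Γ₀` on the boundary legs, and `0` on the
modes that are not contracted (physical modes, outgoing legs that leave `D`). -/
noncomputable def bondMatrix (N : Network A p n) (D : Finset A)
    (Γ₀ : Matrix (D × Leg × Fin n) (D × Leg × Fin n) ℝ) :
    Matrix (D × Mode p n) (D × Mode p n) ℝ :=
  fun x y =>
    match x, y with
    | (s, .inr (a, i)), (s', .inr (b, j)) =>
        if (s' : A) = s + N.step a ∧ b = a.opp then
          (if i = j then (if N.inc s a then -1 else 1) else 0)
        else if N.IsBoundaryLeg D s a ∧ N.IsBoundaryLeg D s' b then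
          Γ₀ (s, a, i) (s', b, j)
        else 0
    | _, _ => 0

open Classical in
/-- The contraction of Gaussian tensors. Writing `o` for the open and `c` for the contracted modes
and `Ω` for `bondMatrix`, the block of `(1 + Λ Ω)⁻¹ Λ` on the open modes is
`Λ_oo + Λ_oc Ω (1 + Λ_cc Ω)⁻¹ Λ_ocᵀ`, the usual Grassmann-integral formula for the correlation
matrix of the contracted Gaussian state. For a single isometric tensor with outgoing block `A`
and incoming-to-outgoing block `B` it is the Gaussian channel `A + B Γ₀ Bᵀ`. -/
noncomputable def contracted (N : Network A p n) (D : Finset A)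
    (Γ₀ : Matrix (D × Leg × Fin n) (D × Leg × Fin n) ℝ) :
    Matrix (D × Mode p n) (D × Mode p n) ℝ :=
  (1 + N.tensorMatrix D * N.bondMatrix D Γ₀)⁻¹ * N.tensorMatrix D

/-- Two-point correlation matrix of the physical modes at the sites `r` and `r'`, in the network
on the region `D` with boundary state `Γ₀`. -/
noncomputable def physCorr (N : Network A p n) (D : Finset A)
    (Γ₀ : Matrix (D × Leg × Fin n) (D × Leg × Fin n) ℝ) (r r' : D) :
    Matrix (Fin p) (Fin p) ℝ :=
  fun α β => N.contracted D Γ₀ (r, .inl α) (r', .inl β)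

end Network

/-- The lattice `ℤ²` rolled up along `w` (the plane itself for `w = 0`). -/
abbrev Cylinder (w : ℤ × ℤ) : Type := (ℤ × ℤ) ⧸ AddSubgroup.zmultiples w

/-- Incoming legs of an isometric tensor network state: left and bottom. -/
def isoIn (a : Leg) : Prop := a = .left ∨ a = .bottom

/-- Incoming legs in the reversed rows of an alternating network: right and bottom. -/
def altIn (a : Leg) : Prop := a = .right ∨ a = .bottom

/-- The translation-invariant isometric tensor network state with the tensor `T 0` on the
sublattice `u + v` even and `T 1` on the sublattice `u + v` odd. In the light-cone coordinates
`(u, v)` the sites with `u + v = t` form the layer `t` of a brick-wall circuit, `(1, -1)` is the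
translation by one unit cell in space and `(1, 1)` the translation by two steps in time. -/
noncomputable def isoTNS {p n : ℕ} (w : ℤ × ℤ)
    (T : ZMod 2 → Matrix (Mode p n) (Mode p n) ℝ) : Network (Cylinder w) p n where
  e₁ := ((1, 0) : ℤ × ℤ)
  e₂ := ((0, 1) : ℤ × ℤ)
  inc := fun _ a => isoIn a
  tensor := fun s => T ((s.out.1 + s.out.2 : ℤ) : ZMod 2)

/-- The alternating isometric tensor network state: the horizontal arrows point from left to right
in the even rows, with tensor `T 0`, and from right to left in the odd rows, with tensor `T 1`. -/
noncomputable def altIsoTNS {p n : ℕ}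
    (T : ZMod 2 → Matrix (Mode p n) (Mode p n) ℝ) : Network (ℤ × ℤ) p n where
  e₁ := (1, 0)
  e₂ := (0, 1)
  inc := fun s a => if Even s.2 then isoIn a else altIn a
  tensor := fun s => T (s.2 : ZMod 2)

/-- The box `[-R, R]²`. -/
def InBox (R : ℕ) (s : ℤ × ℤ) : Prop := |s.1| ≤ R ∧ |s.2| ≤ R

open Classical in
/-- `G` is the physical two-point function in the bulk of the isoTNS in the thermodynamic limit:
for every pair of sites, the two-point function of a finite network converges to `G` when the
region grows in all directions, uniformly in the shape of the region and in the boundary state,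
both in the plane and on cylinders whose circumference `w` is space-like, compatible with the
sublattices, and growing. -/
def IsBulkCorrelationIso {p n : ℕ} (T : ZMod 2 → Matrix (Mode p n) (Mode p n) ℝ)
    (G : ℤ × ℤ → ℤ × ℤ → Matrix (Fin p) (Fin p) ℝ) : Prop :=
  ∀ r r' : ℤ × ℤ, ∀ ε : ℝ, 0 < ε → ∃ R : ℕ,
    ∀ w : ℤ × ℤ, (w = 0 ∨ ((R : ℤ) ≤ w.1 ∧ (R : ℤ) ≤ -w.2 ∧ Even (w.1 + w.2))) →
    ∀ D : Finset (Cylinder w), (∀ s : ℤ × ℤ, InBox R s → (s : Cylinder w) ∈ D) →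
    ∀ Γ₀ : Matrix (D × Leg × Fin n) (D × Leg × Fin n) ℝ, IsCorrelationMatrix Γ₀ →
    ∀ (hr : (r : Cylinder w) ∈ D) (hr' : (r' : Cylinder w) ∈ D) (α β : Fin p),
      |(isoTNS w T).physCorr D Γ₀ ⟨r, hr⟩ ⟨r', hr'⟩ α β - G r r' α β| ≤ ε

/-- The same for the alternating isoTNS, in the plane. -/
def IsBulkCorrelationAlt {p n : ℕ} (T : ZMod 2 → Matrix (Mode p n) (Mode p n) ℝ)
    (G : ℤ × ℤ → ℤ × ℤ → Matrix (Fin p) (Fin p) ℝ) : Prop :=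
  ∀ r r' : ℤ × ℤ, ∀ ε : ℝ, 0 < ε → ∃ R : ℕ,
    ∀ D : Finset (ℤ × ℤ), (∀ s : ℤ × ℤ, InBox R s → s ∈ D) →
    ∀ Γ₀ : Matrix (D × Leg × Fin n) (D × Leg × Fin n) ℝ, IsCorrelationMatrix Γ₀ →
    ∀ (hr : r ∈ D) (hr' : r' ∈ D) (α β : Fin p),
      |(altIsoTNS T).physCorr D Γ₀ ⟨r, hr⟩ ⟨r', hr'⟩ α β - G r r' α β| ≤ ε

/-- `G` decays exponentially along `d`: the correlation length `ξ` depends only on `G` and `d`,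
the prefactor also on the fixed offset `s` between the two lines of sites. -/
def DecaysAlong {p : ℕ} (G : ℤ × ℤ → ℤ × ℤ → Matrix (Fin p) (Fin p) ℝ) (d : ℤ × ℤ) : Prop :=
  ∃ ξ : ℝ, 0 < ξ ∧ ∀ s : ℤ × ℤ, ∃ C : ℝ, ∀ (r : ℤ × ℤ) (m : ℤ) (α β : Fin p),
    |G r (r + s + m • d) α β| ≤ C * Real.exp (-|(m : ℝ)| / ξ)

end GaussianTNS

/-!
Everything is expressed through the *response* `v` of a network to a physical mode: `v s μ` is the
amplitude with which that physical mode depends on the mode `μ` at the site `s`. It solves the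
linear equation `v = source + pull v` (`Network.IsResponse`), in which `pull` propagates backward
along the arrows. By the block structure of the isometric tensors the outgoing part of a contraction
does not depend on the boundary state, so the two-point function of a finite network is
`∑ s, v s ⬝ᵥ Λ s *ᵥ v' s` plus a form in the boundary state (`Network.physCorr_eq`).

*Bulk limit.* Isometry conserves energy: the unit weight of the source is absorbed by the noise of
the tensors or leaves through the incoming boundary legs (`Network.energy_add_inFlux`), and both the
noise form and the boundary form are bounded by these energies. The norms `∑ s, ‖v s‖²` are bounded
on average over the position of the source, since `1 - L Lᵀ` is a projection for the backward step
`L` and the inverse of `1 - L` has unit diagonal (`Network.sum_response_le`). Translating good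
sources back and passing to an ultrafilter limit gives a square-summable response of the infinite
plane (`Network.IsPlane.exists_planeResponse`). It loses little energy outside of a large box, and
the response of a finite region containing the box is close to it there, because their difference
carries at most the energy of the tail. Hence the two-point functions converge to
`Network.bulkCorr`, the noise form of the responses of the plane. On a cylinder of space-like
circumference the past cone of a site does not wind around inside of the box, so that there the
responses even agree.

*Decay.* Let `(a, -b)` be a direction with `a, b ≥ 0` such that the function `b x₁ + a x₂`, which is
constant along it, does not decrease along the arrows of the network. The lattice is cut into strips
along this direction, on which a response is a vector of two-sided sequences, i.e. of elements of a
module over the Laurent polynomials.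
Backward propagation reads `(1 - H) Y_t = M Y_{t-1} + source` with matrices `H`, `M` of Laurent
polynomials, and `det (1 - H) ≠ 0` because nothing can be created without a source
(`Network.det_one_sub_transfer_ne_zero`). A sequence that tends to zero and becomes exponentially
decaying after multiplication with a nonzero Laurent polynomial decays exponentially itself
(`Seq.mem_expDecay_of_smul`), so every `Y_t` decays along the strip. The two-point function is a sum
over `t` of correlations of the components of `Y_t` and `Y'_t`. These correlations obey a linear
recursion in `t`; by the Cayley–Hamilton theorem, and since eigenvalues `1` of the recursion cannot
contribute to summable families, a nonzero Laurent polynomial maps the sum to an exponentially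
decaying sequence (`Seq.exists_smul_timeSum_mem`). The sum tends to zero by square-summability, and
therefore decays exponentially too (`Seq.exists_totalCorr_mem_expDecay`). The rate depends only on
`det (1 - H)` and on the recursion, not on the positions of the two sites.
-/

namespace GaussianTNS

open Matrix Finset Filter Topology
open scoped Classical

/-! ### A single isometric tensor -/

section SingleTensor

variable {p n : ℕ}

/-- The restriction of a vector of modes to the physical and outgoing modes. -/
noncomputable def outPart (inc : Leg → Prop) (v : Mode p n → ℝ) : Mode p n → ℝ
  | .inl α => v (.inl α)
  | .inr (a, i) => if inc a then 0 else v (.inr (a, i))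

/-- The restriction of a vector of modes to the incoming modes. -/
noncomputable def inPart (inc : Leg → Prop) (v : Mode p n → ℝ) : Mode p n → ℝ
  | .inl _ => 0
  | .inr (a, i) => if inc a then v (.inr (a, i)) else 0

/-- The vector `v` is supported on the physical and outgoing modes. -/
def IsOut (inc : Leg → Prop) (v : Mode p n → ℝ) : Prop :=
  ∀ a i, inc a → v (.inr (a, i)) = 0

variable {inc : Leg → Prop} {v v' : Mode p n → ℝ} {M : Matrix (Mode p n) (Mode p n) ℝ}

lemma outPart_add_inPart : outPart inc v + inPart inc v = v := by
  ext μ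
  rcases μ with α | ⟨a, i⟩
  · simp [outPart, inPart]
  · by_cases h : inc a <;> simp [outPart, inPart, h]

lemma isOut_outPart : IsOut inc (outPart inc v) := fun a i h => by simp [outPart, h]

lemma IsOut.outPart_eq (h : IsOut inc v) : outPart inc v = v := by
  ext μ
  rcases μ with α | ⟨a, i⟩
  · rfl
  · by_cases ha : inc a
    · simp [outPart, ha, h a i ha]
    · simp [outPart, ha]

lemma IsOut.add (hv : IsOut inc v) (hw : IsOut inc v') :
    IsOut inc (v + v') := fun a i h => by simp [hv a i h, hw a i h]

lemma IsOut.sub (hv : IsOut inc v) (hw : IsOut inc v') :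
    IsOut inc (v - v') := fun a i h => by simp [hv a i h, hw a i h]

lemma isOut_zero : IsOut inc (0 : Mode p n → ℝ) := fun _ _ _ => rfl

lemma outPart_sub : outPart inc (v - v') = outPart inc v - outPart inc v' := by
  ext μ
  rcases μ with α | ⟨a, i⟩
  · rfl
  · by_cases ha : inc a <;> simp [outPart, ha]

lemma IsOut.dotProduct_inPart (h : IsOut inc v) : v ⬝ᵥ inPart inc v' = 0 := by
  refine Finset.sum_eq_zero fun μ _ => ?_
  rcases μ with α | ⟨a, i⟩
  · simp [inPart]
  · by_cases ha : inc a
    · simp [h a i ha]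
    · simp [inPart, ha]

lemma IsOut.dotProduct_outPart (h : IsOut inc v) : v ⬝ᵥ outPart inc v' = v ⬝ᵥ v' := by
  conv_rhs => rw [← outPart_add_inPart (inc := inc) (v := v'), dotProduct_add,
    h.dotProduct_inPart, add_zero]

lemma dotProduct_self_eq_outPart_add_inPart :
    v ⬝ᵥ v = outPart inc v ⬝ᵥ outPart inc v + inPart inc v ⬝ᵥ inPart inc v := by
  conv_lhs => rw [← outPart_add_inPart (inc := inc) (v := v)]
  rw [add_dotProduct, dotProduct_add, dotProduct_add, isOut_outPart.dotProduct_inPart,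
    dotProduct_comm (inPart inc v), isOut_outPart.dotProduct_inPart]
  ring

lemma IsIsometricTensor.dotProduct_mulVec (h : IsIsometricTensor inc M) :
    v ⬝ᵥ M *ᵥ v' = -((M *ᵥ v) ⬝ᵥ v') := by
  rw [Matrix.dotProduct_mulVec, ← Matrix.mulVec_transpose, h.antisymm, neg_mulVec, neg_dotProduct]

lemma IsIsometricTensor.mulVec_mulVec (h : IsIsometricTensor inc M) :
    M *ᵥ (M *ᵥ v) = -v := by
  have h1 := h.pure
  rw [h.antisymm, neg_mul] at h1
  rw [Matrix.mulVec_mulVec, ← neg_neg (M * M), h1, neg_mulVec, one_mulVec]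

lemma IsIsometricTensor.dotProduct_mulVec_mulVec (h : IsIsometricTensor inc M) :
    (M *ᵥ v) ⬝ᵥ (M *ᵥ v') = v ⬝ᵥ v' := by
  rw [h.dotProduct_mulVec, h.mulVec_mulVec, neg_dotProduct, neg_neg]

lemma IsIsometricTensor.inPart_mulVec_inPart (h : IsIsometricTensor inc M) {a : Leg} (ha : inc a)
    (i : Fin n) : (M *ᵥ inPart inc v) (.inr (a, i)) = 0 := by
  change ∑ μ, M (.inr (a, i)) μ * inPart inc v μ = 0
  refine Finset.sum_eq_zero fun μ _ => ?_
  rcases μ with α | ⟨b, j⟩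
  · simp [inPart]
  · by_cases hb : inc b
    · simp [h.isometric a b ha hb i j]
    · simp [inPart, hb]

lemma IsIsometricTensor.mulVec_outPart (h : IsIsometricTensor inc M) {a : Leg} (ha : inc a)
    (i : Fin n) : (M *ᵥ outPart inc v) (.inr (a, i)) = (M *ᵥ v) (.inr (a, i)) := by
  conv_rhs => rw [← outPart_add_inPart (inc := inc) (v := v), mulVec_add, Pi.add_apply,
    h.inPart_mulVec_inPart ha, add_zero]

/-- With `A` the outgoing block of an isometric tensor, `A` is antisymmetric with `A³ = -A`, so
that the noise form `⟨v, A v'⟩` equals `⟨A v, A (A v')⟩`. -/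
lemma IsIsometricTensor.noise_form_eq (h : IsIsometricTensor inc M) (hv : IsOut inc v)
    (hv' : IsOut inc v') :
    v ⬝ᵥ M *ᵥ v' = outPart inc (M *ᵥ v) ⬝ᵥ M *ᵥ outPart inc (M *ᵥ v') := by
  have e1 : v ⬝ᵥ M *ᵥ v' = v ⬝ᵥ outPart inc (M *ᵥ v') := hv.dotProduct_outPart.symm
  have e2 : v ⬝ᵥ M *ᵥ v' = -(outPart inc (M *ᵥ v) ⬝ᵥ v') := by
    rw [h.dotProduct_mulVec, dotProduct_comm, ← hv'.dotProduct_outPart, dotProduct_comm]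
  have e3 : M *ᵥ outPart inc (M *ᵥ v') = -v' - M *ᵥ inPart inc (M *ᵥ v') := by
    rw [eq_sub_iff_add_eq, ← mulVec_add, outPart_add_inPart, h.mulVec_mulVec]
  have e4 : outPart inc (M *ᵥ v) ⬝ᵥ M *ᵥ inPart inc (M *ᵥ v') = 0 := by
    have : M *ᵥ outPart inc (M *ᵥ v) = -v - M *ᵥ inPart inc (M *ᵥ v) := by
      rw [eq_sub_iff_add_eq, ← mulVec_add, outPart_add_inPart, h.mulVec_mulVec]
    rw [h.dotProduct_mulVec, this, sub_dotProduct, neg_dotProduct, hv.dotProduct_inPart]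
    have h5 : IsOut inc (M *ᵥ inPart inc (M *ᵥ v)) := fun a i ha => h.inPart_mulVec_inPart ha i
    rw [h5.dotProduct_inPart]
    simp
  rw [e3, dotProduct_sub, e4, dotProduct_neg, sub_zero, e2]

/-- The squared norm of the outgoing part of `M v`: the weight with which `v` sees the noise
injected by the tensor `M`. -/
noncomputable def outEnergy (inc : Leg → Prop) (M : Matrix (Mode p n) (Mode p n) ℝ)
    (v : Mode p n → ℝ) : ℝ :=
  outPart inc (M *ᵥ v) ⬝ᵥ outPart inc (M *ᵥ v)

lemma dotProduct_self_nonneg' {ι : Type*} [Fintype ι] (v : ι → ℝ) : 0 ≤ v ⬝ᵥ v :=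
  Finset.sum_nonneg fun i _ => mul_self_nonneg (v i)

lemma outEnergy_nonneg : 0 ≤ outEnergy inc M v := dotProduct_self_nonneg' _

lemma IsIsometricTensor.outEnergy_add (h : IsIsometricTensor inc M) :
    outEnergy inc M v + inPart inc (M *ᵥ v) ⬝ᵥ inPart inc (M *ᵥ v) = v ⬝ᵥ v := by
  rw [outEnergy, ← dotProduct_self_eq_outPart_add_inPart, h.dotProduct_mulVec_mulVec]

lemma inPart_dotProduct_self :
    inPart inc v ⬝ᵥ inPart inc v =
      ∑ a, if inc a then ∑ i, v (.inr (a, i)) ^ 2 else 0 := by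
  simp only [dotProduct, Fintype.sum_sum_type, Fintype.sum_prod_type, inPart]
  simp only [mul_zero, Finset.sum_const_zero, zero_add]
  refine Finset.sum_congr rfl fun a _ => ?_
  by_cases h : inc a <;> simp [h, sq]

end SingleTensor

/-! ### Cauchy–Schwarz for the noise form -/

section CauchySchwarz

variable {ι : Type*} {p n : ℕ}

lemma abs_sum_dotProduct_le {κ : Type*} [Fintype κ] (F : Finset ι) (u u' : ι → κ → ℝ) :
    |∑ s ∈ F, u s ⬝ᵥ u' s| ≤ √(∑ s ∈ F, u s ⬝ᵥ u s) * √(∑ s ∈ F, u' s ⬝ᵥ u' s) := by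
  have h := Finset.sum_mul_sq_le_sq_mul_sq (F ×ˢ (Finset.univ : Finset κ))
    (fun x => u x.1 x.2) (fun x => u' x.1 x.2)
  simp only [Finset.sum_product] at h
  rw [← Real.sqrt_mul (Finset.sum_nonneg fun s _ => dotProduct_self_nonneg' _)]
  refine Real.le_sqrt_of_sq_le ?_
  rw [sq_abs]
  simpa [dotProduct, sq] using h

variable {inc : ι → Leg → Prop} {M : ι → Matrix (Mode p n) (Mode p n) ℝ}

lemma abs_sum_noise_form_le (F : Finset ι) (hM : ∀ s ∈ F, IsIsometricTensor (inc s) (M s))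
    {v v' : ι → Mode p n → ℝ} (hv : ∀ s ∈ F, IsOut (inc s) (v s))
    (hv' : ∀ s ∈ F, IsOut (inc s) (v' s)) :
    |∑ s ∈ F, v s ⬝ᵥ M s *ᵥ v' s| ≤
      √(∑ s ∈ F, outEnergy (inc s) (M s) (v s)) * √(∑ s ∈ F, outEnergy (inc s) (M s) (v' s)) := by
  have h := abs_sum_dotProduct_le F (fun s => outPart (inc s) (M s *ᵥ v s))
    (fun s => M s *ᵥ outPart (inc s) (M s *ᵥ v' s))
  have e1 : ∑ s ∈ F, v s ⬝ᵥ M s *ᵥ v' s = ∑ s ∈ F, outPart (inc s) (M s *ᵥ v s) ⬝ᵥ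
      M s *ᵥ outPart (inc s) (M s *ᵥ v' s) :=
    Finset.sum_congr rfl fun s hs => (hM s hs).noise_form_eq (hv s hs) (hv' s hs)
  have e2 : ∑ s ∈ F, (M s *ᵥ outPart (inc s) (M s *ᵥ v' s)) ⬝ᵥ
      (M s *ᵥ outPart (inc s) (M s *ᵥ v' s)) = ∑ s ∈ F, outEnergy (inc s) (M s) (v' s) :=
    Finset.sum_congr rfl fun s hs => (hM s hs).dotProduct_mulVec_mulVec
  rw [e2] at h
  rw [e1]
  exact h

lemma abs_sqrt_sum_outEnergy_sub_le (F : Finset ι) (v v' : ι → Mode p n → ℝ) :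
    |√(∑ s ∈ F, outEnergy (inc s) (M s) (v s)) - √(∑ s ∈ F, outEnergy (inc s) (M s) (v' s))| ≤
      √(∑ s ∈ F, outEnergy (inc s) (M s) (v s - v' s)) := by
  let U : (ι → Mode p n → ℝ) → EuclideanSpace ℝ (F × Mode p n) := fun w =>
    WithLp.toLp 2 fun x => outPart (inc x.1) (M x.1 *ᵥ w x.1) x.2
  have hU : ∀ w, √(∑ s ∈ F, outEnergy (inc s) (M s) (w s)) = ‖U w‖ := by
    intro w
    rw [EuclideanSpace.norm_eq]
    congr 1
    simp only [Fintype.sum_prod_type, U, Real.norm_eq_abs, sq_abs]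
    rw [← Finset.sum_coe_sort F]
    refine Finset.sum_congr rfl fun s _ => ?_
    simp only [outEnergy, dotProduct, sq]
  have hs : U (fun s => v s - v' s) = U v - U v' := by
    ext x
    simp [U, mulVec_sub, outPart_sub]
  rw [hU v, hU v', hU (fun s => v s - v' s), hs]
  exact abs_norm_sub_norm_le _ _

end CauchySchwarz

/-! ### Backward propagation through a network -/

lemma Leg.opp_opp (a : Leg) : a.opp.opp = a := by cases a <;> rfl

namespace Network

variable {A : Type} [AddCommGroup A] {p n : ℕ}

lemma step_opp (N : Network A p n) (a : Leg) : N.step a.opp = -N.step a := by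
  cases a <;> simp [step, Leg.opp]

lemma add_step_add_step_opp (N : Network A p n) (s : A) (a : Leg) :
    s + N.step a + N.step a.opp = s := by
  rw [step_opp, add_neg_cancel_right]

/-- All tensors of the network are isometric, and the arrows on the two ends of each bond agree. -/
structure IsIsometric (N : Network A p n) : Prop where
  tensor : ∀ s, IsIsometricTensor (N.inc s) (N.tensor s)
  bond : ∀ s a, N.inc (s + N.step a) a.opp ↔ ¬N.inc s a

/-- The arrows of the network form no directed cycle inside `D`: some height function increases
along every arrow. -/
def IsAcyclicOn (N : Network A p n) (D : Finset A) : Prop :=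
  ∃ ρ : A → ℤ, ∀ s ∈ D, ∀ a, ¬N.inc s a → s + N.step a ∈ D → ρ s < ρ (s + N.step a)

/-- One step of backward propagation: the components of `v` on the modes of the later tensors are
pulled back through these tensors to the outgoing legs of the site `s`. -/
noncomputable def pull (N : Network A p n) (v : A → Mode p n → ℝ) (s : A) : Mode p n → ℝ
  | .inl _ => 0
  | .inr (a, i) => if N.inc s a then 0 else
      -(N.tensor (s + N.step a) *ᵥ v (s + N.step a)) (.inr (a.opp, i))

/-- The unit vector at the physical mode `α` of the site `r`. -/
noncomputable def source (r : A) (α : Fin p) (s : A) : Mode p n → ℝ :=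
  fun μ => if s = r ∧ μ = .inl α then 1 else 0

/-- `v` is the response of the network on `D` to the physical mode `α` at `r`: `v s μ` is the
sum over directed paths in `D` from the mode `μ` at `s` to the physical mode, i.e. the amplitude
with which that physical mode depends on the mode `μ`. -/
structure IsResponse (N : Network A p n) (D : Finset A) (r : A) (α : Fin p)
    (v : A → Mode p n → ℝ) : Prop where
  off : ∀ s, s ∉ D → v s = 0
  eq : ∀ s ∈ D, v s = source r α s + N.pull v s

variable {N : Network A p n}

lemma isOut_pull (v : A → Mode p n → ℝ) (s : A) : IsOut (N.inc s) (N.pull v s) := by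
  intro a i h
  simp [pull, h]

lemma isOut_source {B : Type} {inc : Leg → Prop} (r : B) (α : Fin p) (s : B) :
    IsOut inc (source (n := n) r α s) := by
  intro a i _
  simp [source]

lemma isOut_of_eq_source_add_pull {v : A → Mode p n → ℝ} {r : A} {α : Fin p} {s : A}
    (h : v s = source r α s + N.pull v s) : IsOut (N.inc s) (v s) := by
  rw [h]
  exact (isOut_source r α s).add (isOut_pull v s)

lemma IsResponse.isOut {D : Finset A} {r : A} {α : Fin p} {v : A → Mode p n → ℝ}
    (h : N.IsResponse D r α v) (s : A) : IsOut (N.inc s) (v s) := by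
  by_cases hs : s ∈ D
  · exact isOut_of_eq_source_add_pull (h.eq s hs)
  · rw [h.off s hs]
    exact isOut_zero

lemma pull_sub (v w : A → Mode p n → ℝ) (s : A) :
    N.pull (v - w) s = N.pull v s - N.pull w s := by
  ext μ
  rcases μ with α | ⟨a, i⟩
  · simp [pull]
  · by_cases h : N.inc s a
    · simp [pull, h]
    · simp [pull, h, mulVec_sub]
      ring

lemma pull_eq_zero {v : A → Mode p n → ℝ} {s : A}
    (h : ∀ a, ¬N.inc s a → v (s + N.step a) = 0) : N.pull v s = 0 := by
  ext μ
  rcases μ with α | ⟨a, i⟩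
  · simp [pull]
  · by_cases ha : N.inc s a
    · simp [pull, ha]
    · simp [pull, ha, h a ha]

/-- A field obtained from nothing by backward propagation vanishes on every region closed under
the arrows, because its last site would have to be a source. -/
lemma eq_zero_of_eq_pull {D : Finset A} (hD : N.IsAcyclicOn D) {v : A → Mode p n → ℝ}
    (hoff : ∀ s, s ∉ D → v s = 0) {Z : Set A}
    (hZ : ∀ s ∈ Z, ∀ a, ¬N.inc s a → s + N.step a ∈ Z)
    (hv : ∀ s ∈ D, s ∈ Z → v s = N.pull v s) {s : A} (hs : s ∈ Z) : v s = 0 := by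
  obtain ⟨ρ, hρ⟩ := hD
  by_contra hne
  let B := D.filter fun x => x ∈ Z ∧ v x ≠ 0
  have hB : B.Nonempty := ⟨s, by
    simp only [B, Finset.mem_filter]
    exact ⟨by_contra fun h => hne (hoff s h), hs, hne⟩⟩
  obtain ⟨x, hx, hmax⟩ := B.exists_max_image ρ hB
  simp only [B, Finset.mem_filter] at hx hmax
  obtain ⟨hxD, hxZ, hx0⟩ := hx
  refine hx0 ((hv x hxD hxZ).trans (pull_eq_zero fun a ha => ?_))
  by_contra hne'
  have hD' : x + N.step a ∈ D := by_contra fun h => hne' (hoff _ h)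
  have := hmax _ ⟨hD', hZ x hxZ a ha, hne'⟩
  exact absurd (hρ x hxD a ha hD') (not_lt.mpr this)

lemma IsResponse.eq_zero_of_not_mem {D : Finset A} (hD : N.IsAcyclicOn D) {r : A} {α : Fin p}
    {v : A → Mode p n → ℝ} (h : N.IsResponse D r α v) {Z : Set A}
    (hZ : ∀ s ∈ Z, ∀ a, ¬N.inc s a → s + N.step a ∈ Z) (hr : r ∉ Z) {s : A} (hs : s ∈ Z) :
    v s = 0 := by
  refine eq_zero_of_eq_pull hD h.off hZ (fun x hx hxZ => ?_) hs
  rw [h.eq x hx]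
  have : source (p := p) (n := n) r α x = 0 := by
    ext μ
    have : x ≠ r := fun e => hr (e ▸ hxZ)
    simp [source, this]
  rw [this, zero_add]

lemma IsResponse.unique {D : Finset A} (hD : N.IsAcyclicOn D) {r : A} {α : Fin p}
    {v w : A → Mode p n → ℝ} (hv : N.IsResponse D r α v) (hw : N.IsResponse D r α w) : v = w := by
  funext s
  rw [← sub_eq_zero]
  refine eq_zero_of_eq_pull (v := v - w) (Z := Set.univ) (N := N) hD (fun x hx => ?_)
    (fun _ _ _ _ => trivial) (fun x hx _ => ?_) (Set.mem_univ s)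
  · simp [hv.off x hx, hw.off x hx]
  · rw [pull_sub, Pi.sub_apply, hv.eq x hx, hw.eq x hx]
    abel

/-! ### Conservation of energy -/

/-- Reindexing the bonds inside `D` from one end to the other. -/
lemma sum_bonds (N : Network A p n) (D : Finset A) {R : Type*} [AddCommMonoid R] (F : A → Leg → R) :
    ∑ s ∈ D, ∑ a, (if s + N.step a ∈ D then F s a else 0) =
      ∑ s ∈ D, ∑ a, (if s + N.step a ∈ D then F (s + N.step a) a.opp else 0) := by
  rw [← Finset.sum_product', ← Finset.sum_product', ← Finset.sum_filter, ← Finset.sum_filter]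
  refine Finset.sum_nbij' (fun x => (x.1 + N.step x.2, x.2.opp))
    (fun x => (x.1 + N.step x.2, x.2.opp)) ?_ ?_ ?_ ?_ ?_
  · rintro ⟨s, a⟩ h
    simp only [Finset.mem_filter, Finset.mem_product, Finset.mem_univ, and_true] at h ⊢
    exact ⟨h.2, by rw [add_step_add_step_opp]; exact h.1⟩
  · rintro ⟨s, a⟩ h
    simp only [Finset.mem_filter, Finset.mem_product, Finset.mem_univ, and_true] at h ⊢
    exact ⟨h.2, by rw [add_step_add_step_opp]; exact h.1⟩
  · rintro ⟨s, a⟩ _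
    simp [add_step_add_step_opp, Leg.opp_opp]
  · rintro ⟨s, a⟩ _
    simp [add_step_add_step_opp, Leg.opp_opp]
  · rintro ⟨s, a⟩ _
    simp [add_step_add_step_opp, Leg.opp_opp]

/-- The noise that `v` sees inside `D`. -/
noncomputable def energy (N : Network A p n) (D : Finset A) (v : A → Mode p n → ℝ) : ℝ :=
  ∑ s ∈ D, outEnergy (N.inc s) (N.tensor s) (v s)

/-- The weight of `v` on the boundary state. -/
noncomputable def inFlux (N : Network A p n) (D : Finset A) (v : A → Mode p n → ℝ) : ℝ :=
  ∑ s ∈ D, ∑ a, if N.IsBoundaryLeg D s a then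
    ∑ i, (N.tensor s *ᵥ v s) (.inr (a, i)) ^ 2 else 0

/-- The weight of `v` on the outgoing legs that leave `D`. -/
noncomputable def outFlux (N : Network A p n) (D : Finset A) (v : A → Mode p n → ℝ) : ℝ :=
  ∑ s ∈ D, ∑ a, if ¬N.inc s a ∧ s + N.step a ∉ D then ∑ i, v s (.inr (a, i)) ^ 2 else 0

lemma inFlux_nonneg (D : Finset A) (v : A → Mode p n → ℝ) : 0 ≤ N.inFlux D v :=
  Finset.sum_nonneg fun _ _ => Finset.sum_nonneg fun _ _ => by
    split_ifs
    · exact Finset.sum_nonneg fun _ _ => sq_nonneg _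
    · exact le_rfl

lemma outFlux_nonneg (D : Finset A) (v : A → Mode p n → ℝ) : 0 ≤ N.outFlux D v :=
  Finset.sum_nonneg fun _ _ => Finset.sum_nonneg fun _ _ => by
    split_ifs
    · exact Finset.sum_nonneg fun _ _ => sq_nonneg _
    · exact le_rfl

/-- Conservation of energy: what enters a region backward in time, through the physical modes and
the outgoing legs, is absorbed by the noise or leaves through the incoming legs. -/
lemma energy_add_inFlux (hN : N.IsIsometric) (D : Finset A) {v : A → Mode p n → ℝ}
    (hout : ∀ s ∈ D, IsOut (N.inc s) (v s))
    (hloc : ∀ s ∈ D, ∀ a i, ¬N.inc s a → s + N.step a ∈ D →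
      v s (.inr (a, i)) = N.pull v s (.inr (a, i))) :
    N.energy D v + N.inFlux D v = (∑ s ∈ D, ∑ α, v s (.inl α) ^ 2) + N.outFlux D v := by
  let F : A → Leg → ℝ := fun s a =>
    if N.inc s a then ∑ i, (N.tensor s *ᵥ v s) (.inr (a, i)) ^ 2 else 0
  have h1 : N.energy D v + N.inFlux D v +
      ∑ s ∈ D, ∑ a, (if s + N.step a ∈ D then F s a else 0) = ∑ s ∈ D, v s ⬝ᵥ v s := by
    rw [energy, inFlux, add_assoc, ← Finset.sum_add_distrib, ← Finset.sum_add_distrib]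
    refine Finset.sum_congr rfl fun s _ => ?_
    rw [← (hN.tensor s).outEnergy_add, inPart_dotProduct_self, ← Finset.sum_add_distrib]
    congr 1
    refine Finset.sum_congr rfl fun a _ => ?_
    by_cases ha : N.inc s a <;> by_cases hD : s + N.step a ∈ D <;>
      simp [F, IsBoundaryLeg, ha, hD]
  have h2 : (∑ s ∈ D, ∑ α, v s (.inl α) ^ 2) + N.outFlux D v +
      ∑ s ∈ D, ∑ a, (if s + N.step a ∈ D then F (s + N.step a) a.opp else 0) =
      ∑ s ∈ D, v s ⬝ᵥ v s := by
    rw [outFlux, add_assoc, ← Finset.sum_add_distrib, ← Finset.sum_add_distrib]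
    refine Finset.sum_congr rfl fun s hs => ?_
    rw [← Finset.sum_add_distrib]
    simp only [dotProduct, Fintype.sum_sum_type, Fintype.sum_prod_type, ← sq]
    congr 1
    refine Finset.sum_congr rfl fun a _ => ?_
    by_cases ha : N.inc s a
    · have : ∑ i, v s (.inr (a, i)) ^ 2 = 0 :=
        Finset.sum_eq_zero fun i _ => by rw [hout s hs a i ha]; simp
      simp [F, hN.bond, ha, this]
    · by_cases hD : s + N.step a ∈ D
      · simp only [F, hN.bond, ha, hD, not_true, and_false, if_true, if_false, not_false_eq_true,
          zero_add]
        refine Finset.sum_congr rfl fun i _ => ?_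
        rw [hloc s hs a i ha hD]
        simp [pull, ha]
      · simp [ha, hD]
  have h3 := N.sum_bonds D F
  linarith

lemma IsResponse.energy_add_inFlux (hN : N.IsIsometric) {D : Finset A} {r : A} {α : Fin p}
    {v : A → Mode p n → ℝ} (h : N.IsResponse D r α v) (hr : r ∈ D) :
    N.energy D v + N.inFlux D v = 1 := by
  rw [Network.energy_add_inFlux hN D (fun s _ => h.isOut s)]
  · have h1 : N.outFlux D v = 0 := by
      refine Finset.sum_eq_zero fun s hs => Finset.sum_eq_zero fun a _ => ?_
      split_ifs with hc
      · refine Finset.sum_eq_zero fun i _ => ?_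
        rw [h.eq s hs]
        simp [source, pull, hc.1, h.off _ hc.2]
      · rfl
    have h2 : ∑ s ∈ D, ∑ β, v s (.inl β) ^ 2 = 1 := by
      have : ∀ s ∈ D, ∀ β, v s (.inl β) ^ 2 = if s = r then (if β = α then 1 else 0) else 0 := by
        intro s hs β
        rw [h.eq s hs]
        by_cases h1 : s = r <;> by_cases h2 : β = α <;> simp [source, pull, h1, h2]
      rw [Finset.sum_congr rfl fun s hs => Finset.sum_congr rfl fun β _ => this s hs β]
      simp [hr, Finset.sum_ite_irrel]
    rw [h1, h2, add_zero]
  · intro s hs a i ha hD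
    rw [h.eq s hs]
    simp [source]

end Network

namespace Network

variable {A : Type} [AddCommGroup A] {p n : ℕ} {N : Network A p n}

/-! ### Contraction of a finite network -/

/-- Extension by zero of a vector on the modes of `D`. -/
noncomputable def extend {D : Finset A} (η : D × Mode p n → ℝ) (s : A) (μ : Mode p n) : ℝ :=
  if h : s ∈ D then η (⟨s, h⟩, μ) else 0

lemma extend_of_mem {B : Type} {D : Finset B} (η : D × Mode p n → ℝ) {s : B} (hs : s ∈ D)
    (μ : Mode p n) :
    extend η s μ = η (⟨s, hs⟩, μ) := dif_pos hs

lemma extend_of_not_mem {B : Type} {D : Finset B} (η : D × Mode p n → ℝ) {s : B} (hs : s ∉ D) :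
    extend η s = 0 := by
  funext μ
  simp [extend, hs]

/-- The components of a field on the boundary legs. -/
noncomputable def boundaryVec (N : Network A p n) (D : Finset A) (ψ : A → Mode p n → ℝ)
    (x : D × Leg × Fin n) : ℝ :=
  if N.IsBoundaryLeg D x.1 x.2.1 then ψ x.1 (.inr (x.2.1, x.2.2)) else 0

lemma tensorMatrix_mulVec {B : Type} {N : Network B p n} (D : Finset B) (η : D × Mode p n → ℝ)
    {s : B} (hs : s ∈ D) (μ : Mode p n) :
    (N.tensorMatrix D *ᵥ η) (⟨s, hs⟩, μ) = (N.tensor s *ᵥ extend η s) μ := by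
  simp only [mulVec, dotProduct, tensorMatrix, Fintype.sum_prod_type, ite_mul, zero_mul]
  rw [Finset.sum_eq_single (⟨s, hs⟩ : D)]
  · simp [extend_of_mem η hs]
  · intro b _ hb
    exact Finset.sum_eq_zero fun ν _ => if_neg fun h => hb h.symm
  · simp

variable {D : Finset A} {Γ₀ : Matrix (D × Leg × Fin n) (D × Leg × Fin n) ℝ}

lemma bondMatrix_mulVec_inl (ψ : D × Mode p n → ℝ) (s : D) (α : Fin p) :
    (N.bondMatrix D Γ₀ *ᵥ ψ) (s, .inl α) = 0 := by
  refine Finset.sum_eq_zero fun y _ => ?_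
  simp [bondMatrix]

lemma bondMatrix_mulVec_bond (ψ : D × Mode p n → ℝ) {s : A} (hs : s ∈ D) {a : Leg}
    (ha : s + N.step a ∈ D) (i : Fin n) :
    (N.bondMatrix D Γ₀ *ᵥ ψ) (⟨s, hs⟩, .inr (a, i)) =
      (if N.inc s a then -1 else 1) * extend ψ (s + N.step a) (.inr (a.opp, i)) := by
  simp only [mulVec, dotProduct]
  rw [Finset.sum_eq_single ((⟨s + N.step a, ha⟩, .inr (a.opp, i)) : D × Mode p n)]
  · simp [bondMatrix, extend_of_mem ψ ha]
  · rintro ⟨s', β | ⟨b, j⟩⟩ _ hne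
    · simp [bondMatrix]
    · have hb : ¬N.IsBoundaryLeg D s a := fun h => h.2 ha
      simp only [bondMatrix, hb, false_and, if_false]
      split_ifs with h1 h2 h3
      · refine absurd ?_ hne
        obtain ⟨h1, rfl⟩ := h1
        subst h2
        simp [Prod.ext_iff, Subtype.ext_iff, h1]
      · refine absurd ?_ hne
        obtain ⟨h1, rfl⟩ := h1
        subst h2
        simp [Prod.ext_iff, Subtype.ext_iff, h1]
      · simp
      · simp
  · simp

lemma bondMatrix_mulVec_free (ψ : D × Mode p n → ℝ) {s : A} (hs : s ∈ D) {a : Leg}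
    (hinc : ¬N.inc s a) (ha : s + N.step a ∉ D) (i : Fin n) :
    (N.bondMatrix D Γ₀ *ᵥ ψ) (⟨s, hs⟩, .inr (a, i)) = 0 := by
  refine Finset.sum_eq_zero ?_
  rintro ⟨s', β | ⟨b, j⟩⟩ _
  · simp [bondMatrix]
  · have hb : ¬N.IsBoundaryLeg D s a := fun h => hinc h.1
    have hc : ¬((s' : A) = s + N.step a ∧ b = a.opp) := fun h => ha (h.1 ▸ s'.2)
    simp only [bondMatrix, hb, hc, false_and, if_false, zero_mul]

lemma bondMatrix_mulVec_boundary (ψ : D × Mode p n → ℝ) {s : A} (hs : s ∈ D) {a : Leg}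
    (ha : N.IsBoundaryLeg D s a) (i : Fin n) :
    (N.bondMatrix D Γ₀ *ᵥ ψ) (⟨s, hs⟩, .inr (a, i)) =
      (Γ₀ *ᵥ N.boundaryVec D (extend ψ)) (⟨s, hs⟩, a, i) := by
  simp only [mulVec, dotProduct, Fintype.sum_prod_type, Fintype.sum_sum_type]
  refine Finset.sum_congr rfl fun s' _ => ?_
  have h0 : ∑ β, N.bondMatrix D Γ₀ (⟨s, hs⟩, .inr (a, i)) (s', .inl β) * ψ (s', .inl β) = 0 :=
    Finset.sum_eq_zero fun β _ => by simp [bondMatrix]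
  rw [h0, zero_add]
  refine Finset.sum_congr rfl fun b _ => Finset.sum_congr rfl fun j _ => ?_
  have hc : ¬((s' : A) = s + N.step a ∧ b = a.opp) := fun h => ha.2 (h.1 ▸ s'.2)
  simp only [bondMatrix, hc, ha, true_and, if_false, boundaryVec]
  by_cases hb : N.IsBoundaryLeg D s' b
  · simp [hb, extend_of_mem ψ s'.2]
  · simp [hb]

/-- The linear system solved by the contraction of a finite network: `ψ` is the image of `η` under
the tensors, and `η` is the source plus the image of `ψ` under the contracting state. -/
structure IsContraction (N : Network A p n) (D : Finset A)
    (Γ₀ : Matrix (D × Leg × Fin n) (D × Leg × Fin n) ℝ) (σ η ψ : A → Mode p n → ℝ) : Prop where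
  off : ∀ s, s ∉ D → η s = 0 ∧ ψ s = 0
  tensor : ∀ s ∈ D, ψ s = N.tensor s *ᵥ η s
  phys : ∀ s ∈ D, ∀ α, η s (.inl α) = σ s (.inl α)
  bond : ∀ s ∈ D, ∀ a i, s + N.step a ∈ D → η s (.inr (a, i)) = σ s (.inr (a, i)) -
    (if N.inc s a then -1 else 1) * ψ (s + N.step a) (.inr (a.opp, i))
  free : ∀ s ∈ D, ∀ a i, ¬N.inc s a → s + N.step a ∉ D →
    η s (.inr (a, i)) = σ s (.inr (a, i))
  boundary : ∀ s (hs : s ∈ D) a i, N.IsBoundaryLeg D s a →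
    η s (.inr (a, i)) = σ s (.inr (a, i)) - (Γ₀ *ᵥ N.boundaryVec D ψ) (⟨s, hs⟩, a, i)

lemma isContraction_of_eq {σ ψ : D × Mode p n → ℝ}
    (h : ψ + N.tensorMatrix D *ᵥ (N.bondMatrix D Γ₀ *ᵥ ψ) = N.tensorMatrix D *ᵥ σ) :
    N.IsContraction D Γ₀ (extend σ) (extend (σ - N.bondMatrix D Γ₀ *ᵥ ψ)) (extend ψ) where
  off s hs := ⟨extend_of_not_mem _ hs, extend_of_not_mem _ hs⟩
  tensor s hs := by
    funext μ
    rw [← tensorMatrix_mulVec D _ hs, mulVec_sub, ← h, add_sub_cancel_right, extend_of_mem]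
  phys s hs α := by
    rw [extend_of_mem _ hs, extend_of_mem _ hs, Pi.sub_apply, bondMatrix_mulVec_inl, sub_zero]
  bond s hs a i ha := by
    rw [extend_of_mem _ hs, extend_of_mem _ hs, Pi.sub_apply, bondMatrix_mulVec_bond _ hs ha]
  free s hs a i hi ha := by
    rw [extend_of_mem _ hs, extend_of_mem _ hs, Pi.sub_apply, bondMatrix_mulVec_free _ hs hi ha,
      sub_zero]
  boundary s hs a i ha := by
    rw [extend_of_mem _ hs, extend_of_mem _ hs, Pi.sub_apply, bondMatrix_mulVec_boundary _ hs ha]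

section

variable {σ η ψ : A → Mode p n → ℝ}

/-- The outgoing part of a contraction does not depend on the boundary state: it propagates
backward from the source. -/
lemma IsContraction.outPart_eq (hN : N.IsIsometric) (h : N.IsContraction D Γ₀ σ η ψ)
    {s : A} (hs : s ∈ D) :
    outPart (N.inc s) (η s) =
      outPart (N.inc s) (σ s) + N.pull (fun s => outPart (N.inc s) (η s)) s := by
  ext μ
  rcases μ with α | ⟨a, i⟩
  · simp [outPart, pull, h.phys s hs]
  · by_cases ha : N.inc s a
    · simp [outPart, pull, ha]
    · have hb : N.inc (s + N.step a) a.opp := (hN.bond s a).2 ha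
      simp only [Pi.add_apply, pull, ha, if_false, outPart]
      by_cases hD : s + N.step a ∈ D
      · rw [h.bond s hs a i hD, (hN.tensor _).mulVec_outPart hb, h.tensor _ hD]
        simp only [ha, if_false]
        ring
      · have h0 : outPart (N.inc (s + N.step a)) (η (s + N.step a)) = 0 := by
          rw [(h.off _ hD).1]
          exact isOut_zero.outPart_eq
        rw [h.free s hs a i ha hD, h0]
        simp

lemma IsContraction.eq_zero (hN : N.IsIsometric) (hD : N.IsAcyclicOn D)
    (h : N.IsContraction D Γ₀ 0 η ψ) (s : A) : ψ s = 0 := by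
  have hout : ∀ s, outPart (N.inc s) (η s) = 0 := by
    intro s
    refine eq_zero_of_eq_pull (v := fun s => outPart (N.inc s) (η s)) hD (fun x hx => ?_)
      (Z := Set.univ) (fun _ _ _ _ => trivial) (fun x hx _ => ?_) (Set.mem_univ s)
    · rw [(h.off x hx).1]
      exact isOut_zero.outPart_eq
    · have := h.outPart_eq hN hx
      rwa [Pi.zero_apply, isOut_zero.outPart_eq, zero_add] at this
  have hη : ∀ s, η s = 0 := by
    obtain ⟨ρ, hρ⟩ := hD
    intro s
    by_contra hne
    let B := D.filter fun x => η x ≠ 0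
    have hB : B.Nonempty := ⟨s, by
      simp only [B, Finset.mem_filter]
      exact ⟨by_contra fun hs => hne (h.off s hs).1, hne⟩⟩
    obtain ⟨x, hx, hmin⟩ := B.exists_min_image ρ hB
    simp only [B, Finset.mem_filter] at hx hmin
    obtain ⟨hxD, hx0⟩ := hx
    refine hx0 ?_
    ext μ
    have ho := congrFun (hout x) μ
    rcases μ with α | ⟨a, i⟩
    · exact ho
    · by_cases ha : N.inc x a
      · by_cases hxa : x + N.step a ∈ D
        · have hz : η (x + N.step a) = 0 := by
            by_contra hne'
            have h1 := hmin _ ⟨hxa, hne'⟩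
            have h2 : ¬N.inc (x + N.step a) a.opp := by
              rw [hN.bond]
              exact not_not.2 ha
            have h3 := hρ _ hxa _ h2 (by rwa [add_step_add_step_opp])
            rw [add_step_add_step_opp] at h3
            omega
          rw [h.bond x hxD a i hxa, h.tensor _ hxa, hz]
          simp
        · have hv : N.boundaryVec D ψ = 0 := by
            ext ⟨s', b, j⟩
            simp only [boundaryVec, Pi.zero_apply]
            split_ifs with hb
            · rw [h.tensor _ s'.2, ← (hN.tensor _).mulVec_outPart hb.1, hout]
              simp
            · rfl
          rw [h.boundary x hxD a i ⟨ha, hxa⟩, hv]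
          simp
      · simpa [outPart, ha] using ho
  by_cases hs : s ∈ D
  · rw [h.tensor s hs, hη s, mulVec_zero]
  · exact (h.off s hs).2

lemma isUnit_det_contraction (hN : N.IsIsometric) (hD : N.IsAcyclicOn D) :
    IsUnit (1 + N.tensorMatrix D * N.bondMatrix D Γ₀).det := by
  rw [isUnit_iff_ne_zero]
  intro h0
  obtain ⟨ψ, hne, hψ⟩ := Matrix.exists_mulVec_eq_zero_iff.2 h0
  refine hne ?_
  rw [add_mulVec, one_mulVec, ← mulVec_mulVec] at hψ
  have h := isContraction_of_eq (σ := 0) (hψ.trans (mulVec_zero _).symm)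
  have hz : extend (0 : D × Mode p n → ℝ) = 0 := by
    funext s μ
    simp [extend]
  rw [hz] at h
  ext ⟨s, μ⟩
  have := congrFun (h.eq_zero hN hD s) μ
  rwa [extend_of_mem _ s.2] at this

/-- The two-point function is the noise form of the two responses plus the boundary form. -/
theorem physCorr_eq (hN : N.IsIsometric) (hD : N.IsAcyclicOn D) {r r' : D} {α β : Fin p}
    {v v' : A → Mode p n → ℝ} (hv : N.IsResponse D r α v) (hv' : N.IsResponse D r' β v') :
    N.physCorr D Γ₀ r r' α β = ∑ s ∈ D, v s ⬝ᵥ N.tensor s *ᵥ v' s +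
      N.boundaryVec D (fun s => N.tensor s *ᵥ v s) ⬝ᵥ
        Γ₀ *ᵥ N.boundaryVec D (fun s => N.tensor s *ᵥ v' s) := by
  let σ : D × Mode p n → ℝ := Pi.single (r', .inl β) 1
  let ψ : D × Mode p n → ℝ := N.contracted D Γ₀ *ᵥ σ
  have hσ : extend σ = source (r' : A) β := by
    funext s μ
    by_cases hs : s ∈ D
    · rw [extend_of_mem σ hs]
      simp only [σ, Pi.single_apply, source, Prod.ext_iff, Subtype.ext_iff]
    · have : s ≠ r' := fun h => hs (h ▸ r'.2)
      simp [extend, hs, source, this]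
  have hψ : ψ + N.tensorMatrix D *ᵥ (N.bondMatrix D Γ₀ *ᵥ ψ) = N.tensorMatrix D *ᵥ σ := by
    have h1 : ψ + N.tensorMatrix D *ᵥ (N.bondMatrix D Γ₀ *ᵥ ψ) =
        (1 + N.tensorMatrix D * N.bondMatrix D Γ₀) *ᵥ ψ := by
      rw [add_mulVec, one_mulVec, mulVec_mulVec]
    rw [h1]
    simp only [ψ, contracted]
    rw [mulVec_mulVec, ← mul_assoc, mul_nonsing_inv _ (isUnit_det_contraction hN hD), one_mul]
  have hX : N.physCorr D Γ₀ r r' α β = extend ψ r (.inl α) := by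
    rw [extend_of_mem ψ r.2]
    simp [physCorr, ψ, σ]
  have hc := isContraction_of_eq hψ
  set η := extend (σ - N.bondMatrix D Γ₀ *ᵥ ψ) with hη
  set ψ' := extend ψ with hψ'
  rw [hσ] at hc
  have hout : ∀ s, outPart (N.inc s) (η s) = v' s := by
    have : N.IsResponse D r' β fun s => outPart (N.inc s) (η s) := by
      refine ⟨fun s hs => ?_, fun s hs => ?_⟩
      · rw [(hc.off s hs).1]
        exact isOut_zero.outPart_eq
      · have := hc.outPart_eq hN hs
        rwa [(isOut_source _ _ _).outPart_eq] at this
    exact fun s => congrFun (this.unique hD hv') s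
  have hb : N.boundaryVec D (fun s => N.tensor s *ᵥ v' s) = N.boundaryVec D ψ' := by
    ext ⟨s, a, i⟩
    simp only [boundaryVec]
    split_ifs with h
    · rw [hc.tensor s s.2, ← hout, (hN.tensor _).mulVec_outPart h.1]
    · rfl
  rw [hX, hb]
  -- pairing the solution with `v = source + pull v` isolates the physical mode at `r`
  have e1 : ∑ s ∈ D, ψ' s ⬝ᵥ v s = ψ' r (.inl α) + ∑ s ∈ D, ψ' s ⬝ᵥ N.pull v s := by
    rw [Finset.sum_congr rfl fun s hs => by rw [hv.eq s hs, dotProduct_add],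
      Finset.sum_add_distrib]
    congr 1
    rw [Finset.sum_eq_single (r : A)]
    · simp only [dotProduct, source, true_and, mul_ite, mul_one, mul_zero]
      simp
    · intro s _ hs
      refine Finset.sum_eq_zero fun μ _ => ?_
      simp [source, hs]
    · exact fun h => absurd r.2 h
  let F : A → Leg → ℝ := fun s a => if N.inc s a then
    ∑ i, (N.tensor s *ᵥ v s) (.inr (a, i)) * ψ' (s + N.step a) (.inr (a.opp, i)) else 0
  have e2 : ∑ s ∈ D, ψ' s ⬝ᵥ N.pull v s =
      -∑ s ∈ D, ∑ a, (if s + N.step a ∈ D then F (s + N.step a) a.opp else 0) := by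
    rw [← Finset.sum_neg_distrib]
    refine Finset.sum_congr rfl fun s hs => ?_
    rw [← Finset.sum_neg_distrib]
    simp only [dotProduct, Fintype.sum_sum_type, Fintype.sum_prod_type]
    have : ∑ γ : Fin p, ψ' s (.inl γ) * N.pull v s (.inl γ) = 0 :=
      Finset.sum_eq_zero fun γ _ => by simp [pull]
    rw [this, zero_add]
    refine Finset.sum_congr rfl fun a _ => ?_
    by_cases ha : N.inc s a
    · simp [pull, F, hN.bond, ha]
    · by_cases hsa : s + N.step a ∈ D
      · simp only [pull, F, hN.bond, ha, hsa, not_false_eq_true, if_true, if_false,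
          add_step_add_step_opp, Leg.opp_opp]
        rw [← Finset.sum_neg_distrib]
        refine Finset.sum_congr rfl fun i _ => ?_
        ring
      · simp [pull, hsa, hv.off _ hsa]
  have e3 : ∑ s ∈ D, ψ' s ⬝ᵥ v s = ∑ s ∈ D, v s ⬝ᵥ N.tensor s *ᵥ v' s -
      ∑ s ∈ D, (N.tensor s *ᵥ v s) ⬝ᵥ inPart (N.inc s) (η s) := by
    rw [← Finset.sum_sub_distrib]
    refine Finset.sum_congr rfl fun s hs => ?_
    rw [hc.tensor s hs, dotProduct_comm, ← hout s]
    conv_lhs => rw [← outPart_add_inPart (inc := N.inc s) (v := η s)]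
    rw [mulVec_add, dotProduct_add, (hN.tensor s).dotProduct_mulVec (v' := inPart _ _), ← sub_eq_add_neg]
  have e4 : ∑ s ∈ D, (N.tensor s *ᵥ v s) ⬝ᵥ inPart (N.inc s) (η s) =
      ∑ s ∈ D, ∑ a, (if s + N.step a ∈ D then F s a else 0) -
        N.boundaryVec D (fun s => N.tensor s *ᵥ v s) ⬝ᵥ Γ₀ *ᵥ N.boundaryVec D ψ' := by
    have hdot : ∀ x y : D × Leg × Fin n → ℝ,
        x ⬝ᵥ y = ∑ s, ∑ a, ∑ i, x (s, a, i) * y (s, a, i) := fun x y => by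
      simp only [dotProduct, Fintype.sum_prod_type]
    rw [hdot, ← Finset.sum_coe_sort D, ← Finset.sum_coe_sort D, ← Finset.sum_sub_distrib]
    refine Finset.sum_congr rfl fun s _ => ?_
    simp only [dotProduct, Fintype.sum_sum_type, Fintype.sum_prod_type]
    have : ∑ γ : Fin p, (N.tensor s *ᵥ v s) (.inl γ) * inPart (N.inc s) (η s) (.inl γ) = 0 :=
      Finset.sum_eq_zero fun γ _ => by simp [inPart]
    rw [this, zero_add, ← Finset.sum_sub_distrib]
    refine Finset.sum_congr rfl fun a _ => ?_
    by_cases ha : N.inc s a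
    · by_cases hsa : (s : A) + N.step a ∈ D
      · simp only [inPart, F, boundaryVec, IsBoundaryLeg, ha, hsa, if_true, not_true, and_false,
          if_false, zero_mul, Finset.sum_const_zero, sub_zero]
        refine Finset.sum_congr rfl fun i _ => ?_
        rw [hc.bond s s.2 a i hsa]
        simp [ha, source]
      · simp only [inPart, F, boundaryVec, IsBoundaryLeg, ha, hsa, if_true, not_false_eq_true,
          and_true, if_false, zero_sub]
        rw [← Finset.sum_neg_distrib]
        refine Finset.sum_congr rfl fun i _ => ?_
        rw [hc.boundary s s.2 a i ⟨ha, hsa⟩]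
        simp [source]
    · simp [inPart, F, boundaryVec, IsBoundaryLeg, ha]
  have e5 := N.sum_bonds D F
  linarith

end

end Network

namespace Network

/-! ### Comparison of two-point functions on a part of the network -/

variable {A : Type} [AddCommGroup A] {p n : ℕ} {N : Network A p n}

lemma _root_.GaussianTNS.IsCorrelationMatrix.dotProduct_mulVec_le {X : Type} [Fintype X]
    [DecidableEq X] {Γ : Matrix X X ℝ} (h : IsCorrelationMatrix Γ) (x : X → ℝ) :
    (Γ *ᵥ x) ⬝ᵥ (Γ *ᵥ x) ≤ x ⬝ᵥ x := by
  have h1 := h.contraction.dotProduct_mulVec_nonneg x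
  rw [sub_mulVec, one_mulVec, dotProduct_sub, ← mulVec_mulVec, Matrix.dotProduct_mulVec,
    Matrix.vecMul_transpose] at h1
  simpa using h1

lemma boundaryVec_dotProduct_self {D : Finset A} (v : A → Mode p n → ℝ) :
    N.boundaryVec D (fun s => N.tensor s *ᵥ v s) ⬝ᵥ N.boundaryVec D (fun s => N.tensor s *ᵥ v s) =
      N.inFlux D v := by
  rw [inFlux, ← Finset.sum_coe_sort D]
  have hdot : ∀ x y : D × Leg × Fin n → ℝ,
      x ⬝ᵥ y = ∑ s, ∑ a, ∑ i, x (s, a, i) * y (s, a, i) := fun x y => by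
    simp only [dotProduct, Fintype.sum_prod_type]
  rw [hdot]
  refine Finset.sum_congr rfl fun s _ => Finset.sum_congr rfl fun a _ => ?_
  by_cases h : N.IsBoundaryLeg D s a <;> simp [boundaryVec, h, sq]

lemma abs_boundary_form_le {D : Finset A} {Γ₀ : Matrix (D × Leg × Fin n) (D × Leg × Fin n) ℝ}
    (hΓ : IsCorrelationMatrix Γ₀) (v v' : A → Mode p n → ℝ) :
    |N.boundaryVec D (fun s => N.tensor s *ᵥ v s) ⬝ᵥ
      Γ₀ *ᵥ N.boundaryVec D (fun s => N.tensor s *ᵥ v' s)| ≤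
      √(N.inFlux D v) * √(N.inFlux D v') := by
  set c := N.boundaryVec D (fun s => N.tensor s *ᵥ v s)
  set c' := N.boundaryVec D (fun s => N.tensor s *ᵥ v' s)
  have h := abs_sum_dotProduct_le (Finset.univ : Finset Unit) (fun _ => c) (fun _ => Γ₀ *ᵥ c')
  simp only [Finset.univ_unique, Finset.sum_singleton] at h
  refine h.trans ?_
  rw [← boundaryVec_dotProduct_self, ← boundaryVec_dotProduct_self]
  gcongr
  exact hΓ.dotProduct_mulVec_le c'

/-- If, on a part `F` of the network that absorbs almost all of the energy, the responses are close
to `w` and `w'`, then the two-point function is close to the noise form of `w` and `w'` on `F`,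
whatever the rest of the network and the boundary state. -/
theorem abs_physCorr_sub_le (hN : N.IsIsometric) {D : Finset A} (hD : N.IsAcyclicOn D)
    {Γ₀ : Matrix (D × Leg × Fin n) (D × Leg × Fin n) ℝ} (hΓ : IsCorrelationMatrix Γ₀)
    {r r' : D} {α β : Fin p} {v v' : A → Mode p n → ℝ}
    (hv : N.IsResponse D r α v) (hv' : N.IsResponse D r' β v')
    {B : Type} {P : Network B p n} {F : Finset B} {π : B → A} (hπ : Set.InjOn π F)
    (hπD : ∀ x ∈ F, π x ∈ D) (htensor : ∀ x ∈ F, N.tensor (π x) = P.tensor x)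
    (hinc : ∀ x ∈ F, N.inc (π x) = P.inc x) {w w' : B → Mode p n → ℝ}
    (hw : ∀ x ∈ F, IsOut (P.inc x) (w x)) (hw' : ∀ x ∈ F, IsOut (P.inc x) (w' x))
    {ε : ℝ} (hε : 0 ≤ ε) (hε1 : ε ≤ 1)
    (h1 : ∑ x ∈ F, outEnergy (P.inc x) (P.tensor x) (v (π x) - w x) ≤ ε ^ 2)
    (h1' : ∑ x ∈ F, outEnergy (P.inc x) (P.tensor x) (v' (π x) - w' x) ≤ ε ^ 2)
    (h2 : 1 - ∑ x ∈ F, outEnergy (P.inc x) (P.tensor x) (w x) ≤ ε ^ 2)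
    (h2' : 1 - ∑ x ∈ F, outEnergy (P.inc x) (P.tensor x) (w' x) ≤ ε ^ 2) :
    |N.physCorr D Γ₀ r r' α β - ∑ x ∈ F, w x ⬝ᵥ P.tensor x *ᵥ w' x| ≤ 11 * ε := by
  have hP : ∀ x ∈ F, IsIsometricTensor (P.inc x) (P.tensor x) := fun x hx => by
    rw [← htensor x hx, ← hinc x hx]
    exact hN.tensor _
  have himg : F.image π ⊆ D := by
    intro s hs
    obtain ⟨x, hx, rfl⟩ := Finset.mem_image.1 hs
    exact hπD x hx
  have hout : ∀ x ∈ F, IsOut (P.inc x) (v (π x)) := fun x hx => hinc x hx ▸ hv.isOut (π x)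
  have hout' : ∀ x ∈ F, IsOut (P.inc x) (v' (π x)) := fun x hx => hinc x hx ▸ hv'.isOut (π x)
  -- splitting of the energy between `F` and the rest of the network
  have key : ∀ {ρ : D} {γ : Fin p} {u : A → Mode p n → ℝ} {z : B → Mode p n → ℝ},
      N.IsResponse D ρ γ u →
      ∑ x ∈ F, outEnergy (P.inc x) (P.tensor x) (u (π x) - z x) ≤ ε ^ 2 →
      1 - ∑ x ∈ F, outEnergy (P.inc x) (P.tensor x) (z x) ≤ ε ^ 2 →
      √(∑ x ∈ F, outEnergy (P.inc x) (P.tensor x) (u (π x))) ≤ 1 ∧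
      √(∑ x ∈ F, outEnergy (P.inc x) (P.tensor x) (z x)) ≤ 1 + ε ∧
      √(∑ x ∈ F, outEnergy (P.inc x) (P.tensor x) (u (π x) - z x)) ≤ ε ∧
      ∑ s ∈ D \ F.image π, outEnergy (N.inc s) (N.tensor s) (u s) ≤ 4 * ε ∧
      N.inFlux D u ≤ 4 * ε := by
    intro ρ γ u z hu hz1 hz2
    have e1 := hu.energy_add_inFlux hN ρ.2
    have e2 : N.energy D u = ∑ x ∈ F, outEnergy (P.inc x) (P.tensor x) (u (π x)) +
        ∑ s ∈ D \ F.image π, outEnergy (N.inc s) (N.tensor s) (u s) := by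
      rw [energy, ← Finset.sum_sdiff himg, add_comm, Finset.sum_image hπ]
      congr 1
      refine Finset.sum_congr rfl fun x hx => ?_
      rw [htensor x hx, hinc x hx]
    have e3 : 0 ≤ ∑ s ∈ D \ F.image π, outEnergy (N.inc s) (N.tensor s) (u s) :=
      Finset.sum_nonneg fun _ _ => outEnergy_nonneg
    have e4 := N.inFlux_nonneg D u
    have e5 := abs_sqrt_sum_outEnergy_sub_le (inc := P.inc) (M := P.tensor) F (fun x => u (π x)) z
    have e6 : √(∑ x ∈ F, outEnergy (P.inc x) (P.tensor x) (u (π x) - z x)) ≤ ε :=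
      (Real.sqrt_le_sqrt hz1).trans_eq (Real.sqrt_sq hε)
    have e7 : 0 ≤ ∑ x ∈ F, outEnergy (P.inc x) (P.tensor x) (u (π x)) :=
      Finset.sum_nonneg fun _ _ => outEnergy_nonneg
    have e8 : 0 ≤ ∑ x ∈ F, outEnergy (P.inc x) (P.tensor x) (z x) :=
      Finset.sum_nonneg fun _ _ => outEnergy_nonneg
    have f1 := Real.sq_sqrt e7
    have f2 := Real.sq_sqrt e8
    have f3 := Real.sqrt_nonneg (∑ x ∈ F, outEnergy (P.inc x) (P.tensor x) (u (π x)))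
    have f4 := Real.sqrt_nonneg (∑ x ∈ F, outEnergy (P.inc x) (P.tensor x) (z x))
    set X := √(∑ x ∈ F, outEnergy (P.inc x) (P.tensor x) (u (π x)))
    set Y := √(∑ x ∈ F, outEnergy (P.inc x) (P.tensor x) (z x))
    have g1 : X ≤ 1 := by
      have : X ^ 2 ≤ 1 := by linarith
      nlinarith
    have g2 := abs_le.1 (e5.trans e6)
    have g3 : Y ≤ 1 + ε := by linarith [g2.1]
    have g4 : 1 - X ^ 2 ≤ 4 * ε := by
      have : Y ^ 2 - X ^ 2 ≤ ε * (2 + ε) := by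
        have : (Y - X) * (Y + X) ≤ ε * (2 + ε) :=
          mul_le_mul (by linarith) (by linarith) (by positivity) hε
        nlinarith
      nlinarith
    exact ⟨g1, g3, e6, by linarith, by linarith⟩
  obtain ⟨a1, a2, a3, a4, a5⟩ := key hv h1 h2
  obtain ⟨b1, b2, b3, b4, b5⟩ := key hv' h1' h2'
  have c1 := abs_sum_noise_form_le (inc := P.inc) (M := P.tensor) F hP
    (v := fun x => v (π x) - w x) (v' := fun x => v' (π x))
    (fun x hx => (hout x hx).sub (hw x hx)) hout'
  have c2 := abs_sum_noise_form_le (inc := P.inc) (M := P.tensor) F hP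
    (v := w) (v' := fun x => v' (π x) - w' x) hw
    (fun x hx => (hout' x hx).sub (hw' x hx))
  have c3 := abs_sum_noise_form_le (inc := N.inc) (M := N.tensor) (D \ F.image π)
    (fun s _ => hN.tensor s) (v := v) (v' := v') (fun s _ => hv.isOut s) (fun s _ => hv'.isOut s)
  have c4 := abs_boundary_form_le (N := N) hΓ v v'
  have d1 := c1.trans (mul_le_mul a3 b1 (Real.sqrt_nonneg _) hε)
  have d2 := c2.trans (mul_le_mul a2 b3 (Real.sqrt_nonneg _) (by linarith))
  have d3 := c3.trans (mul_le_mul (Real.sqrt_le_sqrt a4) (Real.sqrt_le_sqrt b4)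
    (Real.sqrt_nonneg _) (Real.sqrt_nonneg _))
  have d4 := c4.trans (mul_le_mul (Real.sqrt_le_sqrt a5) (Real.sqrt_le_sqrt b5)
    (Real.sqrt_nonneg _) (Real.sqrt_nonneg _))
  rw [Real.mul_self_sqrt (by positivity)] at d3 d4
  have split : N.physCorr D Γ₀ r r' α β - ∑ x ∈ F, w x ⬝ᵥ P.tensor x *ᵥ w' x =
      ∑ x ∈ F, (v (π x) - w x) ⬝ᵥ P.tensor x *ᵥ v' (π x) +
      ∑ x ∈ F, w x ⬝ᵥ P.tensor x *ᵥ (v' (π x) - w' x) +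
      ∑ s ∈ D \ F.image π, v s ⬝ᵥ N.tensor s *ᵥ v' s +
      N.boundaryVec D (fun s => N.tensor s *ᵥ v s) ⬝ᵥ
        Γ₀ *ᵥ N.boundaryVec D (fun s => N.tensor s *ᵥ v' s) := by
    rw [physCorr_eq hN hD hv hv', ← Finset.sum_sdiff himg, Finset.sum_image hπ]
    have : ∑ x ∈ F, v (π x) ⬝ᵥ N.tensor (π x) *ᵥ v' (π x) =
        ∑ x ∈ F, (v (π x) - w x) ⬝ᵥ P.tensor x *ᵥ v' (π x) +
        ∑ x ∈ F, w x ⬝ᵥ P.tensor x *ᵥ (v' (π x) - w' x) +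
        ∑ x ∈ F, w x ⬝ᵥ P.tensor x *ᵥ w' x := by
      rw [← Finset.sum_add_distrib, ← Finset.sum_add_distrib]
      refine Finset.sum_congr rfl fun x hx => ?_
      rw [htensor x hx, sub_dotProduct, mulVec_sub, dotProduct_sub]
      ring
    rw [this]
    ring
  rw [split]
  have t1 := abs_add_le (∑ x ∈ F, (v (π x) - w x) ⬝ᵥ P.tensor x *ᵥ v' (π x) +
      ∑ x ∈ F, w x ⬝ᵥ P.tensor x *ᵥ (v' (π x) - w' x) +
      ∑ s ∈ D \ F.image π, v s ⬝ᵥ N.tensor s *ᵥ v' s)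
      (N.boundaryVec D (fun s => N.tensor s *ᵥ v s) ⬝ᵥ
        Γ₀ *ᵥ N.boundaryVec D (fun s => N.tensor s *ᵥ v' s))
  have t2 := abs_add_le (∑ x ∈ F, (v (π x) - w x) ⬝ᵥ P.tensor x *ᵥ v' (π x) +
      ∑ x ∈ F, w x ⬝ᵥ P.tensor x *ᵥ (v' (π x) - w' x))
      (∑ s ∈ D \ F.image π, v s ⬝ᵥ N.tensor s *ᵥ v' s)
  have t3 := abs_add_le (∑ x ∈ F, (v (π x) - w x) ⬝ᵥ P.tensor x *ᵥ v' (π x))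
      (∑ x ∈ F, w x ⬝ᵥ P.tensor x *ᵥ (v' (π x) - w' x))
  nlinarith

/-! ### Existence of responses and their mean square -/

/-- The matrix of one step of backward propagation inside `D`. -/
noncomputable def pullMatrix (N : Network A p n) (D : Finset A) :
    Matrix (D × Mode p n) (D × Mode p n) ℝ :=
  fun x y => match x.2 with
    | .inl _ => 0
    | .inr (a, i) => if (y.1 : A) = x.1 + N.step a ∧ ¬N.inc x.1 a then
        -N.tensor y.1 (.inr (a.opp, i)) y.2 else 0

lemma pullMatrix_mulVec {D : Finset A} (v : D × Mode p n → ℝ) {s : A} (hs : s ∈ D)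
    (μ : Mode p n) :
    (N.pullMatrix D *ᵥ v) (⟨s, hs⟩, μ) = N.pull (extend v) s μ := by
  rcases μ with α | ⟨a, i⟩
  · exact Finset.sum_eq_zero fun y _ => by simp [pullMatrix]
  · simp only [mulVec, dotProduct, Fintype.sum_prod_type, pullMatrix]
    by_cases ha : N.inc s a
    · simp [pull, ha]
    · by_cases hD : s + N.step a ∈ D
      · rw [Finset.sum_eq_single (⟨s + N.step a, hD⟩ : D)]
        · simp [pull, ha, mulVec, dotProduct, extend_of_mem v hD]
        · intro b _ hb
          refine Finset.sum_eq_zero fun ν _ => ?_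
          rw [if_neg, zero_mul]
          exact fun h => hb (Subtype.ext h.1)
        · simp
      · have h0 : ∀ b : D, ¬((b : A) = s + N.step a) := fun b h => hD (h ▸ b.2)
        simp [pull, ha, h0, extend_of_not_mem v hD]

/-- The backward step is a partial isometry: `L Lᵀ` is the projection onto the outgoing legs whose
neighbour lies in `D`. -/
lemma pullMatrix_mul_transpose (hN : N.IsIsometric) (D : Finset A) :
    N.pullMatrix D * (N.pullMatrix D)ᵀ = Matrix.diagonal fun x => match x.2 with
      | .inl _ => 0
      | .inr (a, _) => if (x.1 : A) + N.step a ∈ D ∧ ¬N.inc x.1 a then 1 else 0 := by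
  have hpure : ∀ s (μ ν : Mode p n), ∑ κ, N.tensor s μ κ * N.tensor s ν κ = if μ = ν then 1 else 0 := by
    intro s μ ν
    have h1 := (hN.tensor s).pure
    have h2 : N.tensor s * (N.tensor s)ᵀ = 1 := mul_eq_one_comm.1 h1
    have h3 := congrFun (congrFun h2 μ) ν
    rwa [Matrix.mul_apply, Matrix.one_apply] at h3
  ext ⟨s, μ⟩ ⟨s', μ'⟩
  rw [Matrix.mul_apply, Fintype.sum_prod_type]
  rcases μ with α | ⟨a, i⟩
  · rw [Finset.sum_eq_zero fun y _ => Finset.sum_eq_zero fun κ _ => by simp [pullMatrix]]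
    by_cases h : ((s, Sum.inl α) : D × Mode p n) = (s', μ')
    · rw [← h]
      simp
    · rw [Matrix.diagonal_apply_ne _ h]
  rcases μ' with α' | ⟨a', i'⟩
  · rw [Finset.sum_eq_zero fun y _ => Finset.sum_eq_zero fun κ _ => by simp [pullMatrix],
      Matrix.diagonal_apply_ne _ (by simp)]
  simp only [pullMatrix, transpose_apply]
  by_cases hD : (s : A) + N.step a ∈ D ∧ ¬N.inc s a
  · rw [Finset.sum_eq_single (⟨(s : A) + N.step a, hD.1⟩ : D)]
    · by_cases h : ((s, Sum.inr (a, i)) : D × Mode p n) = (s', Sum.inr (a', i'))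
      · simp only [Prod.mk.injEq, Sum.inr.injEq] at h
        obtain ⟨rfl, rfl, rfl⟩ := h
        simp [hD.1, hD.2, hpure]
      · rw [Matrix.diagonal_apply_ne _ h]
        by_cases hc : (s : A) + N.step a = s' + N.step a' ∧ ¬N.inc s' a'
        · have hne : ((Sum.inr (a.opp, i) : Mode p n)) ≠ Sum.inr (a'.opp, i') := by
            intro he
            simp only [Sum.inr.injEq, Prod.mk.injEq] at he
            obtain ⟨he, rfl⟩ := he
            have haa : a = a' := by rw [← a.opp_opp, he, a'.opp_opp]
            subst haa
            exact h (by rw [Subtype.ext (add_right_cancel hc.1)])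
          simp [hc.1, hc.2, hD.2, hpure, hne, -Sum.inr.injEq]
        · simp [hc]
    · intro b _ hb
      refine Finset.sum_eq_zero fun κ _ => ?_
      rw [if_neg, zero_mul]
      exact fun h => hb (Subtype.ext h.1)
    · simp
  · have h0 : ∀ b : D, ¬((b : A) = s + N.step a ∧ ¬N.inc s a) := fun b h => hD ⟨h.1 ▸ b.2, h.2⟩
    rw [Finset.sum_eq_zero fun y _ => Finset.sum_eq_zero fun κ _ => by rw [if_neg (h0 y), zero_mul]]
    by_cases h : ((s, Sum.inr (a, i)) : D × Mode p n) = (s', Sum.inr (a', i'))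
    · rw [← h]
      simp only [Matrix.diagonal_apply_eq]
      rw [if_neg hD]
    · rw [Matrix.diagonal_apply_ne _ h]

lemma isUnit_det_one_sub_pullMatrix {D : Finset A} (hD : N.IsAcyclicOn D) :
    IsUnit (1 - N.pullMatrix D).det := by
  rw [isUnit_iff_ne_zero]
  intro h0
  obtain ⟨v, hne, hv⟩ := Matrix.exists_mulVec_eq_zero_iff.2 h0
  refine hne ?_
  rw [sub_mulVec, one_mulVec, sub_eq_zero] at hv
  ext ⟨s, μ⟩
  have := eq_zero_of_eq_pull (v := extend v) hD (fun x hx => extend_of_not_mem v hx)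
    (Z := Set.univ) (fun _ _ _ _ => trivial) (fun x hx _ => ?_) (Set.mem_univ (s : A))
  · have := congrFun this μ
    rwa [extend_of_mem v s.2] at this
  · funext ν
    rw [← pullMatrix_mulVec v hx, ← hv, extend_of_mem v hx]

/-- The inverse `R` of `1 - L`, with `L` the backward step, has unit diagonal, since no directed
path in `D` is closed. -/
lemma inv_one_sub_pullMatrix_diag {D : Finset A} (hD : N.IsAcyclicOn D) (x : D × Mode p n) :
    (1 - N.pullMatrix D)⁻¹ x x = 1 := by
  have hu := isUnit_det_one_sub_pullMatrix hD
  set R := (1 - N.pullMatrix D)⁻¹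
  have hR : R = 1 + N.pullMatrix D * R := by
    have h1 : (1 - N.pullMatrix D) * R = 1 := mul_nonsing_inv _ hu
    rw [sub_mul, one_mul] at h1
    exact sub_eq_iff_eq_add.1 h1
  -- entries of `R` vanish unless there is a directed path between the two sites
  obtain ⟨ρ, hρ⟩ := hD
  have hstep : ∀ y z : D × Mode p n, N.pullMatrix D y z ≠ 0 → ρ y.1 < ρ z.1 := by
    rintro ⟨s, μ⟩ ⟨s', ν⟩ h
    rcases μ with α | ⟨a, i⟩
    · simp [pullMatrix] at h
    · simp only [pullMatrix] at h
      by_cases hc : (s' : A) = s + N.step a ∧ ¬N.inc s a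
      · have := hρ s s.2 a hc.2 (hc.1 ▸ s'.2)
        rw [← hc.1] at this
        exact this
      · rw [if_neg hc] at h
        exact absurd rfl h
  have hzero : ∀ y, ρ x.1 < ρ y.1 → R y x = 0 := by
    intro y hy
    by_contra hne
    let B := (Finset.univ : Finset (D × Mode p n)).filter fun y => ρ x.1 < ρ y.1 ∧ R y x ≠ 0
    have hB : B.Nonempty := ⟨y, by simp [B, hy, hne]⟩
    obtain ⟨z, hz, hmax⟩ := B.exists_max_image (fun y => ρ y.1) hB
    simp only [B, Finset.mem_filter, Finset.mem_univ, true_and] at hz hmax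
    refine hz.2 ?_
    have hzx : z ≠ x := fun h => lt_irrefl _ (h ▸ hz.1)
    rw [hR, Matrix.add_apply, Matrix.one_apply_ne hzx, zero_add, Matrix.mul_apply]
    refine Finset.sum_eq_zero fun y' _ => ?_
    by_contra hne'
    have h1 := hstep z y' (left_ne_zero_of_mul hne')
    exact absurd h1 (not_lt.2 (hmax y' ⟨hz.1.trans h1, right_ne_zero_of_mul hne'⟩))
  rw [hR, Matrix.add_apply, Matrix.one_apply_eq, Matrix.mul_apply, Finset.sum_eq_zero, add_zero]
  intro y _
  by_contra hne
  exact right_ne_zero_of_mul hne (hzero y (hstep x y (left_ne_zero_of_mul hne)))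

/-- The response as a column of `R = (1 - L)⁻¹`. -/
noncomputable def response (N : Network A p n) (D : Finset A) (r : A) (α : Fin p) :
    A → Mode p n → ℝ :=
  extend fun x : D × Mode p n => if h : r ∈ D then (1 - N.pullMatrix D)⁻¹ x (⟨r, h⟩, .inl α) else 0

lemma isResponse_response {D : Finset A} (hD : N.IsAcyclicOn D) {r : A} (hr : r ∈ D) (α : Fin p) :
    N.IsResponse D r α (N.response D r α) := by
  refine ⟨fun s hs => extend_of_not_mem _ hs, fun s hs => ?_⟩
  have hu := isUnit_det_one_sub_pullMatrix hD
  set R := (1 - N.pullMatrix D)⁻¹ with hRdef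
  have hR : R = 1 + N.pullMatrix D * R := by
    have h1 : (1 - N.pullMatrix D) * R = 1 := mul_nonsing_inv _ hu
    rw [sub_mul, one_mul] at h1
    exact sub_eq_iff_eq_add.1 h1
  funext μ
  have hcol : N.response D r α = extend fun x : D × Mode p n => R x (⟨r, hr⟩, .inl α) := by
    simp only [response, hr, dif_pos, hRdef]
  rw [hcol, extend_of_mem _ hs, Pi.add_apply, ← pullMatrix_mulVec _ hs]
  conv_lhs => rw [hR]
  rw [Matrix.add_apply]
  congr 1
  simp only [Matrix.one_apply, source, Prod.ext_iff, Subtype.ext_iff]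

/-- By isometry each mode of `D` emits unit energy into the physical and the outgoing modes, so
that the squared norm of a response is bounded on average. This is the diagonal of
`R (1 - L Lᵀ) Rᵀ = R + Rᵀ - 1`. -/
theorem sum_response_le (hN : N.IsIsometric) {D : Finset A} (hD : N.IsAcyclicOn D) (α : Fin p) :
    ∑ r ∈ D, ∑ s ∈ D, N.response D r α s ⬝ᵥ N.response D r α s ≤
      Fintype.card (Mode p n) * D.card := by
  have hu := isUnit_det_one_sub_pullMatrix hD
  set L := N.pullMatrix D with hL
  set R := (1 - L)⁻¹ with hR
  have hLR : R * L = R - 1 := by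
    have h1 : R * (1 - L) = 1 := nonsing_inv_mul _ hu
    rw [mul_sub, mul_one] at h1
    rw [← h1]
    abel
  have hid : R * (1 - L * Lᵀ) * Rᵀ = R + Rᵀ - 1 := by
    have : R * (1 - L * Lᵀ) * Rᵀ = R * Rᵀ - (R * L) * (R * L)ᵀ := by
      rw [transpose_mul]
      noncomm_ring
    rw [this, hLR, transpose_sub, transpose_one]
    noncomm_ring
  have hdiag : ∀ x, ∑ r : D, R x (r, .inl α) ^ 2 ≤ 1 := by
    intro x
    have h1 := congrFun (congrFun hid x) x
    have hx : R x x = 1 := inv_one_sub_pullMatrix_diag hD x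
    rw [Matrix.sub_apply, Matrix.add_apply, transpose_apply, hx, Matrix.one_apply_eq, hL, pullMatrix_mul_transpose hN, ← diagonal_one, diagonal_sub,
      Matrix.mul_apply, Fintype.sum_prod_type] at h1
    simp only [Matrix.mul_diagonal, transpose_apply] at h1
    have h2 : ∑ r : D, R x (r, .inl α) ^ 2 ≤ (1 : ℝ) + 1 - 1 := by
      rw [← h1]
      refine Finset.sum_le_sum fun r _ => ?_
      refine le_trans (le_of_eq ?_) (Finset.single_le_sum (fun μ _ => ?_)
        (Finset.mem_univ (Sum.inl α : Mode p n)))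
      · simp [sq]
      · rcases μ with γ | ⟨a, i⟩
        · simp [mul_self_nonneg]
        · dsimp only
          split_ifs
          · simp
          · simp [mul_self_nonneg]
    linarith
  have hswap : ∑ r ∈ D, ∑ s ∈ D, N.response D r α s ⬝ᵥ N.response D r α s =
      ∑ x : D × Mode p n, ∑ r : D, R x (r, .inl α) ^ 2 := by
    rw [Finset.sum_comm (s := (Finset.univ : Finset (D × Mode p n))), ← Finset.sum_coe_sort D]
    refine Finset.sum_congr rfl fun r _ => ?_
    rw [← Finset.sum_coe_sort D, Fintype.sum_prod_type]
    refine Finset.sum_congr rfl fun s _ => Finset.sum_congr rfl fun μ _ => ?_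
    simp [response, extend, sq, hR, hL]
  rw [hswap]
  refine (Finset.sum_le_sum fun x _ => hdiag x).trans (le_of_eq ?_)
  simp [mul_comm]

end Network

namespace Network

variable {p n : ℕ}

/-! ### Square-summable responses of a network on the plane -/

/-- The box `[-k, k]²`. -/
noncomputable def siteBox (k : ℕ) : Finset (ℤ × ℤ) :=
  Finset.Icc (-(k : ℤ)) k ×ˢ Finset.Icc (-(k : ℤ)) k

lemma mem_box {k : ℕ} {s : ℤ × ℤ} : s ∈ siteBox k ↔ |s.1| ≤ k ∧ |s.2| ≤ k := by
  simp only [siteBox, Finset.mem_product, Finset.mem_Icc, abs_le]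

lemma box_mono {k l : ℕ} (h : k ≤ l) : siteBox k ⊆ siteBox l := fun s hs => by
  rw [mem_box] at hs ⊢
  omega

lemma card_box (k : ℕ) : (siteBox k).card = (2 * k + 1) ^ 2 := by
  rw [siteBox, Finset.card_product, Int.card_Icc, sq]
  have : ((k : ℤ) + 1 - -(k : ℤ)).toNat = 2 * k + 1 := by omega
  rw [this]

lemma exists_mem_box (s : ℤ × ℤ) : ∃ k, s ∈ siteBox k :=
  ⟨s.1.natAbs + s.2.natAbs, by rw [mem_box, abs_le, abs_le]; omega⟩

lemma tendsto_box : Tendsto siteBox atTop atTop := by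
  refine tendsto_atTop_finset_of_monotone (fun _ _ h => box_mono h) exists_mem_box

/-- A network on the lattice `ℤ²` of isometric tensors without directed cycles, invariant under
translations by even vectors. -/
structure IsPlane (P : Network (ℤ × ℤ) p n) : Prop where
  e₁ : P.e₁ = (1, 0)
  e₂ : P.e₂ = (0, 1)
  isometric : P.IsIsometric
  acyclic : ∀ D, P.IsAcyclicOn D
  tensor_add : ∀ s z, P.tensor (s + 2 • z) = P.tensor s
  inc_add : ∀ s z, P.inc (s + 2 • z) = P.inc s

variable {P : Network (ℤ × ℤ) p n}

lemma IsPlane.add_step_mem_box (hP : P.IsPlane) {k : ℕ} {s : ℤ × ℤ} (hs : s ∈ siteBox k) (a : Leg) :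
    s + P.step a ∈ siteBox (k + 1) := by
  rw [mem_box, abs_le, abs_le] at hs ⊢
  push_cast
  cases a <;> simp only [step, hP.e₁, hP.e₂, Prod.fst_add, Prod.snd_add, Prod.fst_neg,
    Prod.snd_neg] <;> omega

lemma IsPlane.pull_translate (hP : P.IsPlane) (v : ℤ × ℤ → Mode p n → ℝ) (z s : ℤ × ℤ) :
    P.pull (fun x => v (x + 2 • z)) s = P.pull v (s + 2 • z) := by
  ext μ
  rcases μ with α | ⟨a, i⟩
  · rfl
  · have h1 : s + 2 • z + P.step a = s + P.step a + 2 • z := by abel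
    simp only [pull, hP.inc_add, h1, hP.tensor_add]

lemma source_translate (r : ℤ × ℤ) (α : Fin p) (z s : ℤ × ℤ) :
    source (n := n) (r + 2 • z) α (s + 2 • z) = source r α s := by
  funext μ
  simp [source]

/-- The function `f` does not decrease along the arrows of the network. -/
def IsTime (P : Network (ℤ × ℤ) p n) (f : ℤ × ℤ →+ ℤ) : Prop :=
  ∀ s a, ¬P.inc s a → 0 ≤ f (P.step a)

/-- A square-summable response of the infinite network to the physical mode `α` at `r`, supported
in the past of `r`. -/
structure IsPlaneResponse (P : Network (ℤ × ℤ) p n) (r : ℤ × ℤ) (α : Fin p)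
    (v : ℤ × ℤ → Mode p n → ℝ) : Prop where
  eq : ∀ s, v s = source r α s + P.pull v s
  summable : Summable fun s => v s ⬝ᵥ v s
  causal : ∀ f, P.IsTime f → ∀ s, f r < f s → v s = 0

lemma IsPlaneResponse.isOut {r : ℤ × ℤ} {α : Fin p} {v : ℤ × ℤ → Mode p n → ℝ}
    (h : P.IsPlaneResponse r α v) (s : ℤ × ℤ) : IsOut (P.inc s) (v s) :=
  isOut_of_eq_source_add_pull (h.eq s)

lemma IsPlaneResponse.translate (hP : P.IsPlane) {r : ℤ × ℤ} {α : Fin p}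
    {v : ℤ × ℤ → Mode p n → ℝ} (h : P.IsPlaneResponse r α v) (z : ℤ × ℤ) :
    P.IsPlaneResponse (r + 2 • z) α fun s => v (s - 2 • z) := by
  refine ⟨fun s => ?_, ?_, fun f hf s hs => h.causal f hf _ ?_⟩
  · obtain ⟨s, rfl⟩ : ∃ t, s = t + 2 • z := ⟨s - 2 • z, by abel⟩
    rw [source_translate, ← hP.pull_translate, add_sub_cancel_right]
    simp only [add_sub_cancel_right]
    exact h.eq s
  · exact h.summable.comp_injective (i := fun s => s - 2 • z) fun s t hst => sub_left_inj.1 hst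
  · rw [map_add] at hs
    rw [map_sub]
    omega

/-- In a large box, the responses to the translates of a given physical mode have bounded mean
square norm. Translating the source with the smallest norm back gives an approximate response of
the infinite network, with a bound on its norm that does not depend on the box. -/
lemma IsPlane.exists_approx_response (hP : P.IsPlane) (r : ℤ × ℤ) (α : Fin p) {k : ℕ} (hk : 1 ≤ k)
    (hr : r ∈ siteBox k) :
    ∃ v : ℤ × ℤ → Mode p n → ℝ, (∀ s ∈ siteBox k, v s = source r α s + P.pull v s) ∧
      (∀ F : Finset (ℤ × ℤ), ∑ s ∈ F, v s ⬝ᵥ v s ≤ 49 * (Fintype.card (Mode p n) : ℝ)) ∧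
      ∀ f, P.IsTime f → ∀ s, f r < f s → v s = 0 := by
  set D := siteBox (3 * k) with hD
  set M : ℝ := (Fintype.card (Mode p n) : ℝ) with hM
  let E : ℤ × ℤ → ℝ := fun y => ∑ s ∈ D, P.response D y α s ⬝ᵥ P.response D y α s
  let S : Finset (ℕ × ℕ) := Finset.range k ×ˢ Finset.range k
  let τ : ℕ × ℕ → ℤ × ℤ := fun x => ((x.1 : ℤ), (x.2 : ℤ))
  have hτ : ∀ x ∈ S, ∀ s ∈ siteBox k, s + 2 • τ x ∈ D := by
    intro x hx s hs
    simp only [S, Finset.mem_product, Finset.mem_range] at hx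
    rw [mem_box, abs_le, abs_le] at hs
    rw [hD, mem_box, abs_le, abs_le]
    simp only [τ, Prod.fst_add, Prod.snd_add, Prod.smul_mk, nsmul_eq_mul]
    push_cast
    omega
  obtain ⟨x, hx, hxE⟩ : ∃ x ∈ S, E (r + 2 • τ x) ≤ 49 * M := by
    by_contra! hcon
    have h1 : ∑ x ∈ S, (49 * M) < ∑ x ∈ S, E (r + 2 • τ x) := by
      refine Finset.sum_lt_sum_of_nonempty ?_ hcon
      exact ⟨(0, 0), by simp [S]; omega⟩
    have h2 : ∑ x ∈ S, E (r + 2 • τ x) ≤ ∑ y ∈ D, E y := by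
      have hinj : Set.InjOn (fun x => r + 2 • τ x) S := by
        intro x _ y _ hxy
        have := congrArg Prod.fst hxy
        have := congrArg Prod.snd hxy
        simp only [τ, Prod.fst_add, Prod.snd_add, Prod.smul_mk, nsmul_eq_mul, Nat.cast_ofNat,
          add_right_inj] at *
        ext <;> omega
      rw [← Finset.sum_image (f := E) hinj]
      refine Finset.sum_le_sum_of_subset_of_nonneg ?_ fun y _ _ =>
        Finset.sum_nonneg fun s _ => dotProduct_self_nonneg' _
      intro y hy
      obtain ⟨x, hx, rfl⟩ := Finset.mem_image.1 hy
      exact hτ x hx r hr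
    have h3 : ∑ y ∈ D, E y ≤ M * D.card := sum_response_le hP.isometric (hP.acyclic D) α
    have hS : ∑ x ∈ S, (49 * M) = k * k * (49 * M) := by simp [S]
    have hc : (D.card : ℝ) = (2 * (3 * k) + 1) ^ 2 := by
      rw [hD, card_box]
      push_cast
      ring
    rw [hS] at h1
    rw [hc] at h3
    have hk' : (1 : ℝ) ≤ k := by exact_mod_cast hk
    have hM0 : 0 ≤ M := Nat.cast_nonneg _
    have h4 : (2 * (3 * (k : ℝ)) + 1) ^ 2 ≤ 49 * (k * k) := by nlinarith
    have h5 := mul_le_mul_of_nonneg_left h4 hM0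
    linarith
  have hy : r + 2 • τ x ∈ D := hτ x hx r hr
  have hresp := isResponse_response (hP.acyclic D) hy α
  refine ⟨fun s => P.response D (r + 2 • τ x) α (s + 2 • τ x), fun s hs => ?_, fun F => ?_,
    fun f hf s hs => ?_⟩
  · rw [hP.pull_translate, ← source_translate r α (τ x) s]
    exact hresp.eq _ (hτ x hx s hs)
  · refine le_trans ?_ hxE
    have h1 : ∑ s ∈ F, P.response D (r + 2 • τ x) α (s + 2 • τ x) ⬝ᵥ
        P.response D (r + 2 • τ x) α (s + 2 • τ x) =
        ∑ s ∈ F.image (· + 2 • τ x), P.response D (r + 2 • τ x) α s ⬝ᵥ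
          P.response D (r + 2 • τ x) α s := by
      rw [Finset.sum_image fun a _ b _ h => add_right_cancel h]
    rw [h1, ← Finset.sum_filter_of_ne (p := (· ∈ D))]
    · exact Finset.sum_le_sum_of_subset_of_nonneg (fun s hs => (Finset.mem_filter.1 hs).2)
        fun s _ _ => dotProduct_self_nonneg' _
    · intro s _ hs
      by_contra hsD
      exact hs (by rw [hresp.off s hsD, zero_dotProduct])
  · refine hresp.eq_zero_of_not_mem (hP.acyclic D) (Z := {s | f (r + 2 • τ x) < f s})
      (fun s hs a ha => ?_) (fun h => lt_irrefl (f (r + 2 • τ x)) h) ?_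
    · have := hf s a ha
      simp only [Set.mem_ofPred_eq, map_add] at hs ⊢
      omega
    · simp only [Set.mem_ofPred_eq, map_add] at hs ⊢
      omega

/-- A limit, along an ultrafilter, of the approximate responses. -/
theorem IsPlane.exists_planeResponse (hP : P.IsPlane) (r : ℤ × ℤ) (α : Fin p) :
    ∃ v, P.IsPlaneResponse r α v := by
  obtain ⟨k₀, hk₀⟩ := exists_mem_box r
  have hex : ∀ k : ℕ, ∃ v : ℤ × ℤ → Mode p n → ℝ,
      (∀ s ∈ siteBox k, v s = source r α s + P.pull v s) ∧
      (∀ F : Finset (ℤ × ℤ), ∑ s ∈ F, v s ⬝ᵥ v s ≤ 49 * (Fintype.card (Mode p n) : ℝ)) ∧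
      ∀ f, P.IsTime f → ∀ s, f r < f s → v s = 0 := by
    intro k
    obtain ⟨v, h1, h2, h3⟩ := hP.exists_approx_response r α (k := k + k₀ + 1) (by omega)
      (box_mono (by omega) hk₀)
    exact ⟨v, fun s hs => h1 s (box_mono (by omega) hs), h2, h3⟩
  choose v hloc hsum hcaus using hex
  set C : ℝ := 49 * (Fintype.card (Mode p n) : ℝ) with hC
  have hbound : ∀ k s μ, v k s μ ∈ Set.Icc (-√C) √C := by
    intro k s μ
    rw [Set.mem_Icc, ← abs_le]
    refine Real.abs_le_sqrt ((?_ : _ ≤ v k s ⬝ᵥ v k s).trans ?_)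
    · rw [sq]
      exact Finset.single_le_sum (f := fun μ => v k s μ * v k s μ)
        (fun ν _ => mul_self_nonneg _) (Finset.mem_univ μ)
    · simpa using hsum k {s}
  have hlim : ∀ s μ, ∃ l, Tendsto (fun k => v k s μ) (hyperfilter ℕ) (𝓝 l) := by
    intro s μ
    obtain ⟨l, -, hl⟩ := (isCompact_Icc (a := -√C) (b := √C)).ultrafilter_le_nhds
      ((hyperfilter ℕ).map fun k => v k s μ) (by
        rw [le_principal_iff]
        exact Filter.mem_map.2 (Filter.univ_mem' fun k => hbound k s μ))
    exact ⟨l, hl⟩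
  choose w hw using hlim
  have hfin : ∀ F : Finset (ℤ × ℤ), ∑ s ∈ F, w s ⬝ᵥ w s ≤ C := by
    intro F
    have h : Tendsto (fun k => ∑ s ∈ F, v k s ⬝ᵥ v k s) (hyperfilter ℕ)
        (𝓝 (∑ s ∈ F, w s ⬝ᵥ w s)) :=
      tendsto_finsetSum _ fun s _ => tendsto_finsetSum _ fun μ _ => (hw s μ).mul (hw s μ)
    exact le_of_tendsto' h fun k => hsum k F
  refine ⟨w, fun s => ?_, ?_, fun f hf s hs => ?_⟩
  · have hpull : ∀ μ, Tendsto (fun k => P.pull (v k) s μ) (hyperfilter ℕ) (𝓝 (P.pull w s μ)) := by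
      intro μ
      rcases μ with α | ⟨a, i⟩
      · exact tendsto_const_nhds
      · simp only [pull]
        split_ifs
        · exact tendsto_const_nhds
        · exact Tendsto.neg (tendsto_finsetSum Finset.univ fun ν _ => (hw (s + P.step a) ν).const_mul
            (P.tensor (s + P.step a) (.inr (a.opp, i)) ν))
    funext μ
    have h1 : Tendsto (fun k => v k s μ) (hyperfilter ℕ) (𝓝 ((source r α s + P.pull w s : Mode p n → ℝ) μ)) := by
      refine Tendsto.congr' ?_ ((hpull μ).const_add (source r α s μ))
      have hev : ∀ᶠ k in (hyperfilter ℕ : Filter ℕ), s ∈ siteBox k := by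
        obtain ⟨l, hl⟩ := exists_mem_box s
        refine Filter.Eventually.filter_mono (Nat.hyperfilter_le_atTop) ?_
        exact (eventually_ge_atTop l).mono fun k hk => box_mono hk hl
      exact hev.mono fun k hk => (congrFun (hloc k s hk) μ).symm
    exact tendsto_nhds_unique (hw s μ) h1
  · exact summable_of_sum_le (fun s => dotProduct_self_nonneg' _) hfin
  · funext μ
    refine tendsto_nhds_unique (hw s μ) ?_
    simp only [hcaus _ f hf s hs]
    exact tendsto_const_nhds

end Network

namespace Network

variable {p n : ℕ}

/-! ### The bulk two-point function -/

section Flux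

variable {A : Type} [AddCommGroup A] {N : Network A p n}

lemma sum_legs_le (v : Mode p n → ℝ) (q : Leg → Prop) {_ : DecidablePred q} :
    ∑ a, (if q a then ∑ i, v (.inr (a, i)) ^ 2 else 0) ≤ v ⬝ᵥ v := by
  simp only [dotProduct, Fintype.sum_sum_type, Fintype.sum_prod_type, ← sq]
  refine le_add_of_nonneg_of_le (Finset.sum_nonneg fun _ _ => sq_nonneg _)
    (Finset.sum_le_sum fun a _ => ?_)
  split_ifs
  · exact le_rfl
  · exact Finset.sum_nonneg fun _ _ => sq_nonneg _

lemma sum_eq_sum_sdiff {B : Type} [DecidableEq B] {D D' : Finset B} {F : B → ℝ}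
    (h : ∀ s ∈ D', F s = 0) : ∑ s ∈ D, F s = ∑ s ∈ D \ D', F s := by
  refine (Finset.sum_subset (Finset.sdiff_subset (s := D) (t := D')) fun s hs hs' => h s ?_).symm
  by_contra hc
  exact hs' (by rw [Finset.mem_sdiff]; exact ⟨hs, hc⟩)

lemma inFlux_le [DecidableEq A] (hN : N.IsIsometric) {D D' : Finset A}
    (h : ∀ s ∈ D', ∀ a, s + N.step a ∈ D) (v : A → Mode p n → ℝ) :
    N.inFlux D v ≤ ∑ s ∈ D \ D', v s ⬝ᵥ v s := by
  rw [inFlux, sum_eq_sum_sdiff (D' := D')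
    fun s hs => Finset.sum_eq_zero fun a _ => if_neg fun hb => hb.2 (h s hs a)]
  refine Finset.sum_le_sum fun s _ => ?_
  rw [← (hN.tensor s).dotProduct_mulVec_mulVec]
  exact sum_legs_le _ _

lemma outFlux_le [DecidableEq A] {D D' : Finset A} (h : ∀ s ∈ D', ∀ a, s + N.step a ∈ D)
    (v : A → Mode p n → ℝ) : N.outFlux D v ≤ ∑ s ∈ D \ D', v s ⬝ᵥ v s := by
  rw [outFlux]
  refine le_of_eq_of_le (sum_eq_sum_sdiff (D' := D') fun s hs => Finset.sum_eq_zero fun a _ => ?_)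
    (Finset.sum_le_sum fun s _ => sum_legs_le (v s) _)
  rw [if_neg fun hb => hb.2 (h s hs a)]

end Flux

variable {P : Network (ℤ × ℤ) p n}

/-- On a large box the response of the plane loses only little energy. -/
lemma IsPlaneResponse.one_sub_energy_le (hP : P.IsPlane) {r : ℤ × ℤ} {α : Fin p}
    {v : ℤ × ℤ → Mode p n → ℝ} (h : P.IsPlaneResponse r α v) {k : ℕ} (hr : r ∈ siteBox k) :
    1 - P.energy (siteBox (k + 1)) v ≤ ∑ s ∈ siteBox (k + 1) \ siteBox k, v s ⬝ᵥ v s := by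
  have h1 := energy_add_inFlux hP.isometric (siteBox (k + 1)) (v := v) (fun s _ => h.isOut s)
    (fun s _ a i _ _ => by rw [h.eq s]; simp [source])
  have h2 := inFlux_le hP.isometric (D := siteBox (k + 1)) (fun s hs a => hP.add_step_mem_box hs a) v
  have h3 := P.outFlux_nonneg (siteBox (k + 1)) v
  have h4 : 1 ≤ ∑ s ∈ siteBox (k + 1), ∑ β, v s (.inl β) ^ 2 := by
    have e1 : v r (.inl α) ^ 2 = 1 := by
      rw [h.eq r]
      simp [source, pull]
    rw [← e1]
    refine le_trans ?_ (Finset.single_le_sum (f := fun s => ∑ β, v s (.inl β) ^ 2)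
      (fun s _ => Finset.sum_nonneg fun _ _ => sq_nonneg _) (box_mono k.le_succ hr))
    exact Finset.single_le_sum (f := fun β => v r (.inl β) ^ 2) (fun _ _ => sq_nonneg _)
      (Finset.mem_univ α)
  linarith

/-- The response of a finite region containing a large box is close to the response of the plane:
their difference propagates backward freely from the outgoing legs that leave the region. -/
lemma IsPlaneResponse.energy_sub_le (hP : P.IsPlane) {r : ℤ × ℤ} {α : Fin p}
    {v : ℤ × ℤ → Mode p n → ℝ} (h : P.IsPlaneResponse r α v) {k : ℕ} {D : Finset (ℤ × ℤ)}
    (hD : siteBox (k + 1) ⊆ D) {w : ℤ × ℤ → Mode p n → ℝ} (hw : P.IsResponse D r α w) :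
    P.energy D (w - v) ≤ ∑ s ∈ D \ siteBox k, v s ⬝ᵥ v s := by
  have h1 := energy_add_inFlux hP.isometric D (v := w - v)
    (fun s _ => (hw.isOut s).sub (h.isOut s))
    (fun s hs a i _ _ => by
      rw [pull_sub, Pi.sub_apply, Pi.sub_apply, Pi.sub_apply, hw.eq s hs, h.eq s]
      simp [source])
  have h2 : ∑ s ∈ D, ∑ β, (w - v) s (.inl β) ^ 2 = 0 := by
    refine Finset.sum_eq_zero fun s hs => Finset.sum_eq_zero fun β _ => ?_
    rw [Pi.sub_apply, hw.eq s hs, h.eq s]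
    simp [pull]
  have h3 : P.outFlux D (w - v) = P.outFlux D v := by
    refine Finset.sum_congr rfl fun s hs => Finset.sum_congr rfl fun a _ => ?_
    split_ifs with hc
    · refine Finset.sum_congr rfl fun i _ => ?_
      have : w s (.inr (a, i)) = 0 := by
        rw [hw.eq s hs]
        simp [source, pull, hc.1, hw.off _ hc.2]
      rw [Pi.sub_apply, Pi.sub_apply, this, zero_sub, neg_sq]
    · rfl
  have h4 := outFlux_le (N := P) (fun s hs a => hD (hP.add_step_mem_box hs a)) v
  have h5 := P.inFlux_nonneg D (w - v)
  linarith

/-- The representative of a site in the unit cell `{0, 1}²`. -/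
def cellRep (r : ℤ × ℤ) : ℤ × ℤ := (r.1 % 2, r.2 % 2)

/-- The unit cell of a site. -/
def cellIndex (r : ℤ × ℤ) : ℤ × ℤ := (r.1 / 2, r.2 / 2)

lemma cellRep_add (r : ℤ × ℤ) : cellRep r + 2 • cellIndex r = r := by
  ext <;> simp [cellRep, cellIndex, Int.emod_add_mul_ediv]

lemma cellRep_translate (r z : ℤ × ℤ) : cellRep (r + 2 • z) = cellRep r := by
  ext <;> simp [cellRep]

lemma cellIndex_translate (r z : ℤ × ℤ) : cellIndex (r + 2 • z) = cellIndex r + z := by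
  ext <;> simp only [cellIndex, Prod.fst_add, Prod.snd_add, two_nsmul] <;> omega

/-- A response of the plane. -/
noncomputable def someResponse (hP : P.IsPlane) (r : ℤ × ℤ) (α : Fin p) : ℤ × ℤ → Mode p n → ℝ :=
  (hP.exists_planeResponse r α).choose

/-- The responses of the plane, chosen covariantly under translations. -/
noncomputable def planeResponse (hP : P.IsPlane) (r : ℤ × ℤ) (α : Fin p) :
    ℤ × ℤ → Mode p n → ℝ :=
  fun s => someResponse hP (cellRep r) α (s - 2 • cellIndex r)

lemma isPlaneResponse_planeResponse (hP : P.IsPlane) (r : ℤ × ℤ) (α : Fin p) :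
    P.IsPlaneResponse r α (planeResponse hP r α) := by
  have h := (hP.exists_planeResponse (cellRep r) α).choose_spec.translate hP (cellIndex r)
  rwa [cellRep_add] at h

lemma planeResponse_translate (hP : P.IsPlane) (r z : ℤ × ℤ) (α : Fin p) (s : ℤ × ℤ) :
    planeResponse hP (r + 2 • z) α s = planeResponse hP r α (s - 2 • z) := by
  simp only [planeResponse, cellRep_translate, cellIndex_translate]
  congr 1
  rw [smul_add]
  abel_nf

/-- The two-point function of the infinite network. -/
noncomputable def bulkCorr (hP : P.IsPlane) (r r' : ℤ × ℤ) : Matrix (Fin p) (Fin p) ℝ :=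
  fun α β => ∑' s, planeResponse hP r α s ⬝ᵥ P.tensor s *ᵥ planeResponse hP r' β s

lemma abs_dotProduct_le {κ : Type*} [Fintype κ] (x y : κ → ℝ) :
    |x ⬝ᵥ y| ≤ x ⬝ᵥ x + y ⬝ᵥ y := by
  have h1 := dotProduct_self_nonneg' (x - y)
  have h2 := dotProduct_self_nonneg' (x + y)
  simp only [sub_dotProduct, dotProduct_sub, add_dotProduct, dotProduct_add,
    dotProduct_comm y x] at h1 h2
  have h3 := dotProduct_self_nonneg' x
  have h4 := dotProduct_self_nonneg' y
  rw [abs_le]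
  constructor <;> linarith

lemma IsPlane.summable_noise_form (hP : P.IsPlane) {v v' : ℤ × ℤ → Mode p n → ℝ}
    (hv : Summable fun s => v s ⬝ᵥ v s) (hv' : Summable fun s => v' s ⬝ᵥ v' s) :
    Summable fun s => v s ⬝ᵥ P.tensor s *ᵥ v' s := by
  refine Summable.of_norm_bounded (hv.add hv') fun s => ?_
  rw [Real.norm_eq_abs, ← (hP.isometric.tensor s).dotProduct_mulVec_mulVec (v := v' s)]
  exact abs_dotProduct_le _ _

lemma bulkCorr_translate (hP : P.IsPlane) (r r' z : ℤ × ℤ) :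
    bulkCorr hP (r + 2 • z) (r' + 2 • z) = bulkCorr hP r r' := by
  ext α β
  simp only [bulkCorr, planeResponse_translate]
  rw [← (Equiv.addRight (2 • z)).tsum_eq]
  refine tsum_congr fun s => ?_
  simp [hP.tensor_add, -smul_eq_mul, -nsmul_eq_mul]

/-- The bulk limit, for any network that looks like the plane on a large box and whose responses
are close to those of the plane there. -/
theorem IsPlane.exists_box_abs_physCorr_sub_le (hP : P.IsPlane) (r r' : ℤ × ℤ) {ε : ℝ}
    (hε : 0 < ε) :
    ∃ k, r ∈ siteBox k ∧ r' ∈ siteBox k ∧ ∀ {A : Type} [AddCommGroup A] {N : Network A p n}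
      (_ : N.IsIsometric) {D : Finset A} (_ : N.IsAcyclicOn D)
      {Γ₀ : Matrix (D × Leg × Fin n) (D × Leg × Fin n) ℝ} (_ : IsCorrelationMatrix Γ₀)
      {π : ℤ × ℤ → A} (_ : Set.InjOn π (siteBox (k + 1))) (_ : ∀ x ∈ siteBox (k + 1), π x ∈ D)
      (_ : ∀ x ∈ siteBox (k + 1), N.tensor (π x) = P.tensor x)
      (_ : ∀ x ∈ siteBox (k + 1), N.inc (π x) = P.inc x)
      (_ : ∀ t ∈ siteBox k, ∀ α v, N.IsResponse D (π t) α v → ∃ F, Disjoint F (siteBox k) ∧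
        ∑ x ∈ siteBox (k + 1), outEnergy (P.inc x) (P.tensor x) (v (π x) - planeResponse hP t α x) ≤
          ∑ x ∈ F, planeResponse hP t α x ⬝ᵥ planeResponse hP t α x)
      (hr : π r ∈ D) (hr' : π r' ∈ D) (α β : Fin p),
      |N.physCorr D Γ₀ ⟨π r, hr⟩ ⟨π r', hr'⟩ α β - bulkCorr hP r r' α β| ≤ ε := by
  have hres := isPlaneResponse_planeResponse hP
  set δ : ℝ := min 1 (ε / 22) with hδ
  have hδ0 : 0 < δ := lt_min one_pos (by positivity)
  have hδ1 : δ ≤ 1 := min_le_left _ _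
  have hδε : 11 * δ ≤ ε / 2 := by
    have := min_le_right 1 (ε / 22)
    linarith
  have htail : ∀ t α, ∀ᶠ k in atTop, ∀ F : Finset (ℤ × ℤ), Disjoint F (siteBox k) →
      ∑ x ∈ F, planeResponse hP t α x ⬝ᵥ planeResponse hP t α x ≤ δ ^ 2 := by
    intro t α
    obtain ⟨S, hS⟩ := summable_iff_vanishing_norm.1 (hres t α).summable (δ ^ 2) (by positivity)
    filter_upwards [tendsto_box.eventually_ge_atTop S] with k hk F hF
    exact (le_abs_self _).trans (hS F (hF.mono_right hk)).le
  have hsum : ∀ α β, ∀ᶠ k in atTop,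
      |∑ x ∈ siteBox (k + 1), planeResponse hP r α x ⬝ᵥ P.tensor x *ᵥ planeResponse hP r' β x -
        bulkCorr hP r r' α β| ≤ ε / 2 := by
    intro α β
    have h1 := (hP.summable_noise_form (hres r α).summable (hres r' β).summable).hasSum
    have h2 := (h1.comp (tendsto_box.comp (tendsto_add_atTop_nat 1))).eventually
      (Metric.closedBall_mem_nhds _ (half_pos hε))
    filter_upwards [h2] with k hk
    exact hk
  have hmem : ∀ t, ∀ᶠ k in atTop, t ∈ siteBox k := fun t => by
    obtain ⟨l, hl⟩ := exists_mem_box t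
    exact (eventually_ge_atTop l).mono fun k hk => box_mono hk hl
  obtain ⟨k, hk1, hk2, hkr, hkr', hks⟩ := ((eventually_all.2 (htail r)).and
    ((eventually_all.2 (htail r')).and ((hmem r).and ((hmem r').and
      (eventually_all.2 fun α => eventually_all.2 (hsum α)))))).exists
  refine ⟨k, hkr, hkr', ?_⟩
  intro A _ N hN D hD Γ₀ hΓ π hπ hπD htensor hinc hclose hr hr' α β
  have hv := isResponse_response hD hr α
  have hv' := isResponse_response hD hr' β
  obtain ⟨F, hF, hFle⟩ := hclose r hkr α _ hv
  obtain ⟨F', hF', hFle'⟩ := hclose r' hkr' β _ hv'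
  have h1 := abs_physCorr_sub_le (P := P) (r := ⟨π r, hr⟩) (r' := ⟨π r', hr'⟩) hN hD hΓ hv hv'
    hπ hπD htensor hinc (w := planeResponse hP r α) (w' := planeResponse hP r' β)
    (fun x _ => (hres r α).isOut x) (fun x _ => (hres r' β).isOut x) hδ0.le hδ1
    (hFle.trans (hk1 α F hF)) (hFle'.trans (hk2 β F' hF'))
    (((hres r α).one_sub_energy_le hP hkr).trans (hk1 α _ Finset.sdiff_disjoint))
    (((hres r' β).one_sub_energy_le hP hkr').trans (hk2 β _ Finset.sdiff_disjoint))
  have h2 := hks α β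
  have h3 := abs_sub_le (N.physCorr D Γ₀ ⟨π r, hr⟩ ⟨π r', hr'⟩ α β)
    (∑ x ∈ siteBox (k + 1), planeResponse hP r α x ⬝ᵥ P.tensor x *ᵥ planeResponse hP r' β x)
    (bulkCorr hP r r' α β)
  linarith

end Network

open Network

variable {p n : ℕ}

/-! ### The alternating network -/

section Alt

variable {T : ZMod 2 → Matrix (Mode p n) (Mode p n) ℝ}

lemma altIsoTNS_inc (s : ℤ × ℤ) (a : Leg) :
    (altIsoTNS T).inc s a ↔ a = .bottom ∨ (a = .left ∧ Even s.2) ∨ (a = .right ∧ ¬Even s.2) := by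
  by_cases h : Even s.2 <;> cases a <;> simp [altIsoTNS, h, isoIn, altIn]

lemma isPlane_altIsoTNS (h0 : IsIsometricTensor isoIn (T 0)) (h1 : IsIsometricTensor altIn (T 1)) :
    (altIsoTNS T).IsPlane where
  e₁ := rfl
  e₂ := rfl
  isometric := by
    refine ⟨fun s => ?_, fun s a => ?_⟩
    · by_cases h : Even s.2
      · have hs : (s.2 : ZMod 2) = 0 := (ZMod.intCast_zmod_eq_zero_iff_dvd _ 2).2 h.two_dvd
        have : (altIsoTNS T).inc s = isoIn := by
          funext a
          simp [altIsoTNS, h]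
        rw [this]
        simpa only [altIsoTNS, hs] using h0
      · have hs : (s.2 : ZMod 2) = 1 := by
          obtain ⟨k, hk⟩ := Int.not_even_iff_odd.1 h
          rw [hk]
          push_cast
          rw [show (2 : ZMod 2) = 0 from rfl]
          ring
        have : (altIsoTNS T).inc s = altIn := by
          funext a
          simp [altIsoTNS, h]
        rw [this]
        simpa only [altIsoTNS, hs] using h1
    · rw [altIsoTNS_inc, altIsoTNS_inc]
      cases a <;> simp [step, Leg.opp, altIsoTNS]
  acyclic D := by
    -- the rows are ordered from bottom to top, and the sites of a row along its arrows
    obtain ⟨k, hk⟩ : ∃ k : ℕ, ∀ s ∈ D, -(k : ℤ) ≤ s.1 ∧ s.1 ≤ k := by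
      obtain ⟨k, hk⟩ := (tendsto_box.eventually_ge_atTop D).exists
      refine ⟨k, fun s hs => ?_⟩
      have := mem_box.1 (hk hs)
      rw [abs_le] at this
      exact this.1
    refine ⟨fun s => s.2 * (2 * k + 1) + if Even s.2 then s.1 else -s.1, fun s hs a ha hsa => ?_⟩
    rw [altIsoTNS_inc] at ha
    have b1 := hk s hs
    have b2 := hk _ hsa
    by_cases he : Even s.2 <;> cases a <;>
      simp [step, altIsoTNS, he, ← Int.not_even_iff_odd] at ha b2 ⊢ <;> linarith
  tensor_add s z := by
    simp only [altIsoTNS, Prod.snd_add, two_nsmul]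
    congr 1
    push_cast
    rw [CharTwo.add_self_eq_zero, add_zero]
  inc_add s z := by
    funext a
    simp [altIsoTNS, Int.even_add]

/-- The bulk limit of the alternating network. -/
theorem isBulkCorrelationAlt_bulkCorr (hP : (altIsoTNS T).IsPlane) :
    IsBulkCorrelationAlt T (bulkCorr hP) := by
  intro r r' ε hε
  obtain ⟨k, hkr, hkr', h⟩ := hP.exists_box_abs_physCorr_sub_le r r' hε
  refine ⟨k + 1, fun D hD Γ₀ hΓ hr hr' α β => ?_⟩
  have hbox : siteBox (k + 1) ⊆ D := fun s hs => hD s (mem_box.1 hs)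
  refine h hP.isometric (hP.acyclic D) (by convert hΓ) (π := id) Function.injective_id.injOn
    (fun x hx => hbox hx) (fun _ _ => rfl) (fun _ _ => rfl) (fun t ht γ v hv => ?_) hr hr' α β
  refine ⟨D \ siteBox k, Finset.sdiff_disjoint, le_trans ?_
    ((isPlaneResponse_planeResponse hP t γ).energy_sub_le hP hbox hv)⟩
  exact Finset.sum_le_sum_of_subset_of_nonneg hbox fun _ _ _ => outEnergy_nonneg

end Alt

/-! ### The translation-invariant isometric network, in the plane and on cylinders -/

section Iso

variable {T : ZMod 2 → Matrix (Mode p n) (Mode p n) ℝ}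

/-- The isometric tensor network state on the lattice `ℤ²` itself. -/
def isoPlane (T : ZMod 2 → Matrix (Mode p n) (Mode p n) ℝ) : Network (ℤ × ℤ) p n where
  e₁ := (1, 0)
  e₂ := (0, 1)
  inc := fun _ a => isoIn a
  tensor := fun s => T ((s.1 + s.2 : ℤ) : ZMod 2)

lemma isPlane_isoPlane (hT : ∀ c, IsIsometricTensor isoIn (T c)) : (isoPlane T).IsPlane where
  e₁ := rfl
  e₂ := rfl
  isometric := ⟨fun s => hT _, fun s a => by cases a <;> simp [isoPlane, isoIn, Leg.opp]⟩
  acyclic D := ⟨fun s => s.1 + s.2, fun s _ a ha _ => by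
    cases a <;> simp [isoPlane, isoIn, step] at ha ⊢⟩
  tensor_add s z := by
    simp only [isoPlane, Prod.snd_add, Prod.fst_add, two_nsmul]
    congr 1
    push_cast
    linear_combination CharTwo.add_self_eq_zero (z.1 : ZMod 2) +
      CharTwo.add_self_eq_zero (z.2 : ZMod 2)
  inc_add s z := rfl

variable {w : ℤ × ℤ}

lemma isoTNS_step (a : Leg) : (isoTNS w T).step a = (((isoPlane T).step a : ℤ × ℤ) : Cylinder w) := by
  cases a <;> rfl

lemma exists_zsmul_of_coe_eq {x y : ℤ × ℤ} (h : (x : Cylinder w) = (y : Cylinder w)) :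
    ∃ k : ℤ, y = x + k • w := by
  obtain ⟨k, hk⟩ := AddSubgroup.mem_zmultiples_iff.1 (QuotientAddGroup.eq.1 h)
  exact ⟨k, by rw [hk]; abel⟩

lemma exists_out_eq (x : ℤ × ℤ) : ∃ k : ℤ, (x : Cylinder w).out = x + k • w :=
  exists_zsmul_of_coe_eq (QuotientAddGroup.out_eq' _).symm

lemma isoTNS_tensor_coe (hw : Even (w.1 + w.2)) (x : ℤ × ℤ) :
    (isoTNS w T).tensor x = (isoPlane T).tensor x := by
  obtain ⟨k, hk⟩ := exists_out_eq (w := w) x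
  obtain ⟨l, hl⟩ := hw
  simp only [isoTNS, isoPlane]
  congr 1
  rw [hk]
  have : (x + k • w).1 + (x + k • w).2 = x.1 + x.2 + k * (l + l) := by
    rw [← hl]
    simp
    ring
  rw [this]
  push_cast
  rw [← two_mul, show (2 : ZMod 2) = 0 from rfl]
  simp

lemma isIsometric_isoTNS (hT : ∀ c, IsIsometricTensor isoIn (T c)) : (isoTNS w T).IsIsometric :=
  ⟨fun s => hT _, fun s a => by cases a <;> simp [isoTNS, isoIn, Leg.opp]⟩

/-- On a cylinder with space-like circumference a linear time function of the plane descends to a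
height function. -/
lemma isAcyclicOn_isoTNS (hw : w = 0 ∨ (0 < w.1 ∧ 0 < -w.2)) (D : Finset (Cylinder w)) :
    (isoTNS w T).IsAcyclicOn D := by
  obtain ⟨c₁, c₂, h₁, h₂, hc⟩ : ∃ c₁ c₂ : ℤ, 0 < c₁ ∧ 0 < c₂ ∧ c₁ * w.1 + c₂ * w.2 = 0 := by
    rcases hw with rfl | hw
    · exact ⟨1, 1, one_pos, one_pos, by simp⟩
    · exact ⟨-w.2, w.1, hw.2, hw.1, by ring⟩
  refine ⟨fun s => c₁ * s.out.1 + c₂ * s.out.2, fun s _ a ha _ => ?_⟩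
  obtain ⟨x, rfl⟩ : ∃ x : ℤ × ℤ, s = x := ⟨s.out, (QuotientAddGroup.out_eq' s).symm⟩
  have hf : ∀ y : ℤ × ℤ, c₁ * (y : Cylinder w).out.1 + c₂ * (y : Cylinder w).out.2 =
      c₁ * y.1 + c₂ * y.2 := by
    intro y
    obtain ⟨k, hk⟩ := exists_out_eq (w := w) y
    rw [hk]
    simp only [Prod.fst_add, Prod.snd_add, Prod.smul_fst, Prod.smul_snd, smul_eq_mul]
    linear_combination k * hc
  rw [isoTNS_step, ← QuotientAddGroup.mk_add]
  simp only [hf]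
  cases a <;> simp [isoTNS, isoIn, isoPlane, step] at ha ⊢
  · nlinarith
  · nlinarith

/-- The response of a region of the plane or of a cylinder agrees with the response of the infinite
network on a box, since no path from the box to the source winds around the cylinder or leaves the
box. -/
lemma response_coe_eq {k : ℕ}
    (hw : w = 0 ∨ (2 * (k : ℤ) + 1 ≤ w.1 ∧ 2 * (k : ℤ) + 1 ≤ -w.2)) (hwe : Even (w.1 + w.2))
    {D : Finset (Cylinder w)} (hD : ∀ x ∈ siteBox k, (x : Cylinder w) ∈ D) {r : ℤ × ℤ} (hr : r ∈ siteBox k)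
    {α : Fin p} {v : Cylinder w → Mode p n → ℝ} (hv : (isoTNS w T).IsResponse D (r : Cylinder w) α v)
    {u : ℤ × ℤ → Mode p n → ℝ} (hu : (isoPlane T).IsPlaneResponse r α u) {x : ℤ × ℤ}
    (hx : x ∈ siteBox k) : v (x : Cylinder w) = u x := by
  have hacyc : (isoTNS w T).IsAcyclicOn D := isAcyclicOn_isoTNS (by
    rcases hw with h | h
    · exact Or.inl h
    · exact Or.inr ⟨by omega, by omega⟩) D
  have hrb := mem_box.1 hr
  rw [abs_le, abs_le] at hrb
  -- both responses are supported in the past cone of the source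
  have hcone : ∀ y : ℤ × ℤ, (∀ j : ℤ, ¬((y + j • w).1 ≤ r.1 ∧ (y + j • w).2 ≤ r.2)) →
      v (y : Cylinder w) = 0 := by
    intro y hy
    refine hv.eq_zero_of_not_mem hacyc
      (Z := {s | ∀ z : ℤ × ℤ, (z : Cylinder w) = s → ¬(z.1 ≤ r.1 ∧ z.2 ≤ r.2)}) ?_ ?_ ?_
    · intro s hs a ha z hz hzr
      rw [isoTNS_step] at hz
      have h1 : ((z - (isoPlane T).step a : ℤ × ℤ) : Cylinder w) = s := by
        rw [QuotientAddGroup.mk_sub, hz, add_sub_cancel_right]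
      refine hs _ h1 ?_
      cases a <;> simp [isoTNS, isoIn, isoPlane, step] at ha hzr ⊢ <;> omega
    · exact fun h => h r rfl ⟨le_rfl, le_rfl⟩
    · intro z hz
      obtain ⟨j, rfl⟩ := exists_zsmul_of_coe_eq hz.symm
      exact hy j
  have hcone' : ∀ y : ℤ × ℤ, ¬(y.1 ≤ r.1 ∧ y.2 ≤ r.2) → u y = 0 := by
    intro y hy
    by_cases h1 : r.1 < y.1
    · refine hu.causal (AddMonoidHom.fst ℤ ℤ) (fun s a ha => ?_) y h1
      cases a <;> simp [isoIn, isoPlane, step] at ha ⊢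
    · refine hu.causal (AddMonoidHom.snd ℤ ℤ) (fun s a ha => ?_) y ?_
      · cases a <;> simp [isoIn, isoPlane, step] at ha ⊢
      · simp only [AddMonoidHom.coe_snd]
        omega
  have hsource : ∀ y ∈ siteBox k, source (n := n) (r : Cylinder w) α (y : Cylinder w) =
      source r α y := by
    intro y hy
    have hyb := mem_box.1 hy
    rw [abs_le, abs_le] at hyb
    have : (y : Cylinder w) = (r : Cylinder w) ↔ y = r := by
      refine ⟨fun h => ?_, fun h => h ▸ rfl⟩
      obtain ⟨j, hj⟩ := exists_zsmul_of_coe_eq h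
      rcases hw with rfl | hw
      · simpa using hj.symm
      · have h1 : r.1 = y.1 + j * w.1 := by rw [hj]; simp
        have hj0 : j = 0 := by
          by_contra hne
          rcases lt_or_gt_of_ne hne with h | h
          · nlinarith
          · nlinarith
        rw [hj, hj0]
        simp
    funext μ
    simp [source, this]
  -- induction along the arrows, from the source backward
  have key : ∀ m : ℕ, ∀ x ∈ siteBox k, r.1 + r.2 - (x.1 + x.2) < m → v (x : Cylinder w) = u x := by
    intro m
    induction m with
    | zero =>
      intro x hx hm
      have hxb := mem_box.1 hx
      rw [abs_le, abs_le] at hxb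
      rw [hcone' x (by push_cast at hm; omega), hcone x]
      intro j hj
      rcases hw with rfl | hw
      · simp at hj
        push_cast at hm
        omega
      · simp only [Prod.fst_add, Prod.snd_add, Prod.smul_fst, Prod.smul_snd, smul_eq_mul] at hj
        have hj0 : j = 0 := by
          by_contra hne
          rcases lt_or_gt_of_ne hne with h | h
          · nlinarith
          · nlinarith
        subst hj0
        push_cast at hm
        omega
    | succ m ih =>
      intro x hx hm
      have hxb := mem_box.1 hx
      rw [abs_le, abs_le] at hxb
      rw [hv.eq _ (hD x hx), hu.eq x, hsource x hx]
      congr 1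
      have hstep : ∀ a, ¬isoIn a → v ((x : Cylinder w) + (isoTNS w T).step a) =
          u (x + (isoPlane T).step a) := by
        intro a ha
        rw [isoTNS_step, ← QuotientAddGroup.mk_add]
        by_cases hb : x + (isoPlane T).step a ∈ siteBox k
        · refine ih _ hb ?_
          cases a <;> simp [isoIn, isoPlane, step] at ha hm ⊢ <;> omega
        · rw [mem_box, abs_le, abs_le] at hb
          rw [hcone', hcone]
          · intro j hj
            rcases hw with rfl | hw
            · cases a <;> simp [isoIn, isoPlane, step] at ha hb hj <;> omega
            · cases a <;> simp [isoIn, isoPlane, step] at ha hb hj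
              · have : x.1 = k := by omega
                have : j < 0 := by
                  by_contra hc
                  nlinarith
                nlinarith
              · have : x.2 = k := by omega
                have : 0 < j := by
                  by_contra hc
                  nlinarith
                nlinarith
          · cases a <;> simp [isoIn, isoPlane, step] at ha hb ⊢ <;> omega
      ext μ
      rcases μ with γ | ⟨a, i⟩
      · rfl
      · by_cases ha : isoIn a
        · have h1 : (isoTNS w T).inc x a := ha
          have h2 : (isoPlane T).inc x a := ha
          simp [pull, h1, h2]
        · have h1 : ¬(isoTNS w T).inc x a := ha
          have h2 : ¬(isoPlane T).inc x a := ha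
          simp only [pull, h1, h2, if_false, hstep a ha]
          rw [isoTNS_step, ← QuotientAddGroup.mk_add, isoTNS_tensor_coe hwe]
  exact key (r.1 + r.2 - (x.1 + x.2) + 1).toNat x hx (by omega)

/-- The bulk limit of the isometric network, in the plane and on cylinders. -/
theorem isBulkCorrelationIso_bulkCorr (hT : ∀ c, IsIsometricTensor isoIn (T c)) :
    IsBulkCorrelationIso T (bulkCorr (isPlane_isoPlane hT)) := by
  set hP := isPlane_isoPlane hT
  intro r r' ε hε
  obtain ⟨k, hkr, hkr', h⟩ := hP.exists_box_abs_physCorr_sub_le r r' hε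
  refine ⟨2 * (k + 1) + 1, fun w hw D hD Γ₀ hΓ hr hr' α β => ?_⟩
  have hwe : Even (w.1 + w.2) := by
    rcases hw with rfl | hw
    · simp
    · exact hw.2.2
  have hw' : w = 0 ∨ (2 * ((k + 1 : ℕ) : ℤ) + 1 ≤ w.1 ∧ 2 * ((k + 1 : ℕ) : ℤ) + 1 ≤ -w.2) := by
    rcases hw with hw | hw
    · exact Or.inl hw
    · exact Or.inr ⟨by have := hw.1; push_cast at this ⊢; omega,
        by have := hw.2.1; push_cast at this ⊢; omega⟩
  have hbox : ∀ x ∈ siteBox (k + 1), (x : Cylinder w) ∈ D := by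
    intro x hx
    refine hD x ?_
    have := mem_box.1 (box_mono (show k + 1 ≤ 2 * (k + 1) + 1 by omega) hx)
    exact this
  have hacyc : (isoTNS w T).IsAcyclicOn D := isAcyclicOn_isoTNS (by
    rcases hw' with h | h
    · exact Or.inl h
    · exact Or.inr ⟨by omega, by omega⟩) D
  refine h (isIsometric_isoTNS hT) hacyc (by convert hΓ) (π := fun x => (x : Cylinder w)) ?_ hbox
    (fun x _ => isoTNS_tensor_coe hwe x) (fun _ _ => rfl) (fun t ht γ v hv => ?_) hr hr' α β
  · intro x hx y hy hxy
    have hxb := mem_box.1 hx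
    have hyb := mem_box.1 hy
    rw [abs_le, abs_le] at hxb hyb
    obtain ⟨j, hj⟩ := exists_zsmul_of_coe_eq hxy
    rcases hw' with rfl | hw'
    · simpa using hj.symm
    · have h1 : y.1 = x.1 + j * w.1 := by rw [hj]; simp
      have hj0 : j = 0 := by
        by_contra hne
        rcases lt_or_gt_of_ne hne with h | h
        · nlinarith
        · nlinarith
      rw [hj, hj0]
      simp
  · refine ⟨∅, Finset.disjoint_empty_left _, ?_⟩
    rw [Finset.sum_empty]
    refine le_of_eq (Finset.sum_eq_zero fun x hx => ?_)
    rw [response_coe_eq hw' hwe hbox (box_mono k.le_succ ht) hv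
      (isPlaneResponse_planeResponse hP t γ) hx, sub_self]
    have h0 : outPart ((isoPlane T).inc x) (0 : Mode p n → ℝ) = 0 := isOut_zero.outPart_eq
    simp [outEnergy, h0]

end Iso

/-! ### Two-sided sequences as a module over the Laurent polynomials -/

/-- Two-sided complex sequences. -/
def Seq : Type := ℤ → ℂ

namespace Seq

open LaurentPolynomial

instance : AddCommGroup Seq := inferInstanceAs (AddCommGroup (ℤ → ℂ))

instance : Module ℂ Seq := inferInstanceAs (Module ℂ (ℤ → ℂ))

/-- The translation of a sequence. -/
def shift (k : ℤ) : Seq →ₗ[ℂ] Seq where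
  toFun y := fun g => y (g + k)
  map_add' _ _ := rfl
  map_smul' _ _ := rfl

/-- The action of the Laurent polynomials on sequences, in which `T k` translates by `k`. -/
noncomputable def act : LaurentPolynomial ℂ →ₐ[ℂ] Module.End ℂ Seq :=
  AddMonoidAlgebra.lift ℂ (Module.End ℂ Seq) ℤ
    { toFun := fun k => shift k.toAdd
      map_one' := by
        ext y
        funext g
        change y (g + 0) = y g
        rw [add_zero]
      map_mul' := fun k l => by
        ext y
        funext g
        change y (g + (k.toAdd + l.toAdd)) = y (g + k.toAdd + l.toAdd)
        rw [add_assoc] }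

noncomputable instance : Module (LaurentPolynomial ℂ) Seq := Module.compHom Seq act.toRingHom

lemma smul_def (q : LaurentPolynomial ℂ) (y : Seq) : q • y = act q y := rfl

lemma T_smul_apply (k : ℤ) (y : Seq) (g : ℤ) : ((T k : LaurentPolynomial ℂ) • y) g = y (g + k) := by
  rw [smul_def, T, act, AddMonoidAlgebra.lift_single, one_smul]
  rfl

lemma C_smul (c : ℂ) (y : Seq) : (C c : LaurentPolynomial ℂ) • y = c • y := by
  have h : (C c : LaurentPolynomial ℂ) = algebraMap ℂ _ c := by
    rw [LaurentPolynomial.algebraMap_apply]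
    rfl
  rw [smul_def, h, act.commutes]
  rfl

lemma add_apply (y z : Seq) (g : ℤ) : (y + z) g = y g + z g := rfl

lemma sub_apply (y z : Seq) (g : ℤ) : (y - z) g = y g - z g := rfl

lemma smul_apply (c : ℂ) (y : Seq) (g : ℤ) : (c • y) g = c * y g := rfl

lemma zero_apply (g : ℤ) : (0 : Seq) g = 0 := rfl

lemma sum_apply {ι : Type*} (F : Finset ι) (y : ι → Seq) (g : ℤ) :
    (∑ i ∈ F, y i) g = ∑ i ∈ F, y i g := Finset.sum_apply g F y

/-- A translation-invariant space of sequences is a module over the Laurent polynomials. -/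
def submoduleOfShift (S : Submodule ℂ Seq)
    (h : ∀ (k : ℤ) (y : Seq), y ∈ S → (T k : LaurentPolynomial ℂ) • y ∈ S) :
    Submodule (LaurentPolynomial ℂ) Seq where
  carrier := S
  add_mem' := S.add_mem
  zero_mem' := S.zero_mem
  smul_mem' q y hy := by
    induction q using LaurentPolynomial.induction_on' with
    | add p q hp hq =>
      rw [add_smul]
      exact S.add_mem hp hq
    | C_mul_T k a =>
      rw [mul_smul, C_smul]
      exact S.smul_mem a (h k y hy)

/-- Sequences that tend to zero at both ends. -/
def vanishing : Submodule (LaurentPolynomial ℂ) Seq :=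
  submoduleOfShift
    { carrier := {y | Tendsto y cofinite (𝓝 0)}
      add_mem' := fun {y z} hy hz => by
        have := Tendsto.add (f := y) (g := z) hy hz
        rwa [add_zero] at this
      zero_mem' := tendsto_const_nhds
      smul_mem' := fun c y hy => by
        have := Tendsto.const_mul (f := y) c hy
        rwa [mul_zero] at this }
    fun k y hy => by
      have h : Tendsto (fun g => y (g + k)) cofinite (𝓝 0) :=
        Tendsto.comp (g := y) hy (add_left_injective k).tendsto_cofinite
      refine Tendsto.congr (fun g => ?_) h
      exact (T_smul_apply k y g).symm

/-- Sequences that decay exponentially at both ends, with rate `κ`. -/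
def expDecay (κ : ℝ) : Submodule (LaurentPolynomial ℂ) Seq :=
  submoduleOfShift
    { carrier := {y | ∃ C : ℝ, ∀ g : ℤ, ‖y g‖ ≤ C * Real.exp (-κ * |(g : ℝ)|)}
      add_mem' := fun {y z} ⟨C, hC⟩ ⟨C', hC'⟩ => ⟨C + C', fun g => by
        rw [add_mul]
        exact (norm_add_le _ _).trans (add_le_add (hC g) (hC' g))⟩
      zero_mem' := ⟨0, fun g => by
        rw [zero_apply]
        simp⟩
      smul_mem' := fun c y ⟨C, hC⟩ => ⟨‖c‖ * C, fun g => by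
        rw [smul_apply, norm_mul, mul_assoc]
        exact mul_le_mul_of_nonneg_left (hC g) (norm_nonneg c)⟩ }
    fun k y ⟨C, hC⟩ => ⟨C * Real.exp (|κ| * |(k : ℝ)|), fun g => by
      rw [T_smul_apply]
      refine (hC _).trans ?_
      have hC0 : 0 ≤ C := by
        have := (norm_nonneg _).trans (hC 0)
        simpa using this
      rw [mul_assoc, ← Real.exp_add]
      refine mul_le_mul_of_nonneg_left (Real.exp_le_exp.2 ?_) hC0
      push_cast
      have h1 : |(g : ℝ)| - |(g : ℝ) + k| ≤ |(k : ℝ)| := by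
        have := abs_sub_abs_le_abs_sub (g : ℝ) (g + k)
        rwa [sub_add_cancel_left, abs_neg] at this
      have h2 : |(g : ℝ) + k| - |(g : ℝ)| ≤ |(k : ℝ)| := by
        have := abs_sub_abs_le_abs_sub ((g : ℝ) + k) g
        rwa [add_sub_cancel_left] at this
      have h3 : κ * (|(g : ℝ)| - |(g : ℝ) + k|) ≤ |κ| * |(k : ℝ)| := by
        refine (le_abs_self _).trans ?_
        rw [abs_mul]
        exact mul_le_mul_of_nonneg_left (abs_le.2 ⟨by linarith, h1⟩) (abs_nonneg κ)
      linarith⟩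

lemma mem_expDecay_of_support_finite {y : Seq} (h : (Function.support y).Finite) (κ : ℝ) :
    y ∈ expDecay κ := by
  refine ⟨∑ g ∈ h.toFinset, ‖y g‖ * Real.exp (κ * |(g : ℝ)|), fun g => ?_⟩
  by_cases hg : y g = 0
  · rw [hg, norm_zero]
    exact mul_nonneg (Finset.sum_nonneg fun _ _ => by positivity) (Real.exp_pos _).le
  · have h1 : ‖y g‖ = ‖y g‖ * Real.exp (κ * |(g : ℝ)|) * Real.exp (-κ * |(g : ℝ)|) := by
      rw [mul_assoc, ← Real.exp_add]
      simp
    rw [h1]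
    refine mul_le_mul_of_nonneg_right ?_ (Real.exp_pos _).le
    exact Finset.single_le_sum (f := fun g => ‖y g‖ * Real.exp (κ * |(g : ℝ)|))
      (fun _ _ => by positivity) (h.mem_toFinset.2 hg)

/-! ### Division by a Laurent polynomial -/

/-- A bound for a null sequence that satisfies a contractive recursion from infinity. -/
lemma le_of_recursion {u : ℕ → ℝ} (hu0 : ∀ k, 0 ≤ u k) (hu : Tendsto u atTop (𝓝 0)) {θ ρ B : ℝ}
    (hθ : 0 ≤ θ) (hθ1 : θ ≤ 1) (hρ : 0 ≤ ρ) (hB : 0 ≤ B) (hθρ : θ * ρ < 1)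
    (h : ∀ k, u k ≤ θ * u (k + 1) + B * ρ ^ k) : u 0 ≤ B / (1 - θ * ρ) := by
  set C' := B / (1 - θ * ρ) with hC'
  have hpos : 0 < 1 - θ * ρ := by linarith
  have hC : C' = θ * ρ * C' + B := by
    rw [hC']
    field_simp
    ring
  have hC0 : 0 ≤ C' := div_nonneg hB hpos.le
  -- subtracting the particular solution `C' ρ ^ k` leaves a homogeneous inequality
  have key : ∀ k, u 0 - C' ≤ θ ^ k * (u k - C' * ρ ^ k) := by
    intro k
    induction k with
    | zero => simp
    | succ k ih =>
      refine ih.trans ?_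
      rw [pow_succ θ, mul_assoc]
      refine mul_le_mul_of_nonneg_left ?_ (pow_nonneg hθ k)
      have : C' * ρ ^ k = θ * (C' * ρ ^ (k + 1)) + B * ρ ^ k := by
        rw [pow_succ]
        calc C' * ρ ^ k = (θ * ρ * C' + B) * ρ ^ k := by rw [← hC]
          _ = _ := by ring
      rw [this]
      linarith [h k]
  have hle : ∀ k, u 0 - C' ≤ u k := by
    intro k
    refine (key k).trans ?_
    calc θ ^ k * (u k - C' * ρ ^ k) ≤ θ ^ k * u k := by
          refine mul_le_mul_of_nonneg_left ?_ (pow_nonneg hθ k)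
          have : 0 ≤ C' * ρ ^ k := by positivity
          linarith
      _ ≤ 1 * u k := mul_le_mul_of_nonneg_right (pow_le_one₀ hθ hθ1) (hu0 k)
      _ = u k := one_mul _
  have := ge_of_tendsto' hu hle
  linarith

/-- Division by `T 1 - a` preserves exponential decay within the vanishing sequences: the
recursion is solved from the left end if `‖a‖ ≤ 1` and from the right end if `‖a‖ ≥ 1`. -/
lemma mem_expDecay_of_linear (a : ℂ) : ∃ κ₀ > 0, ∀ κ, 0 < κ → κ ≤ κ₀ → ∀ w ∈ vanishing,
    ((T 1 - C a : LaurentPolynomial ℂ) • w) ∈ expDecay κ → w ∈ expDecay κ := by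
  have hev : ∀ {t : ℝ}, t < 1 → ∃ κ₀ > 0, ∀ κ, κ ≤ κ₀ → 0 ≤ t → t * Real.exp κ < 1 := by
    intro t ht
    have h1 : Tendsto (fun κ => t * Real.exp κ) (𝓝[>] 0) (𝓝 (t * Real.exp 0)) :=
      ((continuous_const.mul Real.continuous_exp).tendsto 0).mono_left nhdsWithin_le_nhds
    rw [Real.exp_zero, mul_one] at h1
    obtain ⟨κ₀, h2, h3⟩ := ((h1.eventually (gt_mem_nhds ht)).and self_mem_nhdsWithin).exists
    refine ⟨κ₀, h3, fun κ hκ ht0 => lt_of_le_of_lt ?_ h2⟩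
    exact mul_le_mul_of_nonneg_left (Real.exp_le_exp.2 hκ) ht0
  have hstep : ∀ (w : Seq) (g : ℤ), ((T 1 - C a : LaurentPolynomial ℂ) • w) g = w (g + 1) - a * w g := by
    intro w g
    rw [sub_smul, sub_apply, T_smul_apply, C_smul, smul_apply]
  -- solving from the left end
  have hleft : ∀ {w : Seq}, w ∈ vanishing → ‖a‖ ≤ 1 → ∀ {g : ℤ} {B ρ : ℝ}, 0 ≤ ρ → 0 ≤ B →
      ‖a‖ * ρ < 1 →
      (∀ k : ℕ, ‖((T 1 - C a : LaurentPolynomial ℂ) • w) (g - k - 1)‖ ≤ B * ρ ^ k) →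
      ‖w g‖ ≤ B / (1 - ‖a‖ * ρ) := by
    intro w hw ha g B ρ hρ hB haρ he
    have := le_of_recursion (u := fun k : ℕ => ‖w (g - k)‖) (fun k => norm_nonneg _) ?_
      (norm_nonneg a) ha hρ hB haρ ?_
    · simpa using this
    · have h1 : Tendsto (fun k : ℕ => g - (k : ℤ)) atTop cofinite := by
        rw [← Nat.cofinite_eq_atTop]
        refine Function.Injective.tendsto_cofinite fun k l hkl => ?_
        simpa using hkl
      have h2 := (Tendsto.comp (g := w) hw h1).norm
      rwa [norm_zero] at h2
    · intro k
      have h1 : w (g - k) = a * w (g - (k + 1 : ℕ)) +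
          ((T 1 - C a : LaurentPolynomial ℂ) • w) (g - k - 1) := by
        rw [hstep]
        push_cast
        rw [show g - (k : ℤ) - 1 + 1 = g - k by ring, show g - ((k : ℤ) + 1) = g - k - 1 by ring]
        ring
      change ‖w (g - k)‖ ≤ _
      rw [h1]
      refine (norm_add_le _ _).trans ?_
      rw [norm_mul]
      exact add_le_add le_rfl (he k)
  -- solving from the right end
  have hright : ∀ {w : Seq}, w ∈ vanishing → 1 ≤ ‖a‖ → ∀ {g : ℤ} {B ρ : ℝ}, 0 ≤ ρ → 0 ≤ B →
      ‖a‖⁻¹ * ρ < 1 →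
      (∀ k : ℕ, ‖((T 1 - C a : LaurentPolynomial ℂ) • w) (g + k)‖ ≤ B * ρ ^ k) →
      ‖w g‖ ≤ B / (1 - ‖a‖⁻¹ * ρ) := by
    intro w hw ha g B ρ hρ hB haρ he
    have ha0 : a ≠ 0 := by
      rintro rfl
      simp at ha
      linarith
    have := le_of_recursion (u := fun k : ℕ => ‖w (g + k)‖) (fun k => norm_nonneg _) ?_
      (inv_nonneg.2 (norm_nonneg a)) (inv_le_one_of_one_le₀ ha) hρ hB haρ ?_
    · simpa using this
    · have h1 : Tendsto (fun k : ℕ => g + (k : ℤ)) atTop cofinite := by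
        rw [← Nat.cofinite_eq_atTop]
        refine Function.Injective.tendsto_cofinite fun k l hkl => ?_
        simpa using hkl
      have h2 := (Tendsto.comp (g := w) hw h1).norm
      rwa [norm_zero] at h2
    · intro k
      have h1 : w (g + k) = a⁻¹ * (w (g + (k + 1 : ℕ)) -
          ((T 1 - C a : LaurentPolynomial ℂ) • w) (g + k)) := by
        rw [hstep]
        push_cast
        rw [show g + ((k : ℤ) + 1) = g + k + 1 by ring]
        field_simp
        ring
      change ‖w (g + k)‖ ≤ _
      rw [h1, norm_mul, norm_inv]
      have h2 := (norm_sub_le (w (g + (k + 1 : ℕ)))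
        (((T 1 - C a : LaurentPolynomial ℂ) • w) (g + k))).trans (add_le_add le_rfl (he k))
      calc ‖a‖⁻¹ * ‖w (g + (k + 1 : ℕ)) - ((T 1 - C a : LaurentPolynomial ℂ) • w) (g + k)‖
          ≤ ‖a‖⁻¹ * (‖w (g + (k + 1 : ℕ))‖ + B * ρ ^ k) :=
            mul_le_mul_of_nonneg_left h2 (inv_nonneg.2 (norm_nonneg a))
        _ = ‖a‖⁻¹ * ‖w (g + (k + 1 : ℕ))‖ + ‖a‖⁻¹ * (B * ρ ^ k) := mul_add _ _ _
        _ ≤ ‖a‖⁻¹ * ‖w (g + (k + 1 : ℕ))‖ + 1 * (B * ρ ^ k) := by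
            gcongr
            exact inv_le_one_of_one_le₀ ha
        _ = _ := by rw [one_mul]
  have hC0 : ∀ {C κ : ℝ} {w : Seq}, (∀ g : ℤ, ‖w g‖ ≤ C * Real.exp (-κ * |(g : ℝ)|)) → 0 ≤ C := by
    intro C κ w h
    have := (norm_nonneg _).trans (h 0)
    simpa using this
  rcases lt_trichotomy ‖a‖ 1 with ha | ha | ha
  · obtain ⟨κ₀, hκ₀, hlt⟩ := hev ha
    refine ⟨κ₀, hκ₀, fun κ hκ hκle w hw ⟨C, hC⟩ => ⟨C * Real.exp κ / (1 - ‖a‖ * Real.exp κ), ?_⟩⟩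
    intro g
    have h0 := hC0 hC
    have := hleft hw ha.le (g := g) (B := C * Real.exp κ * Real.exp (-κ * |(g : ℝ)|))
      (ρ := Real.exp κ) (Real.exp_pos _).le (by positivity) (hlt κ hκle (norm_nonneg a)) ?_
    · rwa [div_mul_eq_mul_div]
    · intro k
      refine (hC _).trans ?_
      rw [mul_assoc, mul_assoc, ← Real.exp_nat_mul, ← Real.exp_add, ← Real.exp_add]
      refine mul_le_mul_of_nonneg_left (Real.exp_le_exp.2 ?_) h0
      push_cast
      have h1 : |(g : ℝ)| - (k + 1) ≤ |(g : ℝ) - k - 1| := by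
        have := abs_sub_abs_le_abs_sub (g : ℝ) ((k : ℝ) + 1)
        rw [abs_of_nonneg (by positivity : (0 : ℝ) ≤ (k : ℝ) + 1)] at this
        rwa [sub_sub]
      nlinarith
  · refine ⟨1, one_pos, fun κ hκ _ w hw ⟨C, hC⟩ =>
      ⟨C / (1 - Real.exp (-κ)), ?_⟩⟩
    have h0 := hC0 hC
    have hlt : Real.exp (-κ) < 1 := (Real.exp_lt_exp.2 (by linarith : -κ < 0)).trans_eq Real.exp_zero
    intro g
    rw [div_mul_eq_mul_div]
    rcases le_total g 0 with hg | hg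
    · have := hleft hw ha.le (g := g) (B := C * Real.exp (-κ * |(g : ℝ)|))
        (ρ := Real.exp (-κ)) (Real.exp_pos _).le (by positivity) (by rwa [ha, one_mul]) ?_
      · rwa [ha, one_mul] at this
      · intro k
        refine (hC _).trans ?_
        rw [mul_assoc, ← Real.exp_nat_mul, ← Real.exp_add]
        refine mul_le_mul_of_nonneg_left (Real.exp_le_exp.2 ?_) h0
        push_cast
        have hg' : (g : ℝ) ≤ 0 := by exact_mod_cast hg
        have hk : (0 : ℝ) ≤ k := Nat.cast_nonneg k
        rw [abs_of_nonpos hg', abs_of_nonpos (by linarith)]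
        nlinarith
    · have := hright hw ha.ge (g := g) (B := C * Real.exp (-κ * |(g : ℝ)|))
        (ρ := Real.exp (-κ)) (Real.exp_pos _).le (by positivity) (by rwa [ha, inv_one, one_mul]) ?_
      · rwa [ha, inv_one, one_mul] at this
      · intro k
        refine (hC _).trans ?_
        rw [mul_assoc, ← Real.exp_nat_mul, ← Real.exp_add]
        refine mul_le_mul_of_nonneg_left (Real.exp_le_exp.2 ?_) h0
        push_cast
        have hg' : (0 : ℝ) ≤ g := by exact_mod_cast hg
        have hk : (0 : ℝ) ≤ k := Nat.cast_nonneg k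
        rw [abs_of_nonneg hg', abs_of_nonneg (by linarith)]
        nlinarith
  · obtain ⟨κ₀, hκ₀, hlt⟩ := hev (inv_lt_one_of_one_lt₀ ha)
    refine ⟨κ₀, hκ₀, fun κ hκ hκle w hw ⟨C, hC⟩ => ⟨C / (1 - ‖a‖⁻¹ * Real.exp κ), ?_⟩⟩
    intro g
    have h0 := hC0 hC
    have := hright hw ha.le (g := g) (B := C * Real.exp (-κ * |(g : ℝ)|))
      (ρ := Real.exp κ) (Real.exp_pos _).le (by positivity)
      (hlt κ hκle (inv_nonneg.2 (norm_nonneg a))) ?_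
    · rwa [div_mul_eq_mul_div]
    · intro k
      refine (hC _).trans ?_
      rw [mul_assoc, ← Real.exp_nat_mul, ← Real.exp_add]
      refine mul_le_mul_of_nonneg_left (Real.exp_le_exp.2 ?_) h0
      push_cast
      have h1 : |(g : ℝ)| - k ≤ |(g : ℝ) + k| := by
        have := abs_sub_abs_le_abs_sub (g : ℝ) (-(k : ℝ))
        rwa [abs_neg, abs_of_nonneg (a := (k : ℝ)) (Nat.cast_nonneg k), sub_neg_eq_add] at this
      nlinarith

lemma mem_expDecay_of_polynomial (m : ℕ) : ∀ f : Polynomial ℂ, f ≠ 0 → f.natDegree ≤ m →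
    ∃ κ₀ > 0, ∀ κ, 0 < κ → κ ≤ κ₀ → ∀ w ∈ vanishing,
      f.toLaurent • w ∈ expDecay κ → w ∈ expDecay κ := by
  have hconst : ∀ f : Polynomial ℂ, f ≠ 0 → f.natDegree = 0 →
      ∃ κ₀ > 0, ∀ κ, 0 < κ → κ ≤ κ₀ → ∀ w ∈ vanishing,
        f.toLaurent • w ∈ expDecay κ → w ∈ expDecay κ := by
    intro f hf hdeg
    rw [Polynomial.eq_C_of_natDegree_eq_zero hdeg] at hf ⊢
    set c := f.coeff 0
    have hc : c ≠ 0 := fun h => hf (by rw [h, Polynomial.C_0])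
    refine ⟨1, one_pos, fun κ _ _ w _ h => ?_⟩
    have := (expDecay κ).smul_mem (C c⁻¹) h
    rwa [Polynomial.toLaurent_C, smul_smul, ← map_mul, inv_mul_cancel₀ hc, map_one, one_smul] at this
  induction m with
  | zero => exact fun f hf hdeg => hconst f hf (Nat.le_zero.1 hdeg)
  | succ m ih =>
    intro f hf hdeg
    by_cases h0 : f.natDegree = 0
    · exact hconst f hf h0
    obtain ⟨a, ha⟩ := IsAlgClosed.exists_root f (by
      rw [Polynomial.degree_eq_natDegree hf]
      exact_mod_cast h0)
    obtain ⟨f', rfl⟩ := Polynomial.dvd_iff_isRoot.2 ha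
    have hf' : f' ≠ 0 := right_ne_zero_of_mul hf
    have hdeg' : f'.natDegree ≤ m := by
      rw [Polynomial.natDegree_mul (Polynomial.X_sub_C_ne_zero a) hf',
        Polynomial.natDegree_X_sub_C] at hdeg
      omega
    obtain ⟨κ₁, h1, h1'⟩ := ih f' hf' hdeg'
    obtain ⟨κ₂, h2, h2'⟩ := mem_expDecay_of_linear a
    refine ⟨min κ₁ κ₂, lt_min h1 h2, fun κ hκ hle w hw h => ?_⟩
    rw [map_mul, map_sub, Polynomial.toLaurent_X, Polynomial.toLaurent_C, mul_smul] at h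
    exact h1' κ hκ (hle.trans (min_le_left _ _)) w hw
      (h2' κ hκ (hle.trans (min_le_right _ _)) _ (vanishing.smul_mem _ hw) h)

/-- A sequence that tends to zero and becomes exponentially decaying after multiplication with a
nonzero Laurent polynomial decays exponentially: zeros of the polynomial on the unit circle cannot
contribute. The rate depends only on the polynomial. -/
theorem mem_expDecay_of_smul {q : LaurentPolynomial ℂ} (hq : q ≠ 0) :
    ∃ κ₀ > 0, ∀ κ, 0 < κ → κ ≤ κ₀ → ∀ w ∈ vanishing, q • w ∈ expDecay κ → w ∈ expDecay κ := by
  obtain ⟨m, f, hf⟩ := q.exists_T_pow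
  have hf0 : f ≠ 0 := by
    rintro rfl
    rw [map_zero] at hf
    exact hq ((isUnit_T (R := ℂ) m).mul_left_eq_zero.1 hf.symm)
  obtain ⟨κ₀, h0, h⟩ := mem_expDecay_of_polynomial f.natDegree f hf0 le_rfl
  refine ⟨κ₀, h0, fun κ hκ hle w hw hqw => h κ hκ hle w hw ?_⟩
  rw [hf, mul_comm, mul_smul]
  exact (expDecay κ).smul_mem _ hqw

end Seq

namespace Seq

open LaurentPolynomial

/-! ### Correlation of square-summable sequences -/

/-- Square-summable sequences. -/
def square : Submodule (LaurentPolynomial ℂ) Seq :=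
  submoduleOfShift
    { carrier := {y | Summable fun g => ‖y g‖ ^ 2}
      add_mem' := fun {y z} hy hz => by
        refine Summable.of_nonneg_of_le (fun g => sq_nonneg _) (fun g => ?_)
          ((Summable.add hy hz).mul_left 2)
        have h1 : ‖y g + z g‖ ≤ ‖y g‖ + ‖z g‖ := norm_add_le _ _
        have h2 := norm_nonneg (y g + z g)
        change ‖y g + z g‖ ^ 2 ≤ _
        nlinarith [sq_nonneg (‖y g‖ - ‖z g‖)]
      zero_mem' := by
        refine summable_zero.congr fun g => ?_
        rw [zero_apply]
        simp
      smul_mem' := fun c y hy => by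
        refine (Summable.mul_left (‖c‖ ^ 2) hy).congr fun g => ?_
        rw [smul_apply, norm_mul, mul_pow] }
    fun k y hy => by
      refine (hy.comp_injective (i := fun g => g + k) (add_left_injective k)).congr fun g => ?_
      rw [Function.comp, T_smul_apply]

lemma square_le_vanishing : square ≤ vanishing := by
  intro y hy
  have h := (Summable.tendsto_cofinite_zero (f := fun g => ‖y g‖ ^ 2) hy).sqrt
  rw [Real.sqrt_zero] at h
  exact (tendsto_zero_iff_norm_tendsto_zero (f := fun g => y g)).2
    (h.congr fun g => Real.sqrt_sq (norm_nonneg _))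

/-- The correlation sequence `m ↦ ∑ g, y g * y' (g - m)`. -/
noncomputable def corr (y y' : Seq) : Seq := fun m => ∑' g, y g * y' (g - m)

lemma summable_corr {y y' : Seq} (hy : y ∈ square) (hy' : y' ∈ square) (m : ℤ) :
    Summable fun g => y g * y' (g - m) := by
  have h1 := Summable.comp_injective (i := fun g => g - m) hy' sub_left_injective
  refine Summable.of_norm_bounded (Summable.add hy h1) fun g => ?_
  rw [norm_mul, Function.comp]
  nlinarith [sq_nonneg (‖y g‖ - ‖y' (g - m)‖), sq_nonneg ‖y g‖, sq_nonneg ‖y' (g - m)‖]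

lemma corr_add_left {y z y' : Seq} (hy : y ∈ square) (hz : z ∈ square) (hy' : y' ∈ square) :
    corr (y + z) y' = corr y y' + corr z y' := by
  funext m
  rw [add_apply, corr, corr, corr,
    ← (summable_corr hy hy' m).tsum_add (summable_corr hz hy' m)]
  exact tsum_congr fun g => by rw [add_apply, add_mul]

lemma corr_add_right {y y' z' : Seq} (hy : y ∈ square) (hy' : y' ∈ square) (hz' : z' ∈ square) :
    corr y (y' + z') = corr y y' + corr y z' := by
  funext m
  rw [add_apply, corr, corr, corr,
    ← (summable_corr hy hy' m).tsum_add (summable_corr hy hz' m)]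
  exact tsum_congr fun g => by rw [add_apply, mul_add]

lemma corr_smul_left (q : LaurentPolynomial ℂ) {y y' : Seq} (hy : y ∈ square) (hy' : y' ∈ square) :
    corr (q • y) y' = q • corr y y' := by
  induction q using LaurentPolynomial.induction_on' with
  | add p q hp hq =>
    rw [add_smul, corr_add_left (square.smul_mem p hy) (square.smul_mem q hy) hy', hp, hq, add_smul]
  | C_mul_T k a =>
    rw [mul_smul, mul_smul, C_smul, C_smul]
    funext m
    rw [smul_apply, T_smul_apply, corr, corr, ← tsum_mul_left,
      ← (Equiv.addRight k).tsum_eq fun g => a * (y g * y' (g - (m + k)))]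
    refine tsum_congr fun g => ?_
    rw [smul_apply, T_smul_apply, Equiv.coe_addRight, add_sub_add_right_eq_sub, mul_assoc]

lemma corr_smul_right (q : LaurentPolynomial ℂ) {y y' : Seq} (hy : y ∈ square)
    (hy' : y' ∈ square) : corr y (q • y') = invert q • corr y y' := by
  induction q using LaurentPolynomial.induction_on' with
  | add p q hp hq =>
    rw [add_smul, corr_add_right hy (square.smul_mem p hy') (square.smul_mem q hy'), hp, hq,
      map_add, add_smul]
  | C_mul_T k a =>
    rw [map_mul, invert_T, invert_C, mul_smul, mul_smul, C_smul, C_smul]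
    funext m
    rw [smul_apply, T_smul_apply, corr, corr, ← tsum_mul_left]
    refine tsum_congr fun g => ?_
    rw [smul_apply, T_smul_apply, show g - m + k = g - (m + -k) by ring]
    ring

lemma corr_sum_left {ι : Type*} (F : Finset ι) {y : ι → Seq} {y' : Seq}
    (hy : ∀ i, y i ∈ square) (hy' : y' ∈ square) :
    corr (∑ i ∈ F, y i) y' = ∑ i ∈ F, corr (y i) y' := by
  induction F using Finset.induction_on with
  | empty =>
    funext m
    simp [corr, zero_apply]
  | insert i F hi ih =>
    rw [Finset.sum_insert hi, Finset.sum_insert hi,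
      corr_add_left (hy i) (square.sum_mem fun i _ => hy i) hy', ih]

lemma corr_sum_right {ι : Type*} (F : Finset ι) {y : Seq} {y' : ι → Seq}
    (hy : y ∈ square) (hy' : ∀ i, y' i ∈ square) :
    corr y (∑ i ∈ F, y' i) = ∑ i ∈ F, corr y (y' i) := by
  induction F using Finset.induction_on with
  | empty =>
    funext m
    simp [corr, zero_apply]
  | insert i F hi ih =>
    rw [Finset.sum_insert hi, Finset.sum_insert hi,
      corr_add_right hy (hy' i) (square.sum_mem fun i _ => hy' i), ih]

lemma summable_exp_neg_abs {κ : ℝ} (hκ : 0 < κ) :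
    Summable fun g : ℤ => Real.exp (-κ * |(g : ℝ)|) := by
  have h : Summable fun k : ℕ => Real.exp (-κ * k) := by
    have h1 := summable_geometric_of_lt_one (Real.exp_pos (-κ)).le
      ((Real.exp_lt_exp.2 (by linarith : -κ < 0)).trans_eq Real.exp_zero)
    refine h1.congr fun k => ?_
    rw [← Real.exp_nat_mul, mul_comm]
  refine Summable.of_nat_of_neg ?_ ?_
  · simpa using h
  · simpa using h

lemma corr_mem_expDecay {κ : ℝ} (hκ : 0 < κ) {y y' : Seq} (hy : y ∈ expDecay κ)
    (hy' : y' ∈ expDecay κ) : corr y y' ∈ expDecay (κ / 2) := by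
  obtain ⟨C, hC⟩ := hy
  obtain ⟨C', hC'⟩ := hy'
  have hC0 : 0 ≤ C := by
    have := (norm_nonneg _).trans (hC 0)
    simpa using this
  have hC0' : 0 ≤ C' := by
    have := (norm_nonneg _).trans (hC' 0)
    simpa using this
  have hs := (summable_exp_neg_abs (half_pos hκ))
  refine ⟨C * C' * ∑' g : ℤ, Real.exp (-(κ / 2) * |(g : ℝ)|), fun m => ?_⟩
  rw [corr]
  refine tsum_of_norm_bounded (((hs.hasSum.mul_left (C * C')).mul_right _)) fun g => ?_
  rw [norm_mul]
  calc ‖y g‖ * ‖y' (g - m)‖ ≤ C * Real.exp (-κ * |(g : ℝ)|) *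
        (C' * Real.exp (-κ * |((g - m : ℤ) : ℝ)|)) :=
        mul_le_mul (hC g) (hC' _) (norm_nonneg _) (by positivity)
    _ = C * C' * Real.exp (-κ * |(g : ℝ)| + -κ * |((g - m : ℤ) : ℝ)|) := by
        rw [Real.exp_add]
        ring
    _ ≤ C * C' * Real.exp (-(κ / 2) * |(g : ℝ)| + -(κ / 2) * |(m : ℝ)|) := by
        refine mul_le_mul_of_nonneg_left (Real.exp_le_exp.2 ?_) (by positivity)
        push_cast
        have h1 : |(m : ℝ)| ≤ |(g : ℝ)| + |(g : ℝ) - m| := by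
          have := abs_sub_abs_le_abs_sub (m : ℝ) g
          rw [abs_sub_comm] at this
          linarith
        nlinarith [abs_nonneg ((g : ℝ) - m)]
    _ = _ := by
        rw [Real.exp_add]
        ring

/-! ### Sums of sequences with a linear recursion -/

section Recursion

variable {J : Type}

/-- The time shift of a family of sequences. -/
noncomputable def timeShift (J : Type) :
    Module.End (LaurentPolynomial ℂ) (ℕ → J → Seq) where
  toFun X := fun t => X (t + 1)
  map_add' _ _ := rfl
  map_smul' _ _ := rfl

lemma timeShift_pow_apply (X : ℕ → J → Seq) (k t : ℕ) : (timeShift J ^ k) X t = X (t + k) := by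
  induction k generalizing t with
  | zero => rfl
  | succ k ih =>
    rw [pow_succ', Module.End.mul_apply]
    change (timeShift J ^ k) X (t + 1) = _
    rw [ih, add_right_comm, add_assoc]

/-- The action of matrices of Laurent polynomials on vectors of sequences. -/
noncomputable def matrixAct (J : Type) [Fintype J] [DecidableEq J] :
    Matrix J J (LaurentPolynomial ℂ) →ₐ[LaurentPolynomial ℂ]
      Module.End (LaurentPolynomial ℂ) (J → Seq) :=
  AlgHom.ofLinearMap
    { toFun := fun N =>
        { toFun := fun x j => ∑ j', N j j' • x j'
          map_add' := fun x x' => by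
            funext j
            simp [smul_add, Finset.sum_add_distrib]
          map_smul' := fun q x => by
            funext j
            simp [Finset.smul_sum, smul_smul, mul_comm] }
      map_add' := fun N N' => by
        refine LinearMap.ext fun x => funext fun j => ?_
        change ∑ j', (N j j' + N' j j') • x j' = ∑ j', N j j' • x j' + ∑ j', N' j j' • x j'
        simp only [add_smul, Finset.sum_add_distrib]
      map_smul' := fun q N => by
        refine LinearMap.ext fun x => funext fun j => ?_
        change ∑ j', (q * N j j') • x j' = q • ∑ j', N j j' • x j'
        simp only [Finset.smul_sum, mul_smul] }
    (by
      refine LinearMap.ext fun x => funext fun j => ?_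
      change ∑ j', (1 : Matrix J J (LaurentPolynomial ℂ)) j j' • x j' = x j
      simp [Matrix.one_apply, ite_smul])
    (fun N N' => by
      refine LinearMap.ext fun x => funext fun j => ?_
      change ∑ j', (∑ k, N j k * N' k j') • x j' = ∑ k, N j k • ∑ j', N' k j' • x j'
      simp only [Finset.sum_smul, Finset.smul_sum, mul_smul]
      exact Finset.sum_comm)

lemma matrixAct_apply [Fintype J] [DecidableEq J] (N : Matrix J J (LaurentPolynomial ℂ)) (x : J → Seq) (j : J) :
    matrixAct J N x j = ∑ j', N j j' • x j' := rfl

/-- Pointwise summability in time. -/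
def HasTimeSum (X : ℕ → J → Seq) (S : J → Seq) : Prop :=
  ∀ j g, HasSum (fun t => X t j g) (S j g)

lemma HasTimeSum.smul {X : ℕ → J → Seq} {S : J → Seq} (h : HasTimeSum X S)
    (q : LaurentPolynomial ℂ) : HasTimeSum (q • X) (q • S) := by
  induction q using LaurentPolynomial.induction_on' with
  | add p q hp hq =>
    intro j g
    rw [add_smul, add_smul]
    exact (hp j g).add (hq j g)
  | C_mul_T k a =>
    intro j g
    have := (h j (g + k)).mul_left a
    simpa only [Pi.smul_apply, mul_smul, C_smul, smul_apply, T_smul_apply] using this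

lemma HasTimeSum.add {X X' : ℕ → J → Seq} {S S' : J → Seq} (h : HasTimeSum X S)
    (h' : HasTimeSum X' S') : HasTimeSum (X + X') (S + S') :=
  fun j g => (h j g).add (h' j g)

lemma HasTimeSum.timeShift {X : ℕ → J → Seq} {S : J → Seq} (h : HasTimeSum X S) :
    HasTimeSum (timeShift J X) (S - X 0) := by
  intro j g
  have := (hasSum_nat_add_iff' 1).2 (h j g)
  rw [Finset.sum_range_one] at this
  exact this

lemma HasTimeSum.timeShift_pow {X : ℕ → J → Seq} {S : J → Seq} (h : HasTimeSum X S)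
    {M : Submodule (LaurentPolynomial ℂ) Seq} (hM : ∀ t j, X t j ∈ M) (k : ℕ) :
    ∃ e : J → Seq, (∀ j, e j ∈ M) ∧ HasTimeSum ((Seq.timeShift J ^ k) X) (S - e) := by
  induction k with
  | zero => exact ⟨0, fun j => M.zero_mem, by simpa using h⟩
  | succ k ih =>
    obtain ⟨e, he, hs⟩ := ih
    refine ⟨e + X k, fun j => M.add_mem (he j) (hM k j), ?_⟩
    have := hs.timeShift
    rw [timeShift_pow_apply, zero_add, sub_sub] at this
    rwa [pow_succ', Module.End.mul_apply]

/-- Summation in time turns a polynomial in the time shift into its value at `1`, up to boundary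
terms. -/
lemma HasTimeSum.aeval {X : ℕ → J → Seq} {S : J → Seq} (h : HasTimeSum X S)
    {M : Submodule (LaurentPolynomial ℂ) Seq} (hM : ∀ t j, X t j ∈ M)
    (Q : Polynomial (LaurentPolynomial ℂ)) :
    ∃ e : J → Seq, (∀ j, e j ∈ M) ∧
      HasTimeSum (Polynomial.aeval (Seq.timeShift J) Q X) (Q.eval 1 • S - e) := by
  induction Q using Polynomial.induction_on' with
  | add P Q hP hQ =>
    obtain ⟨e, he, hs⟩ := hP
    obtain ⟨e', he', hs'⟩ := hQ
    refine ⟨e + e', fun j => M.add_mem (he j) (he' j), ?_⟩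
    rw [map_add, Polynomial.eval_add, add_smul, LinearMap.add_apply, add_sub_add_comm]
    exact hs.add hs'
  | monomial k a =>
    obtain ⟨e, he, hs⟩ := h.timeShift_pow hM k
    refine ⟨a • e, fun j => M.smul_mem a (he j), ?_⟩
    rw [Polynomial.aeval_monomial, Polynomial.eval_monomial, one_pow, mul_one, ← smul_sub,
      Module.End.mul_apply, Module.algebraMap_end_apply]
    exact hs.smul a

/-- A family that is polynomial in time and summable vanishes. -/
lemma HasTimeSum.eq_zero_of_pow {X : ℕ → J → Seq} {S : J → Seq} (h : HasTimeSum X S) (k : ℕ)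
    (hX : Polynomial.aeval (Seq.timeShift J)
      ((Polynomial.X - Polynomial.C 1 : Polynomial (LaurentPolynomial ℂ)) ^ k) X = 0) : X = 0 := by
  induction k with
  | zero => simpa using hX
  | succ k ih =>
    refine ih ?_
    obtain ⟨e, -, hs⟩ := h.aeval (M := ⊤) (fun _ _ => trivial)
      ((Polynomial.X - Polynomial.C 1 : Polynomial (LaurentPolynomial ℂ)) ^ k)
    set w := Polynomial.aeval (Seq.timeShift J)
      ((Polynomial.X - Polynomial.C 1 : Polynomial (LaurentPolynomial ℂ)) ^ k) X
    rw [pow_succ', map_mul, Module.End.mul_apply] at hX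
    have hconst : ∀ t, w (t + 1) = w t := by
      intro t
      have := congrFun hX t
      simp only [map_sub, Polynomial.aeval_X, map_one, LinearMap.sub_apply,
        Module.End.one_apply] at this
      exact sub_eq_zero.1 this
    have hconst' : ∀ t, w t = w 0 := by
      intro t
      induction t with
      | zero => rfl
      | succ t iht => rw [hconst, iht]
    funext t j g
    have h0 := (hs j g).summable.tendsto_atTop_zero
    simp only [hconst'] at h0
    rw [hconst' t]
    exact tendsto_nhds_unique tendsto_const_nhds h0

end Recursion

/-- The sum over time of vectors of sequences with the linear recursion `Δ X (t + 1) = N X t` is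
rational relative to the initial values: some nonzero Laurent polynomial, depending only on `Δ` and
`N`, maps it into every module containing all `X t`. By the Cayley–Hamilton theorem the vectors
satisfy a scalar recursion in time. Its characteristic polynomial may vanish at `1`, but the factors
`x - 1` can be cancelled because the vectors are summable. -/
theorem exists_smul_timeSum_mem {J : Type} [Fintype J] {Δ : LaurentPolynomial ℂ} (hΔ : Δ ≠ 0)
    (N : Matrix J J (LaurentPolynomial ℂ)) :
    ∃ q : LaurentPolynomial ℂ, q ≠ 0 ∧ ∀ (M : Submodule (LaurentPolynomial ℂ) Seq)
      (X : ℕ → J → Seq) (S : J → Seq), (∀ t j, X t j ∈ M) →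
      (∀ t j, Δ • X (t + 1) j = ∑ j', N j j' • X t j') → HasTimeSum X S → ∀ j, q • S j ∈ M := by
  set P : Polynomial (LaurentPolynomial ℂ) := N.charpoly.comp (Polynomial.C Δ * Polynomial.X)
  have hP : P ≠ 0 := by
    intro h0
    have h1 := Polynomial.comp_C_mul_X_coeff (r := Δ) (p := N.charpoly) (n := N.charpoly.natDegree)
    have h2 : P.coeff N.charpoly.natDegree = 0 := by rw [h0, Polynomial.coeff_zero]
    rw [show N.charpoly.comp (Polynomial.C Δ * Polynomial.X) = P from rfl, h2,
      Polynomial.coeff_natDegree, N.charpoly_monic.leadingCoeff, one_mul] at h1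
    exact pow_ne_zero _ hΔ h1.symm
  obtain ⟨Q, hPQ, hQ⟩ := Polynomial.exists_eq_pow_rootMultiplicity_mul_and_not_dvd P hP 1
  refine ⟨Q.eval 1, fun h => hQ (Polynomial.dvd_iff_isRoot.2 h), ?_⟩
  intro M X S hM hrec hsum j
  have hpow : ∀ (k t : ℕ), ((Δ • timeShift J) ^ k) X t = (matrixAct J N ^ k) (X t) := by
    intro k
    induction k with
    | zero => exact fun t => rfl
    | succ k ih =>
      intro t
      rw [pow_succ', Module.End.mul_apply, pow_succ, Module.End.mul_apply]
      change Δ • ((Δ • timeShift J) ^ k) X (t + 1) = _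
      rw [ih, ← map_smul]
      congr 1
      funext j
      exact hrec t j
  have hann : Polynomial.aeval (timeShift J) P X = 0 := by
    have h1 : Polynomial.aeval (timeShift J) P =
        Polynomial.aeval (Δ • timeShift J) N.charpoly := by
      rw [Polynomial.aeval_comp, map_mul, Polynomial.aeval_X, Polynomial.aeval_C,
        ← Algebra.smul_def]
    have h2 : ∀ (p : Polynomial (LaurentPolynomial ℂ)) (t : ℕ),
        Polynomial.aeval (Δ • timeShift J) p X t = Polynomial.aeval (matrixAct J N) p (X t) := by
      intro p t
      induction p using Polynomial.induction_on' with
      | add p p' hp hp' =>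
        rw [map_add, map_add, LinearMap.add_apply, LinearMap.add_apply, Pi.add_apply, hp, hp']
      | monomial k a =>
        rw [Polynomial.aeval_monomial, Polynomial.aeval_monomial, Module.End.mul_apply,
          Module.End.mul_apply, Module.algebraMap_end_apply, Module.algebraMap_end_apply,
          Pi.smul_apply, hpow]
    funext t
    rw [h1, h2, Polynomial.aeval_algHom_apply, Matrix.aeval_self_charpoly, map_zero]
    rfl
  obtain ⟨e, he, hs⟩ := hsum.aeval hM Q
  rw [hPQ, map_mul, Module.End.mul_apply] at hann
  have hzero := hs.eq_zero_of_pow _ hann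
  rw [hzero] at hs
  have : (Q.eval 1 • S - e) j = 0 := by
    funext g
    exact (hs j g).unique hasSum_zero
  rw [Pi.sub_apply, Pi.smul_apply, sub_eq_zero] at this
  rw [this]
  exact he j

end Seq

namespace Seq

open LaurentPolynomial

/-! ### Correlations of recursively generated sequences -/

section Driven

variable {J : Type} [Fintype J]

/-- A square-summable family of vectors of sequences that starts from zero and follows the linear
recursion `D Y (t + 1) = N Y t`, apart from a source of finite support in space and time. -/
structure IsDriven (D : LaurentPolynomial ℂ) (N : Matrix J J (LaurentPolynomial ℂ))
    (Y : ℕ → J → Seq) : Prop where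
  zero : Y 0 = 0
  summable : ∀ j, Summable fun x : ℕ × ℤ => ‖Y x.1 j x.2‖ ^ 2
  support_finite : ∀ t j, (Function.support (D • Y (t + 1) j - ∑ j', N j j' • Y t j')).Finite
  recursion : ∃ t₀, ∀ t, t₀ ≤ t → ∀ j, D • Y (t + 1) j = ∑ j', N j j' • Y t j'

variable {D : LaurentPolynomial ℂ} {N : Matrix J J (LaurentPolynomial ℂ)} {Y Y' : ℕ → J → Seq}

lemma IsDriven.mem_square (h : IsDriven D N Y) (t : ℕ) (j : J) : Y t j ∈ square :=
  (h.summable j).comp_injective (i := fun g => (t, g)) fun _ _ hg => (Prod.mk.inj hg).2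

lemma IsDriven.mem_expDecay (h : IsDriven D N Y) {κ : ℝ}
    (hκ : ∀ w ∈ vanishing, D • w ∈ expDecay κ → w ∈ expDecay κ) (t : ℕ) (j : J) :
    Y t j ∈ expDecay κ := by
  induction t generalizing j with
  | zero =>
    rw [h.zero]
    exact (expDecay κ).zero_mem
  | succ t ih =>
    refine hκ _ (square_le_vanishing (h.mem_square _ _)) ?_
    rw [← sub_add_cancel (D • Y (t + 1) j) (∑ j', N j j' • Y t j')]
    exact (expDecay κ).add_mem (mem_expDecay_of_support_finite (h.support_finite t j) κ)
      ((expDecay κ).sum_mem fun j' _ => (expDecay κ).smul_mem _ (ih j'))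

lemma norm_corr_le {y y' : Seq} (hy : y ∈ square) (hy' : y' ∈ square) (m : ℤ) :
    ‖corr y y' m‖ ≤ ∑' g, ‖y g‖ ^ 2 + ∑' g, ‖y' g‖ ^ 2 := by
  have h1 : HasSum (fun g => ‖y' (g - m)‖ ^ 2) (∑' g, ‖y' g‖ ^ 2) :=
    (Equiv.subRight m).hasSum_iff.2 (Summable.hasSum hy')
  refine tsum_of_norm_bounded ((Summable.hasSum hy).add h1) fun g => ?_
  rw [norm_mul]
  nlinarith [sq_nonneg (‖y g‖ - ‖y' (g - m)‖), sq_nonneg ‖y g‖, sq_nonneg ‖y' (g - m)‖]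

/-- The correlation of two families of sequences, summed over time. -/
noncomputable def totalCorr (Y Y' : ℕ → J → Seq) (i j : J) : Seq :=
  fun m => ∑' t, corr (Y t i) (Y' t j) m

lemma IsDriven.summable_norm (h : IsDriven D N Y) (h' : IsDriven D N Y') (i j : J) :
    Summable fun t => ∑' g, ‖Y t i g‖ ^ 2 + ∑' g, ‖Y' t j g‖ ^ 2 :=
  (h.summable i).prod.add (h'.summable j).prod

lemma IsDriven.hasSum_corr (h : IsDriven D N Y) (h' : IsDriven D N Y') (i j : J) (m : ℤ) :
    HasSum (fun t => corr (Y t i) (Y' t j) m) (totalCorr Y Y' i j m) :=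
  (Summable.of_norm_bounded (h.summable_norm h' i j) fun t =>
    norm_corr_le (h.mem_square t i) (h'.mem_square t j) m).hasSum

lemma IsDriven.totalCorr_mem_vanishing (h : IsDriven D N Y) (h' : IsDriven D N Y')
    (hv : ∀ t i j, corr (Y t i) (Y' t j) ∈ vanishing) (i j : J) :
    totalCorr Y Y' i j ∈ vanishing := by
  have := tendsto_tsum_of_dominated_convergence (𝓕 := cofinite)
    (f := fun (m : ℤ) t => corr (Y t i) (Y' t j) m) (g := fun _ => 0) (h.summable_norm h' i j)
    (fun t => hv t i j)
    (Eventually.of_forall fun m t => norm_corr_le (h.mem_square t i) (h'.mem_square t j) m)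
  rwa [tsum_zero] at this

end Driven

lemma expDecay_le_vanishing {κ : ℝ} (hκ : 0 < κ) : expDecay κ ≤ vanishing := by
  rintro y ⟨C, hC⟩
  have h := ((summable_exp_neg_abs hκ).mul_left C).tendsto_cofinite_zero
  exact squeeze_zero_norm (a := fun g : ℤ => C * Real.exp (-κ * |(g : ℝ)|)) hC h

/-- The time-summed correlations of two driven families decay exponentially, with a rate that
depends only on the recursion. Each term decays exponentially, because its multiple by a nonzero
Laurent polynomial does. The products `Y t i`, `Y' t j` follow a linear recursion as well, so a
nonzero multiple of their sum decays exponentially; the sum itself tends to zero, and hence decays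
exponentially too. -/
theorem exists_totalCorr_mem_expDecay {J : Type} [Fintype J] {D : LaurentPolynomial ℂ} (hD : D ≠ 0)
    (N : Matrix J J (LaurentPolynomial ℂ)) :
    ∃ κ > 0, ∀ Y Y' : ℕ → J → Seq, IsDriven D N Y → IsDriven D N Y' → ∀ i j,
      totalCorr Y Y' i j ∈ expDecay κ := by
  obtain ⟨κ₁, hκ₁, H₁⟩ := mem_expDecay_of_smul hD
  have hΔ : D * invert D ≠ 0 :=
    mul_ne_zero hD fun h => hD (invert.injective (h.trans (map_zero _).symm))
  let 𝒩 : Matrix (J × J) (J × J) (LaurentPolynomial ℂ) :=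
    fun x y => N x.1 y.1 * invert (N x.2 y.2)
  obtain ⟨q, hq, hsum⟩ := exists_smul_timeSum_mem hΔ 𝒩
  obtain ⟨κ₂, hκ₂, H₂⟩ := mem_expDecay_of_smul hq
  set κ := min κ₁ κ₂
  have hκ : 0 < κ := lt_min hκ₁ hκ₂
  refine ⟨κ / 2, half_pos hκ, fun Y Y' h h' i j => ?_⟩
  have hX : ∀ t (x : J × J), corr (Y t x.1) (Y' t x.2) ∈ expDecay (κ / 2) := fun t x =>
    corr_mem_expDecay hκ (h.mem_expDecay (H₁ κ hκ (min_le_left _ _)) t x.1)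
      (h'.mem_expDecay (H₁ κ hκ (min_le_left _ _)) t x.2)
  have hκ2 : κ / 2 ≤ κ₂ := (half_le_self hκ.le).trans (min_le_right _ _)
  refine H₂ _ (half_pos hκ) hκ2 _ (h.totalCorr_mem_vanishing h'
    (fun t i j => expDecay_le_vanishing (half_pos hκ) (hX t (i, j))) i j) ?_
  obtain ⟨t₁, ht₁⟩ := h.recursion
  obtain ⟨t₂, ht₂⟩ := h'.recursion
  set t₀ := max t₁ t₂
  let X : ℕ → J × J → Seq := fun t x => corr (Y t x.1) (Y' t x.2)
  have htot : HasTimeSum X fun x => totalCorr Y Y' x.1 x.2 := fun x m =>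
    h.hasSum_corr h' x.1 x.2 m
  obtain ⟨e, he, htail⟩ := htot.timeShift_pow (M := expDecay (κ / 2)) hX t₀
  have hmem := hsum (expDecay (κ / 2)) _ _ (fun t x => by rw [timeShift_pow_apply]; exact hX _ x) ?_ htail (i, j)
  · have := (expDecay (κ / 2)).add_mem hmem ((expDecay (κ / 2)).smul_mem q (he (i, j)))
    rwa [← smul_add, Pi.sub_apply, sub_add_cancel] at this
  · intro t x
    rw [timeShift_pow_apply, timeShift_pow_apply]
    have e1 : t + 1 + t₀ = t + t₀ + 1 := by omega
    simp only [X, 𝒩, e1]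
    have s1 := fun t j => h.mem_square t j
    have s2 := fun t j => h'.mem_square t j
    rw [mul_smul, ← corr_smul_right D (s1 _ _) (s2 _ _),
      ← corr_smul_left D (s1 _ _) (square.smul_mem _ (s2 _ _)),
      ht₁ _ (by omega), ht₂ _ (by omega),
      corr_sum_left _ (fun k => square.smul_mem _ (s1 _ _))
        (square.sum_mem fun k _ => square.smul_mem _ (s2 _ _)), Fintype.sum_prod_type]
    refine Finset.sum_congr rfl fun k _ => ?_
    rw [corr_sum_right _ (square.smul_mem _ (s1 _ _)) fun k => square.smul_mem _ (s2 _ _)]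
    refine Finset.sum_congr rfl fun l _ => ?_
    rw [corr_smul_left _ (s1 _ _) (square.smul_mem _ (s2 _ _)),
      corr_smul_right _ (s1 _ _) (s2 _ _), mul_smul]

end Seq

/-! ### Coordinates adapted to a direction -/

section Coordinates

/-- The linear function on the lattice that is constant along `(a, -b)`. -/
def height (a b : ℤ) : ℤ × ℤ →+ ℤ :=
  (AddMonoidHom.mulLeft b).comp (AddMonoidHom.fst ℤ ℤ) +
    (AddMonoidHom.mulLeft a).comp (AddMonoidHom.snd ℤ ℤ)

lemma height_apply (a b : ℤ) (x : ℤ × ℤ) : height a b x = b * x.1 + a * x.2 := rfl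

/-- The lattice is cut into strips along `(a, -b)`; `layer a b x` is the strip that contains `x`. -/
def layer (a b : ℤ) (x : ℤ × ℤ) : ℤ := height a b x / (2 * (a + b))

/-- The position of `x` along its strip, in units of `2 • (a, -b)`. -/
def column (a b : ℤ) (x : ℤ × ℤ) : ℤ := (x.1 - x.2) / (2 * (a + b))

/-- The translate of `x` by `g` units along its strip and by `l` strips. -/
def site (a b : ℤ) (x : ℤ × ℤ) (g l : ℤ) : ℤ × ℤ := x + 2 • (g • (a, -b) + l • (1, 1))

/-- The translate of `x` to the strip and the column `0`. -/
def base (a b : ℤ) (x : ℤ × ℤ) : ℤ × ℤ := site a b x (-column a b x) (-layer a b x)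

/-- A fundamental domain for the translations along and across the strips. -/
abbrev Cell (a b : ℤ) : Type := {x : ℤ × ℤ // layer a b x = 0 ∧ column a b x = 0}

variable {a b : ℤ}

lemma site_fst (x : ℤ × ℤ) (g l : ℤ) : (site a b x g l).1 = x.1 + 2 * (g * a + l) := by
  simp [site]

lemma site_snd (x : ℤ × ℤ) (g l : ℤ) : (site a b x g l).2 = x.2 + 2 * (l - g * b) := by
  simp [site]
  ring

lemma layer_site (h : 0 < a + b) (x : ℤ × ℤ) (g l : ℤ) :
    layer a b (site a b x g l) = layer a b x + l := by
  rw [layer, layer, height_apply, height_apply, site_fst, site_snd,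
    ← Int.add_mul_ediv_right _ _ (by omega : 2 * (a + b) ≠ 0)]
  congr 1
  ring

lemma column_site (h : 0 < a + b) (x : ℤ × ℤ) (g l : ℤ) :
    column a b (site a b x g l) = column a b x + g := by
  rw [column, column, site_fst, site_snd, ← Int.add_mul_ediv_right _ _ (by omega : 2 * (a + b) ≠ 0)]
  congr 1
  ring

lemma site_site (x : ℤ × ℤ) (g l g' l' : ℤ) :
    site a b (site a b x g l) g' l' = site a b x (g + g') (l + l') := by
  ext
  · simp only [site_fst]
    ring
  · simp only [site_snd]
    ring

lemma site_zero (x : ℤ × ℤ) : site a b x 0 0 = x := by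
  simp [site]

lemma site_add (x y : ℤ × ℤ) (g l : ℤ) : site a b x g l + y = site a b (x + y) g l :=
  add_right_comm _ _ _

lemma base_site (h : 0 < a + b) (x : ℤ × ℤ) (g l : ℤ) :
    base a b (site a b x g l) = base a b x := by
  rw [base, base, layer_site h, column_site h, site_site]
  congr 1 <;> ring

lemma site_base (x : ℤ × ℤ) (g l : ℤ) :
    site a b (base a b x) (column a b x + g) (layer a b x + l) = site a b x g l := by
  rw [base, site_site, neg_add_cancel_left, neg_add_cancel_left]

/-- The representative of a site in the fundamental domain. -/
def cellOf (h : 0 < a + b) (x : ℤ × ℤ) : Cell a b :=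
  ⟨base a b x, by rw [base, layer_site h, add_neg_cancel],
    by rw [base, column_site h, add_neg_cancel]⟩

lemma base_cell (i : Cell a b) : base a b i.1 = i.1 := by
  rw [base, i.2.1, i.2.2, neg_zero, site_zero]

/-- The coordinates of a site. -/
def coordEquiv (h : 0 < a + b) : Cell a b × (ℤ × ℤ) ≃ ℤ × ℤ where
  toFun y := site a b y.1.1 y.2.2 y.2.1
  invFun x := (cellOf h x, (layer a b x, column a b x))
  left_inv := by
    rintro ⟨i, l, g⟩
    refine Prod.ext (Subtype.ext ?_) (Prod.ext ?_ ?_)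
    · exact (base_site h _ _ _).trans (base_cell i)
    · exact (layer_site h _ _ _).trans (by rw [i.2.1, zero_add])
    · exact (column_site h _ _ _).trans (by rw [i.2.2, zero_add])
  right_inv x := by
    have := site_base (a := a) (b := b) x 0 0
    rw [add_zero, add_zero, site_zero] at this
    exact this

lemma layer_eq_iff (h : 0 < a + b) {x : ℤ × ℤ} {l : ℤ} : layer a b x = l ↔
    l * (2 * (a + b)) ≤ height a b x ∧ height a b x < l * (2 * (a + b)) + 2 * (a + b) :=
  Int.ediv_eq_iff_of_pos (by omega)

lemma finite_cell (h : 0 < a + b) : Finite (Cell a b) := by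
  have hL : 0 < 2 * (a + b) := by omega
  have h1 : ∀ i : Cell a b, 0 ≤ height a b i.1 ∧ height a b i.1 < 2 * (a + b) := fun i => by
    simpa using (layer_eq_iff h).1 i.2.1
  have h2 : ∀ i : Cell a b, 0 ≤ i.1.1 - i.1.2 ∧ i.1.1 - i.1.2 < 2 * (a + b) := fun i => by
    simpa using (Int.ediv_eq_iff_of_pos hL).1 i.2.2
  refine Finite.of_injective (β := Set.Ico 0 (2 * (a + b)) × Set.Ico 0 (2 * (a + b)))
    (fun i => (⟨_, h1 i⟩, ⟨_, h2 i⟩)) fun i j hij => ?_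
  obtain ⟨h3, h4⟩ := Prod.mk.inj hij
  have h3 := congrArg Subtype.val h3
  have h4 := congrArg Subtype.val h4
  simp only [height_apply] at h3 h4
  have h5 : i.1.1 = j.1.1 := by
    refine mul_left_cancel₀ h.ne' ?_
    linear_combination h3 + a * h4
  exact Subtype.ext (Prod.ext h5 (by omega))

end Coordinates

/-! ### Transfer matrices between strips -/

namespace Seq

open LaurentPolynomial

/-- Sequences of finite support. -/
def finSupport : Submodule (LaurentPolynomial ℂ) Seq :=
  submoduleOfShift
    { carrier := {y | (Function.support y).Finite}
      add_mem' := fun {y z} hy hz => (Set.Finite.union hy hz).subset (Function.support_add y z)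
      zero_mem' := by
        change (Function.support fun _ : ℤ => (0 : ℂ)).Finite
        simp
      smul_mem' := fun c y hy => Set.Finite.subset hy (Function.support_const_smul_subset c y) }
    fun k y hy => by
      refine (Set.Finite.preimage (f := fun g => g + k) (add_left_injective k).injOn hy).subset
        fun g hg => ?_
      have := T_smul_apply k y g
      exact fun h0 => hg (this.trans h0)

/-- The unit sequence at the origin. -/
def delta : Seq := fun g => if g = 0 then 1 else 0

lemma delta_mem_finSupport : delta ∈ finSupport :=
  (Set.finite_singleton (0 : ℤ)).subset fun g hg => by
    by_contra h
    exact hg (if_neg h)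

lemma smul_delta_apply (q : LaurentPolynomial ℂ) (g : ℤ) : (q • delta) g = q.coeff (-g) := by
  induction q using LaurentPolynomial.induction_on' with
  | add p q hp hq =>
    rw [add_smul, add_apply, hp, hq]
    rfl
  | C_mul_T k c =>
    rw [mul_smul, C_smul, smul_apply, T_smul_apply, ← single_eq_C_mul_T,
      AddMonoidAlgebra.coeff_single, Finsupp.single_apply, delta]
    by_cases h : g + k = 0
    · rw [if_pos h, if_pos (by omega), mul_one]
    · rw [if_neg h, if_neg (by omega), mul_zero]

lemma eq_zero_of_smul_delta {q : LaurentPolynomial ℂ} (hq : q • delta = 0) : q = 0 := by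
  refine LaurentPolynomial.ext fun g => ?_
  have := smul_delta_apply q (-g)
  rw [hq, neg_neg] at this
  exact this.symm

end Seq

namespace Network

open LaurentPolynomial

variable {p n : ℕ} {P : Network (ℤ × ℤ) p n} {a b : ℤ}

lemma IsPlane.tensor_site (hP : P.IsPlane) (x : ℤ × ℤ) (g l : ℤ) :
    P.tensor (site a b x g l) = P.tensor x := hP.tensor_add _ _

lemma IsPlane.inc_site (hP : P.IsPlane) (x : ℤ × ℤ) (g l : ℤ) :
    P.inc (site a b x g l) = P.inc x := hP.inc_add _ _

lemma IsPlane.tensor_base (hP : P.IsPlane) (x : ℤ × ℤ) :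
    P.tensor (base a b x) = P.tensor x := hP.tensor_site _ _ _

/-- An arrow leads to the same strip or to the next one. -/
lemma layer_add_step (hP : P.IsPlane) (h : 0 < a + b) (ha : 0 ≤ a) (hb : 0 ≤ b)
    (ht : P.IsTime (height a b)) {x : ℤ × ℤ} {e : Leg} (he : ¬P.inc x e) :
    layer a b (x + P.step e) = layer a b x ∨ layer a b (x + P.step e) = layer a b x + 1 := by
  have h1 := ht x e he
  have h2 : height a b (P.step e) ≤ 2 * (a + b) := by
    cases e <;> simp [step, hP.e₁, hP.e₂, height_apply] <;> omega
  have h3 := (layer_eq_iff h (x := x)).1 rfl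
  rw [layer_eq_iff h, layer_eq_iff h, map_add, add_mul]
  omega

/-- The components of a field on a strip, as sequences along the strip. -/
noncomputable def strip (a b : ℤ) (v : ℤ × ℤ → Mode p n → ℝ) (l : ℤ)
    (x : Cell a b × Mode p n) : Seq :=
  fun g => (v (site a b x.1.1 g l) x.2 : ℂ)

/-- The contribution of the strip `l + θ` to the propagation of a field back to the strip `l`. -/
noncomputable def transfer (P : Network (ℤ × ℤ) p n) (a b θ : ℤ) :
    Matrix (Cell a b × Mode p n) (Cell a b × Mode p n) (LaurentPolynomial ℂ) := fun x y =>
  match x.2 with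
  | .inl _ => 0
  | .inr (e, k) =>
      if ¬P.inc x.1.1 e ∧ layer a b (x.1.1 + P.step e) = θ ∧ base a b (x.1.1 + P.step e) = y.1.1 then
        C (-(P.tensor y.1.1 (.inr (e.opp, k)) y.2 : ℂ)) * T (column a b (x.1.1 + P.step e))
      else 0

/-- Backward propagation in the coordinates of the strips. -/
lemma pull_site_inr (hP : P.IsPlane) (v : ℤ × ℤ → Mode p n → ℝ) (x : ℤ × ℤ) (g l : ℤ) {e : Leg}
    (he : ¬P.inc x e) (k : Fin n) :
    P.pull v (site a b x g l) (.inr (e, k)) =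
      -∑ ν, P.tensor (base a b (x + P.step e)) (.inr (e.opp, k)) ν *
        v (site a b (base a b (x + P.step e)) (g + column a b (x + P.step e))
          (l + layer a b (x + P.step e))) ν := by
  have h1 : site a b (base a b (x + P.step e)) (g + column a b (x + P.step e))
      (l + layer a b (x + P.step e)) = site a b x g l + P.step e := by
    rw [add_comm g, add_comm l, site_base, site_add]
  have h2 : P.tensor (site a b x g l + P.step e) = P.tensor (base a b (x + P.step e)) := by
    rw [site_add, hP.tensor_site, hP.tensor_base]
  rw [h1, ← h2]
  simp only [pull, hP.inc_site, he, if_false]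
  rfl

variable [Fintype (Cell a b)]

lemma matrixAct_transfer_inl (θ : ℤ) (Y : Cell a b × Mode p n → Seq) (i : Cell a b) (α : Fin p) :
    Seq.matrixAct _ (P.transfer a b θ) Y (i, .inl α) = 0 := by
  rw [Seq.matrixAct_apply]
  exact Finset.sum_eq_zero fun y _ => zero_smul _ _

lemma matrixAct_transfer_inr (h : 0 < a + b) (θ : ℤ) (Y : Cell a b × Mode p n → Seq) (i : Cell a b)
    (e : Leg) (k : Fin n) (g : ℤ) :
    Seq.matrixAct _ (P.transfer a b θ) Y (i, .inr (e, k)) g =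
      if ¬P.inc i.1 e ∧ layer a b (i.1 + P.step e) = θ then
        -∑ ν, (P.tensor (base a b (i.1 + P.step e)) (.inr (e.opp, k)) ν : ℂ) *
          Y (cellOf h (i.1 + P.step e), ν) (g + column a b (i.1 + P.step e))
      else 0 := by
  rw [Seq.matrixAct_apply, Fintype.sum_prod_type, Finset.sum_eq_single (cellOf h (i.1 + P.step e))]
  · split_ifs with hc
    · rw [← Finset.sum_neg_distrib, Seq.sum_apply]
      refine Finset.sum_congr rfl fun ν _ => ?_
      simp only [transfer]
      rw [if_pos ⟨hc.1, hc.2, rfl⟩, mul_smul, Seq.C_smul, Seq.smul_apply, Seq.T_smul_apply, neg_mul]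
      rfl
    · rw [Seq.sum_apply]
      refine Finset.sum_eq_zero fun ν _ => ?_
      simp only [transfer]
      rw [if_neg fun hc' => hc ⟨hc'.1, hc'.2.1⟩, zero_smul, Seq.zero_apply]
  · intro j _ hj
    refine Finset.sum_eq_zero fun ν _ => ?_
    simp only [transfer]
    rw [if_neg fun hc => hj (Subtype.ext hc.2.2.symm), zero_smul]
  · exact fun hn => absurd (Finset.mem_univ _) hn

lemma strip_pull (hP : P.IsPlane) (h : 0 < a + b) (ha : 0 ≤ a) (hb : 0 ≤ b)
    (ht : P.IsTime (height a b)) (v : ℤ × ℤ → Mode p n → ℝ) (l : ℤ) :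
    strip a b (P.pull v) l = Seq.matrixAct _ (P.transfer a b 0) (strip a b v l) +
      Seq.matrixAct _ (P.transfer a b 1) (strip a b v (l + 1)) := by
  funext ⟨i, μ⟩
  rw [Pi.add_apply]
  rcases μ with α | ⟨e, k⟩
  · rw [matrixAct_transfer_inl, matrixAct_transfer_inl, add_zero]
    funext g
    simp only [strip, pull]
    exact Complex.ofReal_zero
  · funext g
    rw [Seq.add_apply, matrixAct_transfer_inr h, matrixAct_transfer_inr h]
    simp only [strip]
    by_cases he : P.inc i.1 e
    · simp only [he, not_true_eq_false, false_and, if_false, add_zero]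
      simp only [pull, hP.inc_site, he, if_true, Complex.ofReal_zero]
    · rw [pull_site_inr hP v i.1 g l he k]
      rcases layer_add_step hP h ha hb ht he with hl | hl <;> rw [i.2.1] at hl
      · simp [he, hl, cellOf]
      · simp [he, hl, cellOf]

/-- A vector of finitely supported sequences that is fixed by the transfer matrix of a strip would
be a field that is created from nothing. -/
lemma det_one_sub_transfer_ne_zero (hP : P.IsPlane) (h : 0 < a + b) (ha : 0 ≤ a) (hb : 0 ≤ b)
    (ht : P.IsTime (height a b)) : (1 - P.transfer a b 0).det ≠ 0 := by
  intro hdet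
  obtain ⟨u, hu0, hu⟩ := Matrix.exists_mulVec_eq_zero_iff.2 hdet
  let Y : Cell a b × Mode p n → Seq := fun x => u x • Seq.delta
  have hY : Seq.matrixAct _ (P.transfer a b 0) Y = Y := by
    funext x
    have h1 := congrFun hu x
    rw [sub_mulVec, one_mulVec, Pi.sub_apply, Pi.zero_apply, sub_eq_zero] at h1
    rw [Seq.matrixAct_apply]
    simp only [Y]
    rw [h1, mulVec, dotProduct, Finset.sum_smul]
    exact Finset.sum_congr rfl fun y _ => (mul_smul _ _ _).symm
  have hfin : ∀ x, (Function.support (Y x)).Finite := fun x =>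
    Seq.finSupport.smul_mem (u x) Seq.delta_mem_finSupport
  have key : ∀ (φ : ℂ →ₗ[ℝ] ℝ) x g, φ (Y x g) = 0 := by
    intro φ
    let v : ℤ × ℤ → Mode p n → ℝ := fun x μ =>
      if layer a b x = 0 then φ (Y (cellOf h x, μ) (column a b x)) else 0
    have hv : ∀ x, layer a b x ≠ 0 → v x = 0 := fun x hx => funext fun μ => if_neg hx
    have hvs : ∀ i : Cell a b, ∀ g μ, v (site a b i.1 g 0) μ = φ (Y (i, μ) g) := by
      intro i g μ
      have e1 : cellOf h (site a b i.1 g 0) = i :=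
        Subtype.ext ((base_site h _ _ _).trans (base_cell i))
      simp only [v]
      rw [layer_site h, i.2.1, add_zero, if_pos rfl, e1, column_site h, i.2.2, zero_add]
    let S : Set (ℤ × ℤ) := ⋃ x : Cell a b × Mode p n,
      (fun g => site a b x.1.1 g 0) '' Function.support (Y x)
    have hS : S.Finite := Set.finite_iUnion fun x => (hfin x).image _
    have hsite : ∀ x : ℤ × ℤ, layer a b x = 0 →
        ∃ (i : Cell a b) (g : ℤ), x = site a b i.1 g 0 := fun x hx => by
      have := site_base (a := a) (b := b) x 0 0
      rw [hx, add_zero, add_zero, site_zero] at this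
      exact ⟨cellOf h x, _, this.symm⟩
    have hoff : ∀ x, x ∉ hS.toFinset → v x = 0 := by
      intro x hx
      by_cases hl : layer a b x = 0
      · obtain ⟨i, g, rfl⟩ := hsite x hl
        funext μ
        rw [hvs, Pi.zero_apply]
        by_contra hne
        refine hx (hS.mem_toFinset.2 (Set.mem_iUnion.2 ⟨(i, μ), g, fun h0 => hne ?_, rfl⟩))
        rw [h0, map_zero]
      · exact hv x hl
    have hmono : ∀ x e, ¬P.inc x e → layer a b x ≤ layer a b (x + P.step e) := fun x e he => by
      rcases layer_add_step hP h ha hb ht he with h1 | h1 <;> omega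
    have hzero : ∀ x, 0 ≤ layer a b x → v x = 0 := by
      intro x hx
      refine eq_zero_of_eq_pull (hP.acyclic hS.toFinset) hoff (Z := {x | 0 ≤ layer a b x})
        (fun s hs e he => (show 0 ≤ layer a b s from hs).trans (hmono s e he)) (fun s _ hs => ?_) hx
      rcases (show 0 ≤ layer a b s from hs).eq_or_lt with hl | hl
      · obtain ⟨i, g, rfl⟩ := hsite s hl.symm
        funext μ
        rw [hvs, ← hY]
        rcases μ with α | ⟨e, k⟩
        · rw [matrixAct_transfer_inl, Seq.zero_apply, map_zero]
          rfl
        · rw [matrixAct_transfer_inr h]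
          by_cases he : P.inc i.1 e
          · simp [pull, hP.inc_site, he]
          · rw [pull_site_inr hP v i.1 g 0 he k]
            by_cases hl1 : layer a b (i.1 + P.step e) = 0
            · rw [if_pos ⟨he, hl1⟩, map_neg, map_sum]
              refine congrArg Neg.neg (Finset.sum_congr rfl fun ν _ => ?_)
              rw [← Complex.real_smul, map_smul, smul_eq_mul, hl1, add_zero]
              exact congrArg _ (hvs (cellOf h (i.1 + P.step e)) _ ν).symm
            · rw [if_neg fun hc => hl1 hc.2, map_zero, eq_comm, neg_eq_zero]
              refine Finset.sum_eq_zero fun ν _ => ?_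
              rw [hv _ (by
                have := (cellOf h (i.1 + P.step e)).2.1
                rw [cellOf] at this
                rw [layer_site h, this]
                omega), Pi.zero_apply, mul_zero]
      · rw [hv s hl.ne', pull_eq_zero]
        exact fun e he => hv _ (by have := hmono s e he; omega)
    intro x g
    rw [← hvs x.1 g x.2, hzero _ (by rw [layer_site h, x.1.2.1, add_zero])]
    rfl
  refine hu0 (funext fun x => Seq.eq_zero_of_smul_delta (funext fun g => ?_))
  exact Complex.ext (key Complex.reLm x g) (key Complex.imLm x g)

end Network

/-! ### Exponential decay of the bulk two-point function -/

namespace Network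

open LaurentPolynomial

variable {p n : ℕ} {P : Network (ℤ × ℤ) p n} {a b : ℤ}

lemma sq_le_dotProduct_self (v : Mode p n → ℝ) (μ : Mode p n) : v μ ^ 2 ≤ v ⬝ᵥ v := by
  rw [sq]
  exact Finset.single_le_sum (f := fun ν => v ν * v ν) (fun _ _ => mul_self_nonneg _)
    (Finset.mem_univ μ)

lemma injective_site (h : 0 < a + b) (i : Cell a b) :
    Function.Injective fun y : ℤ × ℤ => site a b i.1 y.2 y.1 := fun _ _ hy =>
  (Prod.mk.inj ((coordEquiv h).injective (a₁ := (i, _)) (a₂ := (i, _)) hy)).2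

lemma summable_sq_site (h : 0 < a + b) {v : ℤ × ℤ → Mode p n → ℝ}
    (hv : Summable fun s => v s ⬝ᵥ v s) (i : Cell a b) (μ : Mode p n) :
    Summable fun y : ℤ × ℤ => v (site a b i.1 y.2 y.1) μ ^ 2 :=
  Summable.of_nonneg_of_le (fun _ => sq_nonneg _) (fun _ => sq_le_dotProduct_self _ _)
    (hv.comp_injective (injective_site h i))

lemma strip_source_mem_finSupport (h : 0 < a + b) (r : ℤ × ℤ) (α : Fin p) (l : ℤ)
    (x : Cell a b × Mode p n) : strip a b (source r α) l x ∈ Seq.finSupport := by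
  refine (Set.finite_singleton (column a b r)).subset fun g hg => ?_
  by_contra hne
  refine hg ?_
  have h1 : site a b x.1.1 g l ≠ r := fun h1 => hne (by
    rw [Set.mem_singleton_iff, ← h1, column_site h, x.1.2.2, zero_add])
  simp [strip, source, h1]

lemma strip_source_eq_zero (h : 0 < a + b) (r : ℤ × ℤ) (α : Fin p) {l : ℤ}
    (hl : l ≠ layer a b r) : strip (n := n) a b (source r α) l = 0 := by
  funext x g
  have h1 : site a b x.1.1 g l ≠ r := fun h1 => hl (by rw [← h1, layer_site h, x.1.2.1, zero_add])
  simp only [strip, source, h1, false_and, if_false]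
  exact Complex.ofReal_zero

/-- A response, read backward in time strip by strip, is driven by its source. -/
lemma IsPlaneResponse.isDriven [Fintype (Cell a b)] (hP : P.IsPlane) (h : 0 < a + b) (ha : 0 ≤ a)
    (hb : 0 ≤ b) (ht : P.IsTime (height a b)) {r : ℤ × ℤ} {α : Fin p}
    {v : ℤ × ℤ → Mode p n → ℝ} (hv : P.IsPlaneResponse r α v) {l₀ : ℤ} (hl₀ : layer a b r < l₀) :
    Seq.IsDriven (1 - P.transfer a b 0).det
      ((1 - P.transfer a b 0).adjugate * P.transfer a b 1)
      fun t => strip a b v (l₀ - t) := by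
  set K := 1 - P.transfer a b 0 with hK
  have hcausal : ∀ l, layer a b r < l → strip a b v l = 0 := by
    intro l hl
    funext x g
    have h1 : height a b r < height a b (site a b x.1.1 g l) := by
      have h2 := (layer_eq_iff h (x := r)).1 rfl
      have h3 := (layer_eq_iff h (x := site a b x.1.1 g l) (l := l)).1 (by
        rw [layer_site h, x.1.2.1, zero_add])
      have h4 := mul_le_mul_of_nonneg_right (Int.add_one_le_of_lt hl)
        (by omega : 0 ≤ 2 * (a + b))
      linarith
    simp only [strip, hv.causal _ ht _ h1]
    exact Complex.ofReal_zero
  have hstrip : ∀ l, K.det • strip a b v l =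
      Seq.matrixAct _ (K.adjugate * P.transfer a b 1) (strip a b v (l + 1)) +
        Seq.matrixAct _ K.adjugate (strip a b (source r α) l) := by
    intro l
    have h1 : strip a b v l = strip a b (source r α) l + strip a b (P.pull v) l := by
      funext x g
      simp only [strip]
      rw [hv.eq]
      exact Complex.ofReal_add _ _
    rw [strip_pull hP h ha hb ht] at h1
    have h2 : Seq.matrixAct _ K (strip a b v l) = strip a b (source r α) l +
        Seq.matrixAct _ (P.transfer a b 1) (strip a b v (l + 1)) := by
      rw [hK, map_sub, map_one, LinearMap.sub_apply, Module.End.one_apply, sub_eq_iff_eq_add]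
      refine h1.trans ?_
      abel
    have h3 := congrArg (Seq.matrixAct _ K.adjugate) h2
    rw [← Module.End.mul_apply, ← map_mul, adjugate_mul, map_smul, map_one, map_add,
      LinearMap.smul_apply, Module.End.one_apply] at h3
    rw [h3, map_mul, Module.End.mul_apply, add_comm]
  have hlt : ∀ t : ℕ, l₀ - ((t + 1 : ℕ) : ℤ) + 1 = l₀ - t := fun t => by push_cast; ring
  refine ⟨?_, fun j => ?_, fun t j => ?_, (l₀ - layer a b r).toNat, fun t ht' j => ?_⟩
  · exact hcausal _ (by simpa using hl₀)
  · have h1 := (summable_sq_site h hv.summable j.1 j.2).comp_injective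
      (i := fun x : ℕ × ℤ => (l₀ - x.1, x.2)) fun x y hxy => by
        have := Prod.mk.inj hxy
        exact Prod.ext (by omega) this.2
    refine h1.congr fun x => ?_
    simp [strip]
  · have h1 := congrFun (hstrip (l₀ - ((t + 1 : ℕ) : ℤ))) j
    rw [hlt, Pi.add_apply, Pi.smul_apply, Seq.matrixAct_apply] at h1
    rw [h1, add_sub_cancel_left, Seq.matrixAct_apply]
    exact Seq.finSupport.sum_mem fun x _ =>
      Seq.finSupport.smul_mem _ (strip_source_mem_finSupport h r α _ x)
  · have h1 := congrFun (hstrip (l₀ - ((t + 1 : ℕ) : ℤ))) j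
    rw [hlt, strip_source_eq_zero h r α (by push_cast; omega), map_zero, add_zero, Pi.smul_apply,
      Seq.matrixAct_apply] at h1
    exact h1

/-- The total correlation between two components of two fields is a sum over all strips. -/
lemma totalCorr_strip [Fintype (Cell a b)] (h : 0 < a + b) {v v' : ℤ × ℤ → Mode p n → ℝ}
    (hv : Summable fun s => v s ⬝ᵥ v s) (hv' : Summable fun s => v' s ⬝ᵥ v' s) {l₀ : ℤ}
    (hl₀ : ∀ s, l₀ < layer a b s → v s = 0) (i : Cell a b) (μ ν : Mode p n) (m : ℤ) :
    HasSum (fun y : ℤ × ℤ => (v (site a b i.1 y.2 y.1) μ * v' (site a b i.1 (y.2 - m) y.1) ν : ℂ))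
      (Seq.totalCorr (fun t : ℕ => strip a b v (l₀ - t)) (fun t : ℕ => strip a b v' (l₀ - t))
        (i, μ) (i, ν) m) := by
  have hs : Summable fun y : ℤ × ℤ =>
      (v (site a b i.1 y.2 y.1) μ * v' (site a b i.1 (y.2 - m) y.1) ν : ℂ) := by
    have h1 := summable_sq_site h hv i μ
    have h2 := (summable_sq_site h hv' i ν).comp_injective
      (i := fun y : ℤ × ℤ => (y.1, y.2 - m)) fun x y hxy => by
        have := Prod.mk.inj hxy
        exact Prod.ext this.1 (sub_left_injective this.2)
    refine Summable.of_norm_bounded (h1.add h2) fun y => ?_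
    rw [← Complex.ofReal_mul, Complex.norm_real, Real.norm_eq_abs, abs_mul, Function.comp,
      ← sq_abs, ← sq_abs (v' _ _)]
    nlinarith [sq_nonneg (|v (site a b i.1 y.2 y.1) μ| - |v' (site a b i.1 (y.2 - m) y.1) ν|),
      sq_nonneg |v (site a b i.1 y.2 y.1) μ|, sq_nonneg |v' (site a b i.1 (y.2 - m) y.1) ν|]
  have hinj : Function.Injective fun x : ℕ × ℤ => (l₀ - (x.1 : ℤ), x.2) := fun x y hxy => by
    have := Prod.mk.inj hxy
    exact Prod.ext (by omega) this.2
  have hs' := hs.comp_injective hinj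
  have htot : ∑' x : ℕ × ℤ, (v (site a b i.1 x.2 (l₀ - x.1)) μ *
      v' (site a b i.1 (x.2 - m) (l₀ - x.1)) ν : ℂ) =
      Seq.totalCorr (fun t : ℕ => strip a b v (l₀ - t)) (fun t : ℕ => strip a b v' (l₀ - t))
        (i, μ) (i, ν) m := hs'.tsum_prod
  rw [← htot]
  refine (hinj.hasSum_iff (f := fun y : ℤ × ℤ =>
    (v (site a b i.1 y.2 y.1) μ * v' (site a b i.1 (y.2 - m) y.1) ν : ℂ)) fun y hy => ?_).1
    hs'.hasSum
  have : l₀ < y.1 := by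
    by_contra hle
    refine hy ⟨((l₀ - y.1).toNat, y.2), Prod.ext ?_ rfl⟩
    simp only
    omega
  rw [hl₀ _ (by rw [layer_site h, i.2.1]; omega), Pi.zero_apply, Complex.ofReal_zero, zero_mul]

/-- The bulk two-point function between the lines through `r` and `r'` is a combination of total
correlations of the strips. -/
lemma bulkCorr_eq_sum_totalCorr [Fintype (Cell a b)] (hP : P.IsPlane) (h : 0 < a + b)
    (r r' : ℤ × ℤ) (α β : Fin p) {l₀ : ℤ}
    (hl₀ : ∀ s, l₀ < layer a b s → planeResponse hP r α s = 0) (m : ℤ) :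
    (bulkCorr hP r (r' + 2 • m • (a, -b)) α β : ℂ) =
      ∑ i : Cell a b, ∑ μ, ∑ ν, (P.tensor i.1 μ ν : ℂ) *
        Seq.totalCorr (fun t : ℕ => strip a b (planeResponse hP r α) (l₀ - t))
          (fun t : ℕ => strip a b (planeResponse hP r' β) (l₀ - t)) (i, μ) (i, ν) m := by
  have hv := (isPlaneResponse_planeResponse hP r α).summable
  have hv' := (isPlaneResponse_planeResponse hP r' β).summable
  set v := planeResponse hP r α
  set v' := planeResponse hP r' β
  have hcell : ∀ i : Cell a b, HasSum (fun y : ℤ × ℤ =>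
      ((v (site a b i.1 y.2 y.1) ⬝ᵥ P.tensor (site a b i.1 y.2 y.1) *ᵥ
        v' (site a b i.1 y.2 y.1 - 2 • m • (a, -b)) : ℝ) : ℂ))
      (∑ μ, ∑ ν, (P.tensor i.1 μ ν : ℂ) *
        Seq.totalCorr (fun t : ℕ => strip a b v (l₀ - t)) (fun t : ℕ => strip a b v' (l₀ - t))
          (i, μ) (i, ν) m) := by
    intro i
    have h1 := hasSum_sum (s := Finset.univ) fun μ (_ : μ ∈ Finset.univ) =>
      hasSum_sum (s := Finset.univ) fun ν (_ : ν ∈ Finset.univ) =>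
        (totalCorr_strip h hv hv' hl₀ i μ ν m).mul_left (P.tensor i.1 μ ν : ℂ)
    refine h1.congr_fun fun y => ?_
    have e1 : site a b i.1 y.2 y.1 - 2 • m • (a, -b) = site a b i.1 (y.2 - m) y.1 := by
      rw [site, site, sub_smul]
      simp only [smul_add, smul_sub]
      abel
    rw [e1, hP.tensor_site]
    simp only [dotProduct, mulVec, Complex.ofReal_sum, Complex.ofReal_mul, Finset.mul_sum]
    refine Finset.sum_congr rfl fun μ _ => Finset.sum_congr rfl fun ν _ => ?_
    ring
  have hsum : Summable fun x => v x ⬝ᵥ P.tensor x *ᵥ v' (x - 2 • m • (a, -b)) :=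
    hP.summable_noise_form hv (v' := fun x => v' (x - 2 • m • (a, -b)))
      (hv'.comp_injective (i := fun x => x - 2 • m • (a, -b)) sub_left_injective)
  have hbulk : bulkCorr hP r (r' + 2 • m • (a, -b)) α β =
      ∑' x, v x ⬝ᵥ P.tensor x *ᵥ v' (x - 2 • m • (a, -b)) :=
    tsum_congr fun x => by
      have : planeResponse hP (r' + 2 • m • (a, -b)) β x = v' (x - 2 • m • (a, -b)) :=
        planeResponse_translate hP r' (m • (a, -b)) β x
      rw [this]
  have hsum' := (coordEquiv h).summable_iff.2 (Complex.hasSum_ofReal.2 hsum.hasSum).summable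
  rw [hbulk, Complex.ofReal_tsum, ← (coordEquiv h).tsum_eq]
  refine hsum'.tsum_prod.trans ?_
  rw [tsum_fintype]
  exact Finset.sum_congr rfl fun i _ => (hcell i).tsum_eq

/-- Along a direction in which time does not advance, the two-point function between two lines of
sites decays exponentially, with a rate that does not depend on the lines. -/
lemma IsPlane.exists_bulkCorr_mem_expDecay (hP : P.IsPlane) (h : 0 < a + b) (ha : 0 ≤ a)
    (hb : 0 ≤ b) (ht : P.IsTime (height a b)) :
    ∃ κ > 0, ∀ r r' α β, (fun m : ℤ => (bulkCorr hP r (r' + 2 • m • (a, -b)) α β : ℂ) : Seq) ∈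
      Seq.expDecay κ := by
  have := finite_cell h
  let _ : Fintype (Cell a b) := Fintype.ofFinite _
  obtain ⟨κ, hκ, H⟩ := Seq.exists_totalCorr_mem_expDecay
    (det_one_sub_transfer_ne_zero hP h ha hb ht)
    ((1 - P.transfer a b 0).adjugate * P.transfer a b 1)
  refine ⟨κ, hκ, fun r r' α β => ?_⟩
  set l₀ := max (layer a b r) (layer a b r') + 1
  have hr := isPlaneResponse_planeResponse hP r α
  have hr' := isPlaneResponse_planeResponse hP r' β
  have hH := H _ _ (hr.isDriven hP h ha hb ht (l₀ := l₀) (by omega))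
    (hr'.isDriven hP h ha hb ht (l₀ := l₀) (by omega))
  have hl₀ : ∀ s, l₀ < layer a b s → planeResponse hP r α s = 0 := fun s hs =>
    hr.causal _ ht s (by
      by_contra hle
      have := Int.ediv_le_ediv (by omega : 0 < 2 * (a + b)) (not_lt.1 hle)
      change layer a b s ≤ layer a b r at this
      omega)
  have heq : (fun m : ℤ => (bulkCorr hP r (r' + 2 • m • (a, -b)) α β : ℂ) : Seq) =
      ∑ i : Cell a b, ∑ μ, ∑ ν, C (P.tensor i.1 μ ν : ℂ) •
        Seq.totalCorr (fun t : ℕ => strip a b (planeResponse hP r α) (l₀ - t))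
          (fun t : ℕ => strip a b (planeResponse hP r' β) (l₀ - t)) (i, μ) (i, ν) := by
    funext m
    rw [bulkCorr_eq_sum_totalCorr hP h r r' α β hl₀ m]
    simp only [Seq.sum_apply, Seq.C_smul, Seq.smul_apply]
  rw [heq]
  exact Submodule.sum_mem _ fun i _ => Submodule.sum_mem _ fun μ _ => Submodule.sum_mem _ fun ν _ =>
    Submodule.smul_mem _ _ (hH _ _)

/-- Exponential decay along a direction in which time does not advance. -/
theorem IsPlane.decaysAlong_bulkCorr (hP : P.IsPlane) (h : 0 < a + b) (ha : 0 ≤ a) (hb : 0 ≤ b)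
    (ht : P.IsTime (height a b)) {d : ℤ × ℤ} (hd : d = (a, -b) ∨ d = -(a, -b)) :
    DecaysAlong (bulkCorr hP) d := by
  obtain ⟨κ, hκ, H⟩ := hP.exists_bulkCorr_mem_expDecay h ha hb ht
  choose C hC using H
  refine ⟨2 / κ, by positivity, fun s => ?_⟩
  -- Sites are grouped by their class modulo `2`, and even and odd `m` belong to different lines.
  let F : Finset (ℤ × ℤ) := Finset.Icc 0 1 ×ˢ Finset.Icc 0 1
  let B : ℝ := ∑ r ∈ F, ∑ e ∈ Finset.Icc (0 : ℤ) 1, ∑ α, ∑ β, |C r (r + s + e • d) α β|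
  refine ⟨B * Real.exp κ, fun r m α β => ?_⟩
  have hrF : cellRep r ∈ F := by
    simp only [F, cellRep, Finset.mem_product, Finset.mem_Icc]
    omega
  have heF : m % 2 ∈ Finset.Icc (0 : ℤ) 1 := by
    rw [Finset.mem_Icc]
    omega
  obtain ⟨k, hk, hk'⟩ : ∃ k : ℤ, k • (a, -b) = (m / 2) • d ∧ |k| = |m / 2| := by
    rcases hd with rfl | rfl
    · exact ⟨m / 2, rfl, rfl⟩
    · exact ⟨-(m / 2), by rw [neg_smul, smul_neg], abs_neg _⟩
  have e1 : bulkCorr hP r (r + s + m • d) =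
      bulkCorr hP (cellRep r) (cellRep r + s + (m % 2) • d + 2 • k • (a, -b)) := by
    have e2 : r + s + m • d =
        cellRep r + s + (m % 2) • d + 2 • k • (a, -b) + 2 • cellIndex r := by
      conv_lhs => rw [← cellRep_add r, ← Int.emod_add_mul_ediv m 2]
      rw [hk, add_smul, mul_smul, ofNat_zsmul]
      abel
    have e3 := bulkCorr_translate hP (cellRep r)
      (cellRep r + s + (m % 2) • d + 2 • k • (a, -b)) (cellIndex r)
    rwa [cellRep_add, ← e2] at e3
  have hB : |C (cellRep r) (cellRep r + s + (m % 2) • d) α β| ≤ B := by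
    refine le_trans ?_ (Finset.single_le_sum (f := fun r => ∑ e ∈ Finset.Icc (0 : ℤ) 1, ∑ α, ∑ β,
      |C r (r + s + e • d) α β|) (fun _ _ => by positivity) hrF)
    refine le_trans ?_ (Finset.single_le_sum (f := fun e => ∑ α, ∑ β,
      |C (cellRep r) (cellRep r + s + e • d) α β|) (fun _ _ => by positivity) heF)
    refine le_trans ?_ (Finset.single_le_sum (f := fun α => ∑ β,
      |C (cellRep r) (cellRep r + s + (m % 2) • d) α β|) (fun _ _ => by positivity)
      (Finset.mem_univ α))
    exact Finset.single_le_sum (f := fun β => |C (cellRep r) (cellRep r + s + (m % 2) • d) α β|)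
      (fun _ _ => by positivity) (Finset.mem_univ β)
  have h1 := hC (cellRep r) (cellRep r + s + (m % 2) • d) α β k
  rw [Complex.norm_real, Real.norm_eq_abs] at h1
  rw [e1, mul_assoc, ← Real.exp_add]
  refine h1.trans (mul_le_mul ((le_abs_self _).trans hB) (Real.exp_le_exp.2 ?_)
    (Real.exp_pos _).le ((abs_nonneg _).trans hB))
  have h2 : (|m| : ℤ) ≤ 2 * |k| + 1 := by
    rw [hk', Int.abs_eq_natAbs, Int.abs_eq_natAbs]
    omega
  have h3 : |(m : ℝ)| ≤ 2 * |(k : ℝ)| + 1 := by exact_mod_cast h2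
  have h4 : -|(m : ℝ)| / (2 / κ) = -(κ / 2) * |(m : ℝ)| := by
    field_simp
  rw [h4]
  nlinarith

end Network

/-! ### Time functions of the two networks -/

namespace Network

variable {p n : ℕ} {T : ZMod 2 → Matrix (Mode p n) (Mode p n) ℝ}

lemma isTime_isoPlane {a b : ℤ} (ha : 0 ≤ a) (hb : 0 ≤ b) :
    (isoPlane T).IsTime (height a b) := by
  intro s e he
  cases e
  · exact absurd (Or.inl rfl) he
  · simpa [step, isoPlane, height_apply] using hb
  · simpa [step, isoPlane, height_apply] using ha
  · exact absurd (Or.inr rfl) he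

lemma isTime_altIsoTNS : (altIsoTNS T).IsTime (height 1 0) := by
  intro s e he
  cases e
  · simp [step, altIsoTNS, height_apply]
  · simp [step, altIsoTNS, height_apply]
  · simp [step, altIsoTNS, height_apply]
  · exact absurd ((altIsoTNS_inc s _).2 (Or.inl rfl)) he

/-- A space-like or light-like direction is, up to its sign, one along which some linear time
function of the isometric tensor network state is constant. -/
lemma exists_eq_of_mul_nonpos {d : ℤ × ℤ} (hd : d ≠ 0) (h : d.1 * d.2 ≤ 0) :
    ∃ a b : ℤ, 0 ≤ a ∧ 0 ≤ b ∧ 0 < a + b ∧ (d = (a, -b) ∨ d = -(a, -b)) := by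
  obtain ⟨x, y⟩ := d
  have hne : x ≠ 0 ∨ y ≠ 0 := by
    by_contra! hc
    exact hd (Prod.ext hc.1 hc.2)
  rcases mul_nonpos_iff.1 h with ⟨hx, hy⟩ | ⟨hx, hy⟩
  · simp only at hx hy
    exact ⟨x, -y, hx, by omega, by omega, Or.inl (by rw [neg_neg])⟩
  · simp only at hx hy
    exact ⟨-x, y, by omega, hy, by omega, Or.inr (by ext <;> simp)⟩

end Network

end GaussianTNS

theorem mainTheorem5 (p n : ℕ) :
    (∀ T : ZMod 2 → Matrix (GaussianTNS.Mode p n) (GaussianTNS.Mode p n) ℝ,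
      (∀ c, GaussianTNS.IsIsometricTensor GaussianTNS.isoIn (T c)) →
      ∃ G : ℤ × ℤ → ℤ × ℤ → Matrix (Fin p) (Fin p) ℝ,
        GaussianTNS.IsBulkCorrelationIso T G ∧
        -- the spatial direction
        GaussianTNS.DecaysAlong G (1, -1) ∧
        -- all space-like and light-like directions
        ∀ d : ℤ × ℤ, d ≠ 0 → d.1 * d.2 ≤ 0 → GaussianTNS.DecaysAlong G d) ∧
    (∀ T : ZMod 2 → Matrix (GaussianTNS.Mode p n) (GaussianTNS.Mode p n) ℝ,
      GaussianTNS.IsIsometricTensor GaussianTNS.isoIn (T 0) →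
      GaussianTNS.IsIsometricTensor GaussianTNS.altIn (T 1) →
      ∃ G : ℤ × ℤ → ℤ × ℤ → Matrix (Fin p) (Fin p) ℝ,
        GaussianTNS.IsBulkCorrelationAlt T G ∧
        GaussianTNS.DecaysAlong G (1, 0)) := by
  refine ⟨fun T hT => ?_, fun T h0 h1 => ?_⟩
  · have hdecay : ∀ d : ℤ × ℤ, d ≠ 0 → d.1 * d.2 ≤ 0 → GaussianTNS.DecaysAlong
        (GaussianTNS.Network.bulkCorr (GaussianTNS.isPlane_isoPlane hT)) d := by
      intro d hd h
      obtain ⟨a, b, ha, hb, hab, hd'⟩ := GaussianTNS.Network.exists_eq_of_mul_nonpos hd h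
      exact (GaussianTNS.isPlane_isoPlane hT).decaysAlong_bulkCorr hab ha hb
        (GaussianTNS.Network.isTime_isoPlane ha hb) hd'
    exact ⟨_, GaussianTNS.isBulkCorrelationIso_bulkCorr hT,
      hdecay (1, -1) (by simp) (by norm_num), hdecay⟩
  · have hP := GaussianTNS.isPlane_altIsoTNS h0 h1
    exact ⟨_, GaussianTNS.isBulkCorrelationAlt_bulkCorr hP,
      hP.decaysAlong_bulkCorr (a := 1) (b := 0) (by norm_num) (by norm_num) le_rfl
        GaussianTNS.Network.isTime_altIsoTNS (Or.inl (by simp))⟩
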